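/- Let $\mathbb{F}_q$ be a finite field with $q$ elements, $A=\mathbb{F}_q[\theta]$, and let $A_+\subset A$ be the set of monic polynomials. Let $\phi$ be a Drinfeld $A$-module of rank $r\ge 1$ over $A$, i.e. the $\mathbb{F}_q$-algebra homomorphism $\phi\colon A\to A\{\tau\}$ given by $$\phi_\theta=\theta+\phi_{\theta,1}\tau+\dots+\phi_{\theta,r}\tau^r,\qquad \phi_{\theta,i}\in A,\ \phi_{\theta,r}\ne 0,$$ where $\tau x=x^q\tau$. *The function $\mu$.* Let $f\in A_+$ be irreducible of degree $d$, let $\overline{\phi}$ be the reduction of $\phi$ modulo $f$, and let $r_0\in\{0,\dots,r\}$ be its degree in $\tau$ (with $r_0=0$ if $f\mid\phi_{\theta,i}$ for all $i\ge 1$). For every irreducible $h\in A_+$ with $h\neq f$, the Tate module $T_h(\overline{\phi})=\varprojlim_m\overline{\phi}[h^m]$, formed in an algebraic closure of $A/fA$, is a free module of rank $r_0$ over the $h$-adic completion of $A$. The characteristic polynomial $P(x)=x^{r_0}+p_{r_0-1}x^{r_0-1}+\dots+p_0$ of the action of $\tau^d$ on it lies in $A[x]$ and does not depend on $h$, and if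 $r_0\ge1$ then $p_0=c(f)^{-1}f$ with $c(f)\in\mathbb{F}_q^\times$. Put $p_{r_0}=1$ and $$D_f(x)=1+\sum_{i=1}^{r_0}c(f)\,p_i\,f^{i-1}x^i$$ (so $D_f=1$ if $r_0=0$). Let $\mu\colon A_+\to A$ be the multiplicative function with $\sum_{i\ge0}\mu(f^i)x^i=D_f(x)^{-1}$ for all irreducible $f\in A_+$; that is, $\mu(a)$ are the coefficients of the dual Goss $L$-series $L(\phi^\vee,s-1)=\prod_f D_f(f^{-s})^{-1}=\sum_{a\in A_+}\mu(a)a^{-s}$. *The Taelman $L$-value.* Let $n\ge0$, let $z_1,\dots,z_n$ be indeterminates, put $k=\mathbb{F}_q(z_1,\dots,z_n)$ and $\mathbb{A}=k[\theta]$, and let $\tau\colon\mathbb{A}\to\mathbb{A}$ be the $k$-algebra homomorphism with $\tau(\theta)=\theta^q$. Put $\ell_i(z_j)=\prod_{m=0}^{i-1}(z_j-\theta^{q^m})$, and let $\varphi\colon\mathbb{A}\to\mathbb{A}\{\tau\}$ be the Drinfeld $\mathbb{A}$-module, i.e. the $k$-algebra homomorphism, given by $$\varphi_\theta=\sum_{i=0}^r\ell_i(z_1)\cdots\ell_i(z_n)\,\phi_{\theta,i}\,\tau^i,\qquad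 \phi_{\theta,0}=\theta.$$ For irreducible $f\in A_+$ let $\varphi(\mathbb{A}/f\mathbb{A})$ be the quotient $\mathbb{A}/f\mathbb{A}$ with the $\mathbb{A}$-module structure in which $\theta$ acts as $\varphi_\theta$. For an $\mathbb{A}$-module $M$ of finite dimension over $k$, let $[M]_{\mathbb{A}}\in\mathbb{A}$ be the monic generator of its Fitting ideal, i.e. $[M]_{\mathbb{A}}=f_1\cdots f_s$ if $M\cong\bigoplus_{i=1}^s\mathbb{A}/f_i\mathbb{A}$ with $f_i$ monic in $\theta$. **Theorem.** The Euler product $$L(\varphi,\mathbb{A})=\prod_{f}\frac{[\mathbb{A}/f\mathbb{A}]_{\mathbb{A}}}{[\varphi(\mathbb{A}/f\mathbb{A})]_{\mathbb{A}}}$$ over the irreducible $f\in A_+$ converges in $\mathbb{F}_q(z_1,\dots,z_n)((\theta^{-1}))$ with its $\theta^{-1}$-adic topology, and there $$L(\varphi,\mathbb{A})=\sum_{a\in A_+}\frac{\mu(a)\,a(z_1)\cdots a(z_n)}{a},$$ where the series converges as well, both unconditionally (in any order), and $a(z_j)$ denotes the evaluation of $a$ at $\theta=z_j$. -/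

import Mathlib

open Polynomial

noncomputable section

namespace Taelman

/-! ### Tate modules -/

section TateModule

variable {R : Type*} [CommRing R]

/-- The `h ^ m`-torsion of the `R`-module `V`, as a type of its own. -/
def Torsion (V : Type*) [AddCommGroup V] [Module R V] (h : R) (m : ℕ) : Type _ :=
  Submodule.torsionBySet R V ((Ideal.span {h} ^ m : Ideal R) : Set R)

variable (V : Type*) [AddCommGroup V] [Module R V] (h : R)

instance (m : ℕ) : AddCommGroup (Torsion V h m) :=
  inferInstanceAs
    (AddCommGroup (Submodule.torsionBySet R V ((Ideal.span {h} ^ m : Ideal R) : Set R)))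

/-- The `h ^ m`-torsion is a module over `R ⧸ (h) ^ m`. -/
instance (m : ℕ) : Module (R ⧸ (Ideal.span {h} ^ m : Ideal R)) (Torsion V h m) :=
  inferInstanceAs (Module (R ⧸ (Ideal.span {h} ^ m : Ideal R))
    (Submodule.torsionBySet R V ((Ideal.span {h} ^ m : Ideal R) : Set R)))

/-- Through the projection `R_h → R ⧸ (h) ^ m`, the `h ^ m`-torsion is a module over the `h`-adic
completion `R_h` of `R`. -/
instance (m : ℕ) : Module (AdicCompletion (Ideal.span {h}) R) (Torsion V h m) :=
  Module.compHom _ (AdicCompletion.evalₐ (Ideal.span {h}) m).toRingHom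

variable {V h} in
/-- The element of `V` underlying a torsion element. -/
def Torsion.val {m : ℕ} (x : Torsion V h m) : V := Subtype.val x

variable {V h} in
theorem Torsion.val_add {m : ℕ} (x y : Torsion V h m) : (x + y).val = x.val + y.val := rfl

variable {V h} in
theorem Torsion.val_zero {m : ℕ} : (0 : Torsion V h m).val = 0 := rfl

variable {V h} in
/-- An element `a` of the completion acts on the `h ^ m`-torsion as any `r : R` that is congruent
to `a` modulo `h ^ m`. -/
theorem Torsion.val_smul {m : ℕ} (a : AdicCompletion (Ideal.span {h}) R) (x : Torsion V h m)
    (r : R) (hr : AdicCompletion.evalₐ (Ideal.span {h}) m a = Ideal.Quotient.mk _ r) :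
    (a • x).val = r • x.val := by
  change ((AdicCompletion.evalₐ (Ideal.span {h}) m a) • x).val = _
  rw [hr]
  rfl

/-- The `h`-adic Tate module `T_h(V)`: the inverse limit of the torsion modules `V[h ^ m]` along
multiplication by `h`, a module over the `h`-adic completion of `R`. -/
def tateModule : Submodule (AdicCompletion (Ideal.span {h}) R) ((m : ℕ) → Torsion V h m) where
  carrier := {x | ∀ m, h • (x (m + 1)).val = (x m).val}
  add_mem' := by
    intro x y hx hy m
    simp only [Pi.add_apply, Torsion.val_add, smul_add, hx m, hy m]
  zero_mem' := by
    intro m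
    simp [Torsion.val_zero]
  smul_mem' := by
    intro a x hx m
    obtain ⟨r, hr⟩ := Ideal.Quotient.mk_surjective
      (AdicCompletion.evalₐ (Ideal.span {h}) (m + 1) a)
    have hr' : AdicCompletion.evalₐ (Ideal.span {h}) m a = Ideal.Quotient.mk _ r := by
      obtain ⟨s, rfl⟩ := AdicCompletion.mk_surjective (Ideal.span {h}) R a
      rw [AdicCompletion.evalₐ_mk] at hr ⊢
      rw [Ideal.Quotient.eq] at hr ⊢
      have h1 := s.2 (Nat.le_succ m)
      rw [SModEq.sub_mem] at h1
      have h2 := Ideal.pow_le_pow_right (Nat.le_succ m) hr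
      have h3 : s.val m - s.val (m + 1) ∈ (Ideal.span {h} ^ m : Ideal R) := by
        simpa using h1
      have := sub_mem h3 h2
      simpa using this
    simp only [Pi.smul_apply]
    rw [Torsion.val_smul a _ r hr.symm, Torsion.val_smul a _ r hr', smul_comm, hx m]

variable {V} in
/-- An `R`-linear endomorphism of `V` acts on `T_h(V)`, componentwise. -/
def tateMap (F : V →ₗ[R] V) :
    tateModule V h →ₗ[AdicCompletion (Ideal.span {h}) R] tateModule V h where
  toFun x := ⟨fun m => ⟨F (x.1 m).val, by
      have hx := (Submodule.mem_torsionBySet_iff _ _).1 (x.1 m).2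
      refine (Submodule.mem_torsionBySet_iff _ _).2 fun a => ?_
      rw [← map_smul]
      exact (congrArg F (hx a)).trans (map_zero F)⟩, fun m => by
      change h • F (x.1 (m + 1)).val = F (x.1 m).val
      rw [← map_smul, x.2 m]⟩
  map_add' x y := by
    refine Subtype.ext (funext fun m => Subtype.ext ?_)
    exact map_add F (x.1 m).val (y.1 m).val
  map_smul' a x := by
    refine Subtype.ext (funext fun m => ?_)
    obtain ⟨r, hr⟩ := Ideal.Quotient.mk_surjective (AdicCompletion.evalₐ (Ideal.span {h}) m a)
    refine Subtype.ext ?_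
    refine Eq.trans ?_ (Torsion.val_smul a _ r hr.symm).symm
    change F (a • x.1 m).val = r • F (x.1 m).val
    rw [Torsion.val_smul a _ r hr.symm, map_smul]

end TateModule

/-! ### Fitting ideals -/

/-- `IsFittingGenerator k M g`: the `k[θ]`-module `M` is isomorphic to a finite direct sum
`⨁ k[θ] / (g i)` with all `g i` monic, and `g = ∏ g i`. -/
def IsFittingGenerator (k : Type*) [Field k] (M : Type*) [AddCommGroup M] [Module k[X] M]
    (g : k[X]) : Prop :=
  ∃ (s : ℕ) (c : Fin s → k[X]), (∀ i, (c i).Monic) ∧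
    Nonempty (M ≃ₗ[k[X]] ((i : Fin s) → k[X] ⧸ Ideal.span {c i})) ∧ g = ∏ i, c i

open Classical in
/-- The monic generator `[M]` of the Fitting ideal of a `k[θ]`-module `M` of finite dimension
over `k`. -/
def fittingGenerator (k : Type*) [Field k] (M : Type*) [AddCommGroup M] [Module k[X] M] : k[X] :=
  if hM : ∃ g, IsFittingGenerator k M g then hM.choose else 1

/-! ### Drinfeld modules -/

/-- The action `x ↦ ∑ c i * τ ^ i x` of the skew polynomial `∑ c i τ ^ i` on a `k`-algebra `B` with
a `k`-algebra endomorphism `τ`. -/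
def skewAction {k B : Type*} [Field k] [CommRing B] [Algebra k B] (τ : B →ₐ[k] B) {r : ℕ}
    (c : Fin (r + 1) → B) : B →ₗ[k] B :=
  ∑ i, LinearMap.mulLeft k (c i) ∘ₗ (τ ^ (i : ℕ)).toLinearMap

theorem skewAction_apply {k B : Type*} [Field k] [CommRing B] [Algebra k B] (τ : B →ₐ[k] B)
    {r : ℕ} (c : Fin (r + 1) → B) (x : B) :
    skewAction τ c x = ∑ i, c i * (τ ^ (i : ℕ)) x := by
  simp [skewAction]

variable (Fq : Type*) [Field Fq]

/-- A Drinfeld `A`-module of rank `r` over `A = Fq[θ]`. An `Fq`-algebra homomorphism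
`A → A{τ}` is the same as an element `φ_θ = ∑ coeff i τ ^ i` of `A{τ}`. -/
structure DrinfeldModule (r : ℕ) where
  coeff : Fin (r + 1) → Fq[X]
  rank_pos : 1 ≤ r
  coeff_zero : coeff 0 = X
  coeff_last : coeff (Fin.last r) ≠ 0

/-- The set `A₊` of monic polynomials. -/
abbrev MonicPoly := {a : Fq[X] // a.Monic}

/-- The set of monic irreducible polynomials. -/
abbrev MonicPrime := {f : Fq[X] // f.Monic ∧ Irreducible f}

variable {Fq}

instance (f : MonicPrime Fq) : Fact (Irreducible f.1) := ⟨f.2.2⟩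

/-- An algebraic closure of the residue field `A / f`. -/
abbrev ResidueClosure (f : MonicPrime Fq) := AlgebraicClosure (AdjoinRoot f.1)

/-- The image of `θ` in the algebraic closure of `A / f`. -/
def thetaBar (f : MonicPrime Fq) : ResidueClosure f :=
  algebraMap (AdjoinRoot f.1) (ResidueClosure f) (AdjoinRoot.root f.1)

variable [Fintype Fq]

theorem thetaBar_pow (f : MonicPrime Fq) :
    thetaBar f ^ Fintype.card Fq ^ f.1.natDegree = thetaBar f := by
  have hf : f.1 ≠ 0 := f.2.2.ne_zero
  let pb := AdjoinRoot.powerBasis hf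
  have : Module.Finite Fq (AdjoinRoot f.1) := pb.finite
  have : Finite (AdjoinRoot f.1) := Module.finite_of_finite Fq
  let _ := Fintype.ofFinite (AdjoinRoot f.1)
  have hc : Fintype.card (AdjoinRoot f.1) = Fintype.card Fq ^ f.1.natDegree := by
    rw [Module.card_eq_pow_finrank (K := Fq) (V := AdjoinRoot f.1), pb.finrank]
    rfl
  rw [thetaBar, ← map_pow, ← hc, FiniteField.pow_card]

namespace DrinfeldModule

variable {r : ℕ} (φ : DrinfeldModule Fq r)

/-- The reduction of `φ_θ` modulo `f` acting on the algebraic closure of `A / f`, with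
`τ x = x ^ q`. -/
def reductionAction (f : MonicPrime Fq) : ResidueClosure f →ₗ[Fq] ResidueClosure f :=
  skewAction (FiniteField.frobeniusAlgHom Fq (ResidueClosure f))
    fun i => aeval (thetaBar f) (φ.coeff i)

/-- The algebraic closure of `A / f` as an `A`-module through the reduction of `φ` at `f`. -/
abbrev ReductionModule (f : MonicPrime Fq) : Type _ := Module.AEval' (φ.reductionAction f)

theorem frobenius_pow_apply (f : MonicPrime Fq) (n : ℕ) (x : ResidueClosure f) :
    (FiniteField.frobeniusAlgHom Fq (ResidueClosure f) ^ n) x = x ^ Fintype.card Fq ^ n := by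
  induction n generalizing x with
  | zero => simp
  | succ n ih =>
    rw [pow_succ, AlgHom.mul_apply, ih, FiniteField.coe_frobeniusAlgHom, pow_succ', pow_mul]

theorem frobenius_reductionAction (f : MonicPrime Fq) (x : ResidueClosure f) :
    (FiniteField.frobeniusAlgHom Fq (ResidueClosure f) ^ f.1.natDegree) (φ.reductionAction f x) =
      φ.reductionAction f
        ((FiniteField.frobeniusAlgHom Fq (ResidueClosure f) ^ f.1.natDegree) x) := by
  simp only [reductionAction, skewAction_apply, map_sum, map_mul]
  refine Finset.sum_congr rfl fun i _ => ?_
  congr 1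
  · rw [← Polynomial.aeval_algHom_apply, frobenius_pow_apply, thetaBar_pow]
  · rw [← AlgHom.mul_apply, ← AlgHom.mul_apply, ← pow_add, ← pow_add, add_comm]

/-- The Frobenius `τ ^ d : x ↦ x ^ (q ^ d)`, `d = deg f`, as an endomorphism of the `A`-module
given by the reduction of `φ` at `f`. -/
def frobenius (f : MonicPrime Fq) : φ.ReductionModule f →ₗ[Fq[X]] φ.ReductionModule f :=
  LinearMap.ofAEval _
    ((Module.AEval'.of (φ.reductionAction f)).toLinearMap ∘ₗ
      (FiniteField.frobeniusAlgHom Fq (ResidueClosure f) ^ f.1.natDegree).toLinearMap)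
    (fun x => by
      have := φ.frobenius_reductionAction f x
      simp only [LinearMap.comp_apply, AlgHom.toLinearMap_apply, LinearEquiv.coe_coe,
        Module.AEval'.X_smul_of, Module.End.smul_def]
      rw [this])

/-- `P` is the characteristic polynomial of the action of `τ ^ d` on the Tate module `T_h` of
the reduction of `φ` at `f` (which is free of finite rank over the completion `A_h`). -/
def IsFrobeniusCharpolyAt (f h : MonicPrime Fq) (P : Fq[X][X]) : Prop :=
  ∃ (s : ℕ) (b : Module.Basis (Fin s) (AdicCompletion (Ideal.span {h.1}) Fq[X])
      (tateModule (φ.ReductionModule f) h.1)),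
    (LinearMap.toMatrix b b (tateMap h.1 (φ.frobenius f))).charpoly =
      P.map (algebraMap Fq[X] (AdicCompletion (Ideal.span {h.1}) Fq[X]))

open Classical in
/-- The characteristic polynomial `P ∈ A[x]` of the action of `τ ^ d` on the Tate modules `T_h` of
the reduction of `φ` at `f`; it is the same for all monic irreducible `h ≠ f`. -/
def frobeniusCharpoly (f : MonicPrime Fq) : Fq[X][X] :=
  if hP : ∃ P, ∀ h : MonicPrime Fq, h ≠ f → φ.IsFrobeniusCharpolyAt f h P then hP.choose else 1

/-- The rank `r₀` of the reduction of `φ` at `f`: the largest `i` such that `φ_{θ,i}` is not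
divisible by `f` (and `0` if there is no `i ≥ 1` of that kind). -/
def reductionRank (f : MonicPrime Fq) : ℕ :=
  sSup {i : ℕ | ∃ hi : i < r + 1, ¬ f.1 ∣ φ.coeff ⟨i, hi⟩}

/-- The constant `c(f) ∈ Fqˣ` with `P(0) = c(f)⁻¹ f`. -/
def frobeniusConst (f : MonicPrime Fq) : Fq :=
  ((φ.frobeniusCharpoly f).coeff 0).leadingCoeff⁻¹

/-- The Euler factor `D_f(x) = 1 + ∑_{i=1}^{r₀} c(f) p_i f^{i-1} x^i`, where `p_i` are the
coefficients of the characteristic polynomial of Frobenius; it is `1` if `r₀ = 0`. -/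
def eulerFactor (f : MonicPrime Fq) : Fq[X][X] :=
  1 + ∑ i ∈ Finset.Icc 1 (φ.reductionRank f),
    C (C (φ.frobeniusConst f) * (φ.frobeniusCharpoly f).coeff i * f.1 ^ (i - 1)) * X ^ i

/-- The value `μ(f ^ i)`, given by `∑ μ(f ^ i) x ^ i = D_f(x)⁻¹`. -/
def muPrimePow (f : MonicPrime Fq) (i : ℕ) : Fq[X] :=
  PowerSeries.coeff i (PowerSeries.invOfUnit (φ.eulerFactor f : PowerSeries Fq[X]) 1)

/-- The multiplicative function `μ : A₊ → A` with `L(φ^∨, s - 1) = ∏_f D_f(f^{-s})⁻¹ =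
∑_a μ(a) / a^s`. -/
def mu (a : MonicPoly Fq) : Fq[X] :=
  ∏ᶠ f : MonicPrime Fq, φ.muPrimePow f (multiplicity f.1 a.1)

end DrinfeldModule

/-! ### The twisted module over `𝔸 = Fq(z_1, …, z_n)[θ]` -/

variable (Fq) in
/-- The field `Fq(z_1, …, z_n)`; the ring `𝔸` is `(ZField Fq n)[X]`. -/
abbrev ZField (n : ℕ) := FractionRing (MvPolynomial (Fin n) Fq)

variable (Fq) in
/-- The variable `z_k` as an element of `Fq(z_1, …, z_n)`. -/
def z {n : ℕ} (k : Fin n) : ZField Fq n :=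
  algebraMap (MvPolynomial (Fin n) Fq) (ZField Fq n) (MvPolynomial.X k)

variable (Fq) in
/-- The inclusion `A → 𝔸`. -/
def toZ (n : ℕ) : Fq[X] →+* (ZField Fq n)[X] := mapRingHom (algebraMap Fq (ZField Fq n))

variable (Fq) in
/-- `τ : 𝔸 → 𝔸`, the `Fq(z_1, …, z_n)`-algebra homomorphism with `τ θ = θ ^ q`. -/
def tauZ (n : ℕ) : (ZField Fq n)[X] →ₐ[ZField Fq n] (ZField Fq n)[X] :=
  expand (ZField Fq n) (Fintype.card Fq)

variable (Fq) in
/-- `ℓ_i(z_k) = ∏_{j=0}^{i-1} (z_k - θ^{q^j})`. -/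
def ell {n : ℕ} (i : ℕ) (k : Fin n) : (ZField Fq n)[X] :=
  ∏ j ∈ Finset.range i, (C (z Fq k) - X ^ Fintype.card Fq ^ j)

variable (Fq) in
theorem tauZ_toZ (n : ℕ) (f : Fq[X]) : tauZ Fq n (toZ Fq n f) = toZ Fq n f ^ Fintype.card Fq := by
  rw [tauZ, toZ, coe_mapRingHom, ← map_expand, FiniteField.expand_card, Polynomial.map_pow]

theorem tauZ_pow_mem (n : ℕ) (f : Fq[X]) (i : ℕ) {x : (ZField Fq n)[X]}
    (hx : x ∈ Ideal.span {toZ Fq n f}) : (tauZ Fq n ^ i) x ∈ Ideal.span {toZ Fq n f} := by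
  induction i with
  | zero => simpa using hx
  | succ i ih =>
    rw [pow_succ', AlgHom.mul_apply]
    obtain ⟨y, hy⟩ := Ideal.mem_span_singleton.1 ih
    rw [hy, map_mul, tauZ_toZ]
    exact Ideal.mul_mem_right _ _ (Ideal.pow_mem_of_mem _ (Ideal.mem_span_singleton_self _) _
      Fintype.card_pos)

namespace DrinfeldModule

variable {r : ℕ} (φ : DrinfeldModule Fq r) (n : ℕ)

/-- The coefficients `ℓ_i(z_1) ⋯ ℓ_i(z_n) φ_{θ,i}` of the Drinfeld `𝔸`-module `ϕ` attached
to `φ`. -/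
def twistCoeff (i : Fin (r + 1)) : (ZField Fq n)[X] :=
  (∏ k : Fin n, ell Fq (i : ℕ) k) * toZ Fq n (φ.coeff i)

/-- The action of `ϕ_θ` on `𝔸`. -/
def twistAction : (ZField Fq n)[X] →ₗ[ZField Fq n] (ZField Fq n)[X] :=
  skewAction (tauZ Fq n) (φ.twistCoeff n)

/-- The action of `ϕ_θ` on `𝔸 / f𝔸`. -/
def twistQuotientAction (f : Fq[X]) :
    ((ZField Fq n)[X] ⧸ (Ideal.span {toZ Fq n f}).restrictScalars (ZField Fq n)) →ₗ[ZField Fq n]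
      ((ZField Fq n)[X] ⧸ (Ideal.span {toZ Fq n f}).restrictScalars (ZField Fq n)) :=
  Submodule.mapQ _ _ (φ.twistAction n) (by
    intro x hx
    rw [Submodule.mem_comap, Submodule.restrictScalars_mem, twistAction, skewAction_apply]
    exact sum_mem fun i _ => Ideal.mul_mem_left _ _ (tauZ_pow_mem n f _ hx))

/-- The `𝔸`-module `ϕ(𝔸 / f𝔸)`: the space `𝔸 / f𝔸` on which `θ` acts as `ϕ_θ`. -/
abbrev TwistModule (f : Fq[X]) : Type _ := Module.AEval' (φ.twistQuotientAction n f)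

end DrinfeldModule

variable (Fq) in
/-- The inclusion of `𝔸` in the complete field `Fq(z_1, …, z_n)((θ⁻¹))`. The latter is the field of
Laurent series in the variable `θ⁻¹` with its valuation topology, so `θ` is the
monomial of exponent `-1`. -/
def toLaurent (n : ℕ) : (ZField Fq n)[X] →ₐ[ZField Fq n] LaurentSeries (ZField Fq n) :=
  aeval (HahnSeries.single (-1 : ℤ) (1 : ZField Fq n))

namespace DrinfeldModule

variable {r : ℕ} (φ : DrinfeldModule Fq r) (n : ℕ)

/-- The factor `[𝔸 / f𝔸] / [ϕ(𝔸 / f𝔸)]` of the Taelman `L`-value. -/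
def taelmanFactor (f : MonicPrime Fq) : LaurentSeries (ZField Fq n) :=
  toLaurent Fq n
      (fittingGenerator (ZField Fq n) ((ZField Fq n)[X] ⧸ Ideal.span {toZ Fq n f.1})) /
    toLaurent Fq n (fittingGenerator (ZField Fq n) (φ.TwistModule n f.1))

/-- The Taelman `L`-value `L(ϕ, 𝔸)`, an infinite product over the monic irreducible `f`. -/
def taelmanLValue : LaurentSeries (ZField Fq n) := ∏' f : MonicPrime Fq, φ.taelmanFactor n f

/-- The term `μ(a) a(z_1) ⋯ a(z_n) / a`. -/
def pellarinTerm (a : MonicPoly Fq) : LaurentSeries (ZField Fq n) :=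
  toLaurent Fq n (toZ Fq n (φ.mu a) * ∏ k : Fin n, C (aeval (z Fq k) a.1)) /
    toLaurent Fq n (toZ Fq n a.1)

end DrinfeldModule

end Taelman

end

/-!
Both sides of the local identity are values of one spectral determinant. Let
`a_{ij} = c_j ^ (q ^ i)`, where the `c_j` are the coefficients of the reduction of `φ_θ` at `f`, and
let `Δ(t, z)` be the determinant of `t - ∑_j a_{ij} S ^ j`, with `S` the shift, on the sequences
with `x_{i+d} = z x_i`, where `d = deg f`.

* Pairing torsion points with `E[t] / h ^ m`, `E` an algebraic closure of `A / f`, turns them into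
  solutions of the difference equation `t x_i = ∑_j a_{ij} x_{i+j}`, on which `τ ^ d` is the
  monodromy. Up to a constant factor, its characteristic polynomial is `Δ(t, z)`.
* Evaluation at the conjugates `β ^ (q ^ i)` of a root `β` of `f`, scaled by `∏_k ℓ_i(z_k)(β)`,
  identifies the dual of `ϕ(𝔸 / f𝔸)` with these sequences for `z = f(z_1) ⋯ f(z_n)`, so that its
  Fitting generator is `Δ(θ, f(z_1) ⋯ f(z_n))`.

Hence the local factor is `D_f(f(z_1) ⋯ f(z_n) / f)⁻¹`. Giving `t` the weight `r` and `z` the weight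
`d` bounds the degrees of the coefficients of `Δ`; this makes the terms `μ(a) a(z_1) ⋯ a(z_n) / a`
tend to zero, and the Euler product expands by unique factorization.
-/

noncomputable section

namespace Taelman

/-! ### Square presentations and Fitting ideals -/

section Presentation

variable {R N ι κ : Type*} [CommRing R] [AddCommGroup N] [Module R N] [Fintype ι]

theorem exists_matrix_sum_smul_eq {g : ι → N} (hg : Submodule.span R (Set.range g) = ⊤)
    (g' : κ → N) : ∃ Q : Matrix κ ι R, ∀ k, ∑ i, Q k i • g i = g' k := by
  choose Q hQ using fun k =>
    (Submodule.mem_span_range_iff_exists_fun R).1 (hg ▸ Submodule.mem_top : g' k ∈ _)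
  exact ⟨Q, hQ⟩

variable [Fintype κ]

/-- The sequence `R ^ ι → R ^ ι → N → 0` is exact, where the first map is `v ↦ v M` and the second
one sends the standard basis to `g`. The determinant of such a square matrix `M` of relations
generates the Fitting ideal of `N`. -/
structure IsPresentedBy (g : ι → N) (M : Matrix ι ι R) : Prop where
  span_eq_top : Submodule.span R (Set.range g) = ⊤
  ker_eq_range : LinearMap.ker (Fintype.linearCombination R g) = LinearMap.range M.vecMulLinear

theorem linearCombination_vecMul (g : ι → N) (M : Matrix κ ι R) (v : κ → R) :
    Fintype.linearCombination R g (Matrix.vecMul v M) = ∑ k, v k • ∑ i, M k i • g i := by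
  simp only [Fintype.linearCombination_apply, Matrix.vecMul, dotProduct, Finset.sum_smul, mul_smul,
    Finset.smul_sum]
  exact Finset.sum_comm

namespace IsPresentedBy

theorem sum_smul_eq_zero {g : ι → N} {M : Matrix ι ι R} (h : IsPresentedBy g M) (i : ι) :
    ∑ j, M i j • g j = 0 := by
  classical
  have hi : Matrix.vecMul (Pi.single i 1) M ∈ LinearMap.ker (Fintype.linearCombination R g) :=
    h.ker_eq_range ▸ ⟨_, rfl⟩
  rwa [LinearMap.mem_ker, Matrix.single_one_vecMul] at hi

theorem of_leftInverse [DecidableEq ι] {g : ι → N} {M : Matrix ι ι R}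
    (hspan : Submodule.span R (Set.range g) = ⊤) (hrel : ∀ i, ∑ j, M i j • g j = 0)
    (s : N →ₗ[R] (ι → R) ⧸ LinearMap.range M.vecMulLinear)
    (hs : ∀ i, s (g i) = Submodule.Quotient.mk (Pi.single i 1)) : IsPresentedBy g M := by
  refine ⟨hspan, le_antisymm (fun v hv => ?_) ?_⟩
  · have hmk : s ∘ₗ Fintype.linearCombination R g = Submodule.mkQ _ :=
      (Pi.basisFun R ι).ext fun i => by simp [hs, Fintype.linearCombination_apply]
    rw [← Submodule.Quotient.mk_eq_zero, ← Submodule.mkQ_apply, ← hmk, LinearMap.comp_apply,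
      LinearMap.mem_ker.1 hv, map_zero]
  · rintro _ ⟨v, rfl⟩
    simp [LinearMap.mem_ker, linearCombination_vecMul, hrel]

theorem map {N' : Type*} [AddCommGroup N'] [Module R N'] {g : ι → N} {M : Matrix ι ι R}
    (h : IsPresentedBy g M) (e : N ≃ₗ[R] N') : IsPresentedBy (e ∘ g) M where
  span_eq_top := by
    rw [Set.range_comp, ← LinearEquiv.coe_coe, Submodule.span_image, h.span_eq_top,
      Submodule.map_top, LinearEquiv.range]
  ker_eq_range := by
    rw [← h.ker_eq_range]
    ext v
    rw [LinearMap.mem_ker, LinearMap.mem_ker, ← e.map_eq_zero_iff]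
    simp [Fintype.linearCombination_apply]

theorem reindex {g : ι → N} {M : Matrix ι ι R} (h : IsPresentedBy g M) (e : κ ≃ ι) :
    IsPresentedBy (g ∘ e) (M.submatrix e e) where
  span_eq_top := by rw [EquivLike.range_comp, h.span_eq_top]
  ker_eq_range := by
    have hcomb (v : κ → R) : Fintype.linearCombination R (g ∘ e) v =
        Fintype.linearCombination R g (v ∘ e.symm) := by
      simp only [Fintype.linearCombination_apply, Function.comp_apply]
      exact Fintype.sum_equiv e _ _ fun k => by simp
    ext v
    rw [LinearMap.mem_ker, hcomb, ← LinearMap.mem_ker, h.ker_eq_range]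
    constructor
    · rintro ⟨u, hu⟩
      refine ⟨u ∘ e, ?_⟩
      rw [Matrix.vecMulLinear_apply] at hu ⊢
      rw [Matrix.submatrix_vecMul_equiv, Function.comp_assoc, e.self_comp_symm, Function.comp_id,
        hu, Function.comp_assoc, e.symm_comp_self, Function.comp_id]
    · rintro ⟨u, rfl⟩
      refine ⟨u ∘ e.symm, ?_⟩
      rw [Matrix.vecMulLinear_apply, Matrix.vecMulLinear_apply, Matrix.submatrix_vecMul_equiv,
        Function.comp_assoc, e.self_comp_symm, Function.comp_id]

theorem sumElim [DecidableEq κ] {g : ι → N} {M : Matrix ι ι R} (h : IsPresentedBy g M)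
    {g' : κ → N} {Q : Matrix κ ι R} (hQ : ∀ k, ∑ i, Q k i • g i = g' k) :
    IsPresentedBy (Sum.elim g g') (Matrix.fromBlocks M 0 (-Q) 1) where
  span_eq_top := by
    rw [Set.Sum.elim_range, Submodule.span_union, h.span_eq_top, top_sup_eq]
  ker_eq_range := by
    have hcomb (w : ι ⊕ κ → R) : Fintype.linearCombination R (Sum.elim g g') w =
        Fintype.linearCombination R g (w ∘ Sum.inl + Matrix.vecMul (w ∘ Sum.inr) Q) := by
      rw [map_add, linearCombination_vecMul]
      simp [Fintype.linearCombination_apply, hQ]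
    ext w
    rw [LinearMap.mem_ker, hcomb, ← LinearMap.mem_ker, h.ker_eq_range]
    constructor
    · rintro ⟨u, hu⟩
      refine ⟨Sum.elim u (w ∘ Sum.inr), ?_⟩
      rw [Matrix.vecMulLinear_apply] at hu ⊢
      simp [Matrix.vecMul_fromBlocks, hu, Matrix.vecMul_neg]
    · rintro ⟨u, rfl⟩
      refine ⟨u ∘ Sum.inl, ?_⟩
      simp [Matrix.vecMul_fromBlocks, Matrix.vecMul_neg]

variable [DecidableEq ι]

theorem det_dvd_det_of_same_generators {g : ι → N} {M M' : Matrix ι ι R} (h : IsPresentedBy g M)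
    (h' : IsPresentedBy g M') : M.det ∣ M'.det := by
  have hrow (i : ι) : ∃ u, Matrix.vecMul u M = M' i := by
    have hi : M' i ∈ LinearMap.ker (Fintype.linearCombination R g) := h'.sum_smul_eq_zero i
    rwa [h.ker_eq_range] at hi
  choose U hU using hrow
  have hmul : Matrix.of U * M = M' := Matrix.ext fun i j => congrFun (hU i) j
  exact ⟨(Matrix.of U).det, by rw [← hmul, Matrix.det_mul, mul_comm]⟩

/-- Both matrices of relations are enlarged to matrices of relations between the members of `g` and
`g'`, which does not change the determinants. -/
theorem det_dvd_det [DecidableEq κ] {g : ι → N} {g' : κ → N} {M : Matrix ι ι R}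
    {M' : Matrix κ κ R} (h : IsPresentedBy g M) (h' : IsPresentedBy g' M') : M.det ∣ M'.det := by
  obtain ⟨Q, hQ⟩ := exists_matrix_sum_smul_eq h.span_eq_top g'
  obtain ⟨P, hP⟩ := exists_matrix_sum_smul_eq h'.span_eq_top g
  have h₁ := h.sumElim hQ
  have h₂ := (h'.sumElim hP).reindex (Equiv.sumComm ι κ)
  rw [show Sum.elim g' g ∘ Equiv.sumComm ι κ = Sum.elim g g' from Sum.elim_swap] at h₂
  have hdvd := h₁.det_dvd_det_of_same_generators h₂
  rwa [Matrix.det_submatrix_equiv_self, Matrix.det_fromBlocks_zero₁₂,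
    Matrix.det_fromBlocks_zero₁₂, Matrix.det_one, Matrix.det_one, mul_one, mul_one] at hdvd

theorem det_smul_eq_zero {g : ι → N} {M : Matrix ι ι R} (h : IsPresentedBy g M) (x : N) :
    M.det • x = 0 := by
  have hg (i : ι) : M.det • g i = 0 := by
    have := linearCombination_vecMul g M (M.adjugate i)
    simp only [h.sum_smul_eq_zero, smul_zero, Finset.sum_const_zero] at this
    rw [← this, ← Matrix.mul_apply_eq_vecMul, Matrix.adjugate_mul]
    simp [Fintype.linearCombination_apply, Matrix.one_apply, ite_smul]
  have hx : x ∈ Submodule.span R (Set.range g) := h.span_eq_top ▸ Submodule.mem_top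
  induction hx using Submodule.span_induction with
  | mem _ hy => obtain ⟨i, rfl⟩ := hy; exact hg i
  | zero => exact smul_zero _
  | add _ _ _ _ hy hz => rw [smul_add, hy, hz, add_zero]
  | smul c _ _ hy => rw [smul_comm, hy, smul_zero]

theorem coker (M : Matrix ι ι R) :
    IsPresentedBy (fun i => (Submodule.Quotient.mk (Pi.single i 1) :
      (ι → R) ⧸ LinearMap.range M.vecMulLinear)) M := by
  have hcomb : Fintype.linearCombination R (fun i => (Submodule.Quotient.mk (Pi.single i 1) :
      (ι → R) ⧸ LinearMap.range M.vecMulLinear)) = Submodule.mkQ _ :=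
    (Pi.basisFun R ι).ext fun i => by simp [Fintype.linearCombination_apply]
  refine ⟨?_, ?_⟩
  · rw [← Fintype.range_linearCombination, hcomb, Submodule.range_mkQ]
  · rw [hcomb, Submodule.ker_mkQ]

theorem pi_quotient (c : ι → R) :
    IsPresentedBy (fun i => (Pi.single i 1 : (i : ι) → R ⧸ Ideal.span {c i}))
      (Matrix.diagonal c) := by
  have hcomb (v : ι → R) : Fintype.linearCombination R
      (fun i => (Pi.single i 1 : (i : ι) → R ⧸ Ideal.span {c i})) v =
        fun i => Ideal.Quotient.mk _ (v i) := by
    rw [Fintype.linearCombination_apply]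
    simp_rw [← Pi.single_smul, Algebra.smul_def, mul_one]
    exact Finset.univ_sum_single fun i => Ideal.Quotient.mk (Ideal.span {c i}) (v i)
  refine ⟨eq_top_iff.2 fun x _ => ?_, Submodule.ext fun v => ?_⟩
  · choose v hv using fun i => Ideal.Quotient.mk_surjective (x i)
    rw [← Fintype.range_linearCombination]
    exact ⟨v, (hcomb v).trans (funext hv)⟩
  · rw [LinearMap.mem_ker, hcomb]
    simp only [funext_iff, Pi.zero_apply, Ideal.Quotient.eq_zero_iff_mem,
      Ideal.mem_span_singleton, LinearMap.mem_range, Matrix.vecMulLinear_apply,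
      Matrix.vecMul_diagonal]
    rw [← Classical.skolem (p := fun i u => u * c i = v i)]
    exact forall_congr' fun i => ⟨fun ⟨u, hu⟩ => ⟨u, by rw [hu, mul_comm]⟩,
      fun ⟨u, hu⟩ => ⟨u, by rw [← hu, mul_comm]⟩⟩

end IsPresentedBy

end Presentation

section FittingGenerator

variable {k : Type*} [Field k] {ι : Type*} [Fintype ι] [DecidableEq ι]

theorem sum_charmatrix_smul {W : Type*} [AddCommGroup W] [Module k[X] W] (A : Matrix ι ι k)
    (w : ι → W) (i : ι) :
    ∑ j, A.charmatrix i j • w j = (X : k[X]) • w i - ∑ j, C (A i j) • w j := by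
  simp [Matrix.charmatrix_apply, Matrix.diagonal_apply, sub_smul, Finset.sum_sub_distrib, ite_smul]

theorem isPresentedBy_charmatrix {V : Type*} [AddCommGroup V] [Module k V]
    (b : Module.Basis ι k V) (T : V →ₗ[k] V) :
    IsPresentedBy (fun i => Module.AEval'.of T (b i))
      (LinearMap.toMatrix b b T).transpose.charmatrix := by
  set A := (LinearMap.toMatrix b b T).transpose with hA
  set K := LinearMap.range A.charmatrix.vecMulLinear
  have hT (i : ι) : T (b i) = ∑ j, A i j • b j := by
    simp only [hA, Matrix.transpose_apply, LinearMap.toMatrix_apply, b.sum_repr]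
  let e (i : ι) : (ι → k[X]) ⧸ K := Submodule.Quotient.mk (Pi.single i 1)
  have he (i : ι) : (X : k[X]) • e i = ∑ j, C (A i j) • e j := by
    rw [← sub_eq_zero, ← sum_charmatrix_smul]
    simp only [e, ← Submodule.mkQ_apply, ← map_smul, ← map_sum]
    rw [Submodule.mkQ_apply, Submodule.Quotient.mk_eq_zero]
    exact ⟨Pi.single i 1, by
      ext1 j
      simp [Finset.sum_apply, Pi.single_apply]⟩
  let s : Module.AEval' T →ₗ[k[X]] (ι → k[X]) ⧸ K :=
    LinearMap.ofAEval T (b.constr k e) fun v => by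
      suffices b.constr k e ∘ₗ T = (Module.toModuleEnd k _ (X : k[X])) ∘ₗ b.constr k e from
        LinearMap.congr_fun this v
      refine b.ext fun i => ?_
      simp only [LinearMap.comp_apply, b.constr_basis, hT, map_sum, map_smul,
        Module.toModuleEnd_apply, DistribSMul.toLinearMap_apply, he]
      exact Finset.sum_congr rfl fun j _ => (algebraMap_smul k[X] (A i j) (e j)).symm
  refine .of_leftInverse (eq_top_iff.2 fun x _ => ?_) (fun i => ?_) s fun i => ?_
  · rw [← Fintype.range_linearCombination]
    refine ⟨fun i => C (b.repr ((Module.AEval'.of T).symm x) i), ?_⟩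
    simp only [Fintype.linearCombination_apply, Module.AEval.C_smul, ← map_smul, ← map_sum,
      b.sum_repr, LinearEquiv.apply_symm_apply]
  · refine (sum_charmatrix_smul A _ i).trans ?_
    rw [Module.AEval'.X_smul_of, hT, map_sum, sub_eq_zero]
    simp [Module.AEval.C_smul]
  · exact b.constr_basis k e i

theorem IsFittingGenerator.eq_det {M : Type*} [AddCommGroup M] [Module k[X] M] {g : k[X]}
    (hg : IsFittingGenerator k M g) {x : ι → M} {A : Matrix ι ι k[X]} (hA : IsPresentedBy x A)
    (hmonic : A.det.Monic) : g = A.det := by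
  obtain ⟨s, c, hc, ⟨e⟩, rfl⟩ := hg
  have hc' : IsPresentedBy _ (Matrix.diagonal c) := (IsPresentedBy.pi_quotient c).map e.symm
  rw [← Matrix.det_diagonal]
  exact eq_of_monic_of_associated (Matrix.det_diagonal (d := c) ▸
    monic_prod_of_monic _ _ fun i _ => hc i) hmonic
    (associated_of_dvd_dvd (hc'.det_dvd_det hA) (hA.det_dvd_det hc'))

theorem exists_isFittingGenerator (M : Type*) [AddCommGroup M] [Module k[X] M]
    [Module.Finite k[X] M] (hM : Module.IsTorsion k[X] M) : ∃ g, IsFittingGenerator k M g := by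
  classical
  obtain ⟨κ, _, p, hp, e, ⟨E⟩⟩ := Module.equiv_directSum_of_isTorsion hM
  let c : κ → k[X] := fun i => normalize (p i ^ e i)
  have hspan (i : κ) : Ideal.span {p i ^ e i} = Ideal.span {c i} :=
    Ideal.span_singleton_eq_span_singleton.2 (associated_normalize _)
  let ε : κ ≃ Fin (Fintype.card κ) := Fintype.equivFin κ
  exact ⟨_, _, fun i => c (ε.symm i), fun i => monic_normalize (pow_ne_zero _ (hp _).ne_zero),
    ⟨E ≪≫ₗ DirectSum.linearEquivFunOnFintype k[X] κ _ ≪≫ₗ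
      LinearEquiv.piCongrRight (fun i => Submodule.quotEquivOfEq _ _ (hspan i)) ≪≫ₗ
      LinearEquiv.piCongrLeft' k[X] (fun i => k[X] ⧸ Ideal.span {c i}) ε⟩, rfl⟩

theorem IsPresentedBy.fittingGenerator_eq {M : Type*} [AddCommGroup M] [Module k[X] M]
    {x : ι → M} {A : Matrix ι ι k[X]} (hA : IsPresentedBy x A) (hmonic : A.det.Monic) :
    fittingGenerator k M = A.det := by
  have hfin : Module.Finite k[X] M := Module.finite_def.2
    (hA.span_eq_top ▸ Submodule.fg_span (Set.finite_range x))
  have hex : ∃ g, IsFittingGenerator k M g := exists_isFittingGenerator M fun {m} =>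
    ⟨⟨A.det, mem_nonZeroDivisors_of_ne_zero hmonic.ne_zero⟩, hA.det_smul_eq_zero m⟩
  rw [fittingGenerator, dif_pos hex]
  exact hex.choose_spec.eq_det hA hmonic

theorem fittingGenerator_quotient {g : k[X]} (hg : g.Monic) :
    fittingGenerator k (k[X] ⧸ Ideal.span {g}) = g := by
  have h := (IsPresentedBy.pi_quotient fun _ : Unit => g).map (LinearEquiv.funUnique Unit k[X] _)
  simpa using h.fittingGenerator_eq (by simpa using hg)

theorem fittingGenerator_aeval {V : Type*} [AddCommGroup V] [Module k V]
    (b : Module.Basis ι k V) (T : V →ₗ[k] V) :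
    fittingGenerator k (Module.AEval' T) = (LinearMap.toMatrix b b T).charpoly := by
  have hdet : (LinearMap.toMatrix b b T).transpose.charmatrix.det =
      (LinearMap.toMatrix b b T).charpoly := by
    rw [Matrix.charmatrix_transpose, Matrix.det_transpose, Matrix.charpoly]
  rw [(isPresentedBy_charmatrix b T).fittingGenerator_eq (hdet ▸ Matrix.charpoly_monic _), hdet]

end FittingGenerator

/-! ### Periodic difference equations -/

section Difference

variable {R V : Type*} [CommRing R] [AddCommGroup V] [Module R V]

/-- The sequence `x` solves the difference equation `t x_i = ∑_{j ≤ r} a_{ij} x_{i+j}`. -/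
def IsRecSolution (t : R) (a : ℕ → ℕ → R) (r : ℕ) (x : ℕ → V) : Prop :=
  ∀ i, t • x i = ∑ j ∈ Finset.range (r + 1), a i j • x (i + j)

/-- The universal solution, with values in `R ^ r`, of the difference equation
`t x_i = ∑_{j ≤ r} a_{ij} x_{i+j}`, which starts with the standard basis. It is meaningful if all
`a_{ir}` are units. -/
def recSeq (t : R) (a : ℕ → ℕ → R) (r : ℕ) (i : ℕ) : Fin r → R :=
  if h : i < r then Pi.single ⟨i, h⟩ 1
  else if _hr : r = 0 then 0
  else Ring.inverse (a (i - r) r) •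
    (t • recSeq t a r (i - r) - ∑ j : Fin r, a (i - r) j • recSeq t a r (i - r + j))
termination_by i
decreasing_by
  · omega
  · have := j.2
    omega

/-- The matrix, with respect to the initial values, of the shift by `d` on the solutions of a
`d`-periodic difference equation. -/
def monodromy (t : R) (a : ℕ → ℕ → R) (r d : ℕ) : Matrix (Fin r) (Fin r) R :=
  Matrix.of fun l => recSeq t a r (d + l)

/-- The sequence `x` satisfies `x_{i+d} = z x_i`. -/
def IsQuasiPeriodic (d : ℕ) (z : R) (x : ℕ → V) : Prop :=
  ∀ i, x (i + d) = z • x i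

/-- The matrix of `t - ∑_j a_{ij} S ^ j` on the sequences with `x_{i+d} = z x_i`, where `S` is the
shift. -/
def quasiPeriodicMatrix (t : R) (a : ℕ → ℕ → R) (r d : ℕ) (z : R) : Matrix (Fin d) (Fin d) R :=
  Matrix.of fun i l => (if i = l then t else 0) - ∑ j ∈ Finset.range (r + 1),
    if ((i : ℕ) + j) % d = l then a i j * z ^ (((i : ℕ) + j) / d) else 0

variable {t z : R} {a : ℕ → ℕ → R} {r d : ℕ} {x y : ℕ → V}

theorem recSeq_val (l : Fin r) : recSeq t a r l = Pi.single l 1 := by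
  rw [recSeq, dif_pos l.2]

theorem isRecSolution_recSeq (ha : ∀ i, IsUnit (a i r)) :
    IsRecSolution t a r (recSeq t a r) := by
  intro i
  rcases Nat.eq_zero_or_pos r with rfl | hr
  · exact Subsingleton.elim _ _
  · rw [Finset.sum_range_succ, recSeq.eq_1 t a r (i + r), dif_neg (by omega), dif_neg hr.ne',
      smul_smul, Nat.add_sub_cancel, Ring.mul_inverse_cancel _ (ha i), one_smul,
      Finset.sum_range fun j => a i j • recSeq t a r (i + j), add_sub_cancel]

namespace IsRecSolution

theorem map {W : Type*} [AddCommGroup W] [Module R W] (hx : IsRecSolution t a r x)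
    (f : V →ₗ[R] W) : IsRecSolution t a r (f ∘ x) := fun i => by
  simpa using congrArg f (hx i)

theorem shift (hx : IsRecSolution t a r x) (hd : Function.Periodic a d) :
    IsRecSolution t a r (fun i => x (i + d)) := fun i => by
  simpa only [hd i, add_right_comm] using hx (i + d)

theorem eq_of_forall_lt (hx : IsRecSolution t a r x) (hy : IsRecSolution t a r y)
    (ha : ∀ i, IsUnit (a i r)) (hr : r ≠ 0) (h : ∀ i < r, x i = y i) : x = y := by
  funext i
  induction i using Nat.strong_induction_on with
  | _ i ih =>
    rcases lt_or_ge i r with hi | hi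
    · exact h i hi
    obtain ⟨n, rfl⟩ := Nat.exists_eq_add_of_le' hi
    have hlow : ∑ j ∈ Finset.range r, a n j • x (n + j) =
        ∑ j ∈ Finset.range r, a n j • y (n + j) :=
      Finset.sum_congr rfl fun j hj => by rw [ih _ (by have := Finset.mem_range.1 hj; omega)]
    have hn := hx n
    rw [ih n (by omega), hy n, Finset.sum_range_succ, Finset.sum_range_succ, hlow] at hn
    exact ((ha n).smul_left_cancel.1 (add_left_cancel hn)).symm

theorem eq_sum (hx : IsRecSolution t a r x) (ha : ∀ i, IsUnit (a i r)) (hr : r ≠ 0) (i : ℕ) :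
    x i = ∑ l, recSeq t a r i l • x l := by
  let f := Fintype.linearCombination R fun l : Fin r => x l
  have huniv := (isRecSolution_recSeq (t := t) ha).map f
  refine congrFun (hx.eq_of_forall_lt huniv ha hr fun l hl => ?_) i
  simpa [f, Fintype.linearCombination_apply, Pi.single_apply, ite_smul] using
    congrArg f (recSeq_val (t := t) (a := a) ⟨l, hl⟩).symm

end IsRecSolution

theorem recSeq_map {R' : Type*} [CommRing R'] (ψ : R →+* R') (ha : ∀ i, IsUnit (a i r)) (i : ℕ) :
    recSeq (ψ t) (fun i j => ψ (a i j)) r i = ψ ∘ recSeq t a r i := by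
  rcases Nat.eq_zero_or_pos r with rfl | hr
  · exact Subsingleton.elim _ _
  have ha' (i : ℕ) : IsUnit (ψ (a i r)) := (ha i).map ψ
  have hψ : IsRecSolution (ψ t) (fun i j => ψ (a i j)) r fun i => ψ ∘ recSeq t a r i := fun i => by
    ext l
    simpa using congrArg ψ (congrFun (isRecSolution_recSeq (t := t) ha i) l)
  refine congrFun ((isRecSolution_recSeq ha').eq_of_forall_lt hψ ha' hr.ne' fun l hl => ?_) i
  lift l to Fin r using hl
  ext m
  simp [recSeq_val, Pi.single_apply, apply_ite ψ]

theorem monodromy_map {R' : Type*} [CommRing R'] (ψ : R →+* R') (ha : ∀ i, IsUnit (a i r)) :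
    (monodromy t a r d).map ψ = monodromy (ψ t) (fun i j => ψ (a i j)) r d :=
  Matrix.ext fun l m => (congrFun (recSeq_map ψ ha (d + l)) m).symm

theorem IsRecSolution.sum_scalar_sub_monodromy_smul (hx : IsRecSolution t a r x)
    (ha : ∀ i, IsUnit (a i r)) (l : Fin r) :
    ∑ m, (Matrix.scalar (Fin r) z - monodromy t a r d) l m • x m = z • x l - x (l + d) := by
  have hr : r ≠ 0 := l.pos.ne'
  simp [Matrix.diagonal_apply, sub_smul, Finset.sum_sub_distrib, ite_smul, monodromy,
    add_comm d, ← hx.eq_sum ha hr]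

theorem IsRecSolution.isQuasiPeriodic_iff (hx : IsRecSolution t a r x) (ha : ∀ i, IsUnit (a i r))
    (hr : r ≠ 0) (hd : Function.Periodic a d) :
    IsQuasiPeriodic d z x ↔
      ∀ l : Fin r, ∑ m, (Matrix.scalar (Fin r) z - monodromy t a r d) l m • x m = 0 := by
  simp only [hx.sum_scalar_sub_monodromy_smul ha, sub_eq_zero]
  refine ⟨fun h l => (h l).symm, fun h => congrFun ?_⟩
  exact (hx.shift hd).eq_of_forall_lt (hx.map (LinearMap.lsmul R V z)) ha hr
    fun l hl => (h ⟨l, hl⟩).symm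

namespace IsQuasiPeriodic

theorem apply_add_mul (hx : IsQuasiPeriodic d z x) (i m : ℕ) : x (i + d * m) = z ^ m • x i := by
  induction m with
  | zero => simp
  | succ m ih => rw [Nat.mul_succ, ← add_assoc, hx, ih, smul_smul, pow_succ']

theorem apply_eq_pow_smul (hx : IsQuasiPeriodic d z x) (i : ℕ) :
    x i = z ^ (i / d) • x (i % d) := by
  rw [← hx.apply_add_mul, Nat.mod_add_div]

theorem sum_quasiPeriodicMatrix_smul (hx : IsQuasiPeriodic d z x) (i : Fin d) :
    ∑ l, quasiPeriodicMatrix t a r d z i l • x l =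
      t • x i - ∑ j ∈ Finset.range (r + 1), a i j • x (i + j) := by
  simp only [quasiPeriodicMatrix, Matrix.of_apply, sub_smul, Finset.sum_sub_distrib, ite_smul,
    zero_smul, Finset.sum_ite_eq, Finset.mem_univ, if_true, Finset.sum_smul]
  rw [Finset.sum_comm]
  congr 1
  refine Finset.sum_congr rfl fun j _ => ?_
  rw [hx.apply_eq_pow_smul (i + j),
    Finset.sum_eq_single ⟨(i + j) % d, Nat.mod_lt _ i.pos⟩ _ (by simp)]
  · simp [smul_smul]
  · exact fun l _ hl => if_neg fun h => hl (Fin.ext h.symm)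

theorem isRecSolution_iff (hx : IsQuasiPeriodic d z x) (hd : Function.Periodic a d) (hd0 : 0 < d) :
    IsRecSolution t a r x ↔ ∀ i : Fin d, ∑ l, quasiPeriodicMatrix t a r d z i l • x l = 0 := by
  simp only [hx.sum_quasiPeriodicMatrix_smul, sub_eq_zero]
  refine ⟨fun h i => h i, fun h i => ?_⟩
  have hshift (j : ℕ) : x (i + j) = z ^ (i / d) • x (i % d + j) := by
    rw [← hx.apply_add_mul, add_right_comm, Nat.mod_add_div]
  have hi := h ⟨i % d, Nat.mod_lt _ hd0⟩
  dsimp only at hi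
  rw [hd.map_mod_nat] at hi
  simp only [hshift, hx.apply_eq_pow_smul i, smul_comm _ (z ^ (i / d)), ← Finset.smul_sum, hi]

end IsQuasiPeriodic

theorem isQuasiPeriodic_pow_smul_mod (hd0 : 0 < d) (z : R) (v : ℕ → V) :
    IsQuasiPeriodic d z fun i => z ^ (i / d) • v (i % d) := fun i => by
  dsimp only
  rw [Nat.add_div_right _ hd0, Nat.add_mod_right, smul_smul, pow_succ']

/-- Both matrices present the module that represents the functor of quasi-periodic solutions: a
solution is determined by its first `r` terms, a quasi-periodic sequence by its first `d` terms. -/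
theorem isPresentedBy_quasiPeriodicMatrix (hd0 : 0 < d) (hr : r ≠ 0) (ha : ∀ i, IsUnit (a i r))
    (hd : Function.Periodic a d) (z : R) :
    IsPresentedBy (fun i : Fin d => (Submodule.Quotient.mk (recSeq t a r i) :
      (Fin r → R) ⧸ LinearMap.range (Matrix.scalar (Fin r) z - monodromy t a r d).vecMulLinear))
      (quasiPeriodicMatrix t a r d z) := by
  set B := Matrix.scalar (Fin r) z - monodromy t a r d with hB
  set Q := quasiPeriodicMatrix t a r d z
  let x (i : ℕ) : (Fin r → R) ⧸ LinearMap.range B.vecMulLinear := Submodule.mkQ _ (recSeq t a r i)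
  have hx : IsRecSolution t a r x := (isRecSolution_recSeq ha).map _
  have hxval (l : Fin r) : x l = Submodule.Quotient.mk (Pi.single l 1) := by
    simp only [x, recSeq_val, Submodule.mkQ_apply]
  have hxz : IsQuasiPeriodic d z x := (hx.isQuasiPeriodic_iff ha hr hd).2 fun l => by
    simpa only [hxval] using (IsPresentedBy.coker B).sum_smul_eq_zero l
  let e (i : ℕ) : (Fin d → R) ⧸ LinearMap.range Q.vecMulLinear :=
    if h : i < d then Submodule.Quotient.mk (Pi.single ⟨i, h⟩ 1) else 0
  let y (i : ℕ) := z ^ (i / d) • e (i % d)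
  have hyz : IsQuasiPeriodic d z y := isQuasiPeriodic_pow_smul_mod hd0 z e
  have hyval (i : Fin d) : y i = Submodule.Quotient.mk (Pi.single i 1) := by
    simp [y, e, Nat.div_eq_of_lt i.2, Nat.mod_eq_of_lt i.2]
  have hy : IsRecSolution t a r y := (hyz.isRecSolution_iff hd hd0).2 fun i => by
    simpa only [hyval] using (IsPresentedBy.coker Q).sum_smul_eq_zero i
  have hker : LinearMap.range B.vecMulLinear ≤
      LinearMap.ker (Fintype.linearCombination R fun l : Fin r => y l) := by
    rintro _ ⟨v, rfl⟩
    rw [LinearMap.mem_ker, Matrix.vecMulLinear_apply, linearCombination_vecMul]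
    exact Finset.sum_eq_zero fun l _ => by
      rw [hB, (hy.isQuasiPeriodic_iff ha hr hd).1 hyz l, smul_zero]
  refine .of_leftInverse (eq_top_iff.2 ?_) ((hxz.isRecSolution_iff hd hd0).1 hx)
    (Submodule.liftQ _ _ hker) fun i => ?_
  · rw [← (IsPresentedBy.coker B).span_eq_top, Submodule.span_le]
    rintro _ ⟨l, rfl⟩
    dsimp only
    rw [← hxval, hxz.apply_eq_pow_smul]
    exact Submodule.smul_mem _ _ (Submodule.subset_span ⟨⟨l % d, Nat.mod_lt _ hd0⟩, rfl⟩)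
  · rw [← hyval, hy.eq_sum ha hr]
    rfl

theorem det_quasiPeriodicMatrix_dvd_dvd (hd0 : 0 < d) (hr : r ≠ 0) (ha : ∀ i, IsUnit (a i r))
    (hd : Function.Periodic a d) (z : R) :
    (quasiPeriodicMatrix t a r d z).det ∣ (Matrix.scalar (Fin r) z - monodromy t a r d).det ∧
      (Matrix.scalar (Fin r) z - monodromy t a r d).det ∣ (quasiPeriodicMatrix t a r d z).det :=
  have hQ := isPresentedBy_quasiPeriodicMatrix hd0 hr ha hd z
  have hB := IsPresentedBy.coker (Matrix.scalar (Fin r) z - monodromy t a r d)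
  ⟨hQ.det_dvd_det hB, hB.det_dvd_det hQ⟩

end Difference

section SpectralCurve

variable {R : Type*} [CommRing R]

theorem quasiPeriodicMatrix_map {R' : Type*} [CommRing R'] (ψ : R →+* R') (t : R)
    (a : ℕ → ℕ → R) (r d : ℕ) (z : R) :
    (quasiPeriodicMatrix t a r d z).map ψ =
      quasiPeriodicMatrix (ψ t) (fun i j => ψ (a i j)) r d (ψ z) := by
  ext i l
  simp [quasiPeriodicMatrix, map_sum, apply_ite ψ]

theorem quasiPeriodicMatrix_eq_of_le (t : R) {a : ℕ → ℕ → R} {r r' : ℕ} (hle : r ≤ r')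
    (h0 : ∀ i j, r < j → a i j = 0) (d : ℕ) (z : R) :
    quasiPeriodicMatrix t a r' d z = quasiPeriodicMatrix t a r d z := by
  ext i l
  simp only [quasiPeriodicMatrix, Matrix.of_apply]
  congr 1
  refine (Finset.sum_subset (Finset.range_mono (Nat.succ_le_succ hle)) fun j _ hj => ?_).symm
  rw [h0 _ _ (by simpa using hj), zero_mul, ite_self]

theorem quasiPeriodicMatrix_zero_apply_of_le (t : R) (a : ℕ → ℕ → R) (r : ℕ) {d : ℕ}
    {i l : Fin d} (hli : l ≤ i) :
    quasiPeriodicMatrix t a r d 0 i l = if i = l then t - a i 0 else 0 := by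
  have hsum : ∑ j ∈ Finset.range (r + 1),
      (if ((i : ℕ) + j) % d = l then a i j * 0 ^ (((i : ℕ) + j) / d) else 0) =
        if i = l then a i 0 else 0 := by
    rw [Finset.sum_eq_single 0 _ (by simp)]
    · simp [Nat.mod_eq_of_lt i.2, Nat.div_eq_of_lt i.2, Fin.ext_iff]
    · intro j _ hj
      rcases lt_or_ge ((i : ℕ) + j) d with hlt | hge
      · rw [Nat.mod_eq_of_lt hlt, if_neg (by have : (l : ℕ) ≤ i := hli; omega)]
      · rw [zero_pow (Nat.div_pos hge i.pos).ne', mul_zero, ite_self]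
  rw [quasiPeriodicMatrix, Matrix.of_apply, hsum]
  split_ifs <;> simp

theorem det_quasiPeriodicMatrix_zero (t : R) (a : ℕ → ℕ → R) (r d : ℕ) :
    (quasiPeriodicMatrix t a r d 0).det = ∏ i : Fin d, (t - a i 0) := by
  rw [Matrix.det_of_isUpperTriangular]
  · exact Finset.prod_congr rfl fun i _ => by
      rw [quasiPeriodicMatrix_zero_apply_of_le t a r le_rfl, if_pos rfl]
  · intro i l hli
    have hlt : l < i := hli
    rw [quasiPeriodicMatrix_zero_apply_of_le t a r hlt.le, if_neg hlt.ne']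

theorem det_quasiPeriodicMatrix_order_zero (t : R) (a : ℕ → ℕ → R) (d : ℕ) (z : R) :
    (quasiPeriodicMatrix t a 0 d z).det = ∏ i : Fin d, (t - a i 0) := by
  have hdiag : quasiPeriodicMatrix t a 0 d z = Matrix.diagonal fun i : Fin d => t - a i 0 := by
    ext i l
    simp only [quasiPeriodicMatrix, Matrix.of_apply, zero_add, Finset.range_one,
      Finset.sum_singleton, add_zero, Nat.mod_eq_of_lt i.2, Nat.div_eq_of_lt i.2, pow_zero, mul_one,
      Matrix.diagonal_apply, Fin.val_inj]
    split_ifs <;> simp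
  rw [hdiag, Matrix.det_diagonal]

theorem natDegree_det_le_of_weighted {d D : ℕ} (M : Matrix (Fin d) (Fin d) R[X])
    (hM : ∀ i l : Fin d, (M i l * X ^ (l : ℕ)).natDegree ≤ D + i) : M.det.natDegree ≤ d * D := by
  nontriviality R
  rcases eq_or_ne M.det 0 with h0 | h0
  · simp [h0]
  have hdet : (M * Matrix.diagonal fun l : Fin d => (X : R[X]) ^ (l : ℕ)).det =
      M.det * X ^ (∑ l : Fin d, (l : ℕ)) := by
    rw [Matrix.det_mul, Matrix.det_diagonal, Finset.prod_pow_eq_pow_sum]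
  have hdeg : (M * Matrix.diagonal fun l : Fin d => (X : R[X]) ^ (l : ℕ)).det.natDegree ≤
      ∑ i : Fin d, (D + (i : ℕ)) := by
    rw [← Matrix.det_transpose, Matrix.det_apply]
    refine natDegree_sum_le_of_forall_le _ _ fun σ _ => ?_
    refine (natDegree_smul_le _ _).trans ((natDegree_prod_le _ _).trans ?_)
    refine Finset.sum_le_sum fun i _ => ?_
    rw [Matrix.transpose_apply, Matrix.mul_diagonal]
    exact hM _ _
  rw [hdet, natDegree_mul_X_pow _ h0, Finset.sum_add_distrib] at hdeg
  simpa using hdeg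

/-- The determinant of `t - ∑_j a_{ij} S ^ j` on the sequences with `x_{i+d} = z x_i`, where `S` is
the shift, as a polynomial in `z` over `R[t]`: up to a constant factor, the characteristic
polynomial of the monodromy. -/
def spectralPoly (a : ℕ → ℕ → R) (r d : ℕ) : R[X][X] :=
  (quasiPeriodicMatrix (C X : R[X][X]) (fun i j => C (C (a i j))) r d X).det

/-- The monodromy matrix over `R[t]`. -/
abbrev polyMonodromy (a : ℕ → ℕ → R) (r d : ℕ) : Matrix (Fin r) (Fin r) R[X] :=
  monodromy (X : R[X]) (fun i j => C (a i j)) r d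

theorem eval₂_spectralPoly {S : Type*} [CommRing S] (ψ : R[X] →+* S) (z : S) (a : ℕ → ℕ → R)
    (r d : ℕ) : (spectralPoly a r d).eval₂ ψ z =
      (quasiPeriodicMatrix (ψ X) (fun i j => ψ (C (a i j))) r d z).det := by
  rw [← coe_eval₂RingHom, spectralPoly, RingHom.map_det, RingHom.mapMatrix_apply,
    quasiPeriodicMatrix_map]
  simp

theorem spectralPoly_coeff_zero (a : ℕ → ℕ → R) (r d : ℕ) :
    (spectralPoly a r d).coeff 0 = ∏ i : Fin d, (X - C (a i 0)) := by
  rw [coeff_zero_eq_eval_zero, eval, eval₂_spectralPoly, det_quasiPeriodicMatrix_zero]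
  rfl

theorem exists_charpoly_polyMonodromy {E : Type*} [Field E] {a : ℕ → ℕ → E} {r d : ℕ}
    (hd0 : 0 < d) (hr : r ≠ 0) (ha : ∀ i, a i r ≠ 0) (hd : Function.Periodic a d) :
    ∃ c : E, c ≠ 0 ∧ (polyMonodromy a r d).charpoly = C (C c) * spectralPoly a r d := by
  have hunit (i : ℕ) : IsUnit (C (a i r) : E[X]) := isUnit_C.2 (ha i).isUnit
  have hperiodic : Function.Periodic (fun i j => (C (C (a i j)) : E[X][X])) d := fun i => by
    simp only [hd i]
  have hdvd := det_quasiPeriodicMatrix_dvd_dvd (t := C X) hd0 hr (fun i => (hunit i).map C)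
    hperiodic (X : E[X][X])
  have hcharpoly : (Matrix.scalar (Fin r) (X : E[X][X]) -
      monodromy (C X : E[X][X]) (fun i j => C (C (a i j))) r d).det =
        (polyMonodromy a r d).charpoly := by
    rw [Matrix.charpoly, Matrix.charmatrix, RingHom.mapMatrix_apply, monodromy_map C hunit]
  rw [hcharpoly] at hdvd
  obtain ⟨u, hu⟩ := associated_of_dvd_dvd hdvd.1 hdvd.2
  obtain ⟨v, hv, hvu⟩ := Polynomial.isUnit_iff.1 u.isUnit
  obtain ⟨c, hc, rfl⟩ := Polynomial.isUnit_iff.1 hv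
  exact ⟨c, hc.ne_zero, by rw [← hu, ← hvu, mul_comm]; rfl⟩

/-- The substitution `t = y ^ r`, `z = z y ^ d`, which gives `t ^ α z ^ β` the degree `r α + d β` in
the outer variable `y`. -/
def weightHom (R : Type*) [CommRing R] (r d : ℕ) : R[X][X] →+* R[X][X] :=
  eval₂RingHom (eval₂RingHom ((C : R[X] →+* R[X][X]).comp C) (X ^ r)) (C X * X ^ d)

theorem weightHom_monomial (r d m n : ℕ) (c : R) :
    weightHom R r d (monomial m (monomial n c)) = monomial (r * n + d * m) (monomial m c) := by
  simp only [weightHom, coe_eval₂RingHom, eval₂_monomial, RingHom.comp_apply]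
  simp only [← C_mul_X_pow_eq_monomial, map_mul, map_pow, mul_pow, pow_add, pow_mul]
  ring

theorem coeff_coeff_weightHom {r : ℕ} (hr : r ≠ 0) (d : ℕ) (P : R[X][X]) (α β : ℕ) :
    ((weightHom R r d P).coeff (r * α + d * β)).coeff β = (P.coeff β).coeff α := by
  induction P using Polynomial.induction_on' with
  | add p q hp hq => simp [hp, hq]
  | monomial m p =>
    induction p using Polynomial.induction_on' with
    | add p q hp hq => simp only [map_add, coeff_add, hp, hq]
    | monomial n c =>
      rw [weightHom_monomial, coeff_monomial, coeff_monomial]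
      rcases eq_or_ne m β with rfl | hm
      · have hiff : r * n + d * m = r * α + d * m ↔ n = α := by simp [hr]
        simp only [hiff, if_true, coeff_monomial]
        split_ifs <;> simp
      · rw [if_neg hm]
        split_ifs <;> simp [coeff_monomial, hm]

theorem natDegree_weightHom_spectralPoly_le (a : ℕ → ℕ → R) (r d : ℕ) :
    (weightHom R r d (spectralPoly a r d)).natDegree ≤ d * r := by
  rw [weightHom, coe_eval₂RingHom, eval₂_spectralPoly]
  refine natDegree_det_le_of_weighted _ fun i l => ?_
  simp only [quasiPeriodicMatrix, Matrix.of_apply, sub_mul, Finset.sum_mul, coe_eval₂RingHom,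
    eval₂_X, eval₂_C, RingHom.comp_apply]
  refine (natDegree_sub_le _ _).trans (max_le ?_ ?_)
  · split_ifs with h
    · rw [← pow_add, h]
      exact natDegree_X_pow_le _
    · simp
  · refine natDegree_sum_le_of_forall_le _ _ fun j hj => ?_
    split_ifs with h
    · rw [mul_pow, ← C_pow, ← pow_mul, mul_assoc, mul_assoc, ← pow_add]
      refine (natDegree_C_mul_le _ _).trans ((natDegree_C_mul_le _ _).trans
        ((natDegree_X_pow_le _).trans ?_))
      have hdiv := Nat.div_add_mod ((i : ℕ) + j) d
      have hjr := Finset.mem_range.1 hj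
      omega
    · simp

theorem natDegree_coeff_spectralPoly_le (a : ℕ → ℕ → R) {r : ℕ} (hr : r ≠ 0) (d β : ℕ)
    (h : (spectralPoly a r d).coeff β ≠ 0) :
    r * ((spectralPoly a r d).coeff β).natDegree + d * β ≤ d * r := by
  refine le_trans (le_natDegree_of_ne_zero fun h0 => h ?_)
    (natDegree_weightHom_spectralPoly_le a r d)
  rw [← leadingCoeff_eq_zero, leadingCoeff, ← coeff_coeff_weightHom hr d, h0, coeff_zero]

end SpectralCurve

/-! ### Bases of Tate modules -/

section TateBasis

variable {R V ι : Type*} [CommRing R] [AddCommGroup V] [Module R V] [Fintype ι] {h : R}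

/-- The family `v` is a basis of the `a`-torsion of the `R`-module `V` over `R ⧸ (a)`. -/
structure IsTorsionBasis (a : R) (v : ι → V) : Prop where
  smul_eq_zero : ∀ i, a • v i = 0
  exists_eq_sum : ∀ w : V, a • w = 0 → ∃ c : ι → R, w = ∑ i, c i • v i
  dvd_of_sum_eq_zero : ∀ c : ι → R, ∑ i, c i • v i = 0 → ∀ i, a ∣ c i

theorem Torsion.pow_smul_val {m : ℕ} (x : Torsion V h m) : h ^ m • x.val = 0 :=
  (Submodule.mem_torsionBySet_iff _ _).1 x.2
    ⟨h ^ m, Ideal.pow_mem_pow (Ideal.mem_span_singleton_self h) m⟩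

/-- An element of `V` that is killed by `h ^ m`, as a torsion element. -/
def Torsion.ofVal {m : ℕ} (v : V) (hv : h ^ m • v = 0) : Torsion V h m :=
  ⟨v, (Submodule.mem_torsionBySet_iff _ _).2 fun a => by
    obtain ⟨b, hb⟩ : h ^ m ∣ a.1 := by
      rw [← Ideal.mem_span_singleton, ← Ideal.span_singleton_pow]
      exact a.2
    rw [hb, mul_comm, mul_smul, hv, smul_zero]⟩

/-- The component in `V[h ^ m]` of an element of the Tate module. -/
def tateComponent (m : ℕ) : tateModule V h →+ V where
  toFun x := (x.1 m).val
  map_zero' := rfl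
  map_add' _ _ := rfl

theorem smul_tateComponent_succ (x : tateModule V h) (m : ℕ) :
    h • tateComponent (m + 1) x = tateComponent m x := x.2 m

theorem pow_smul_tateComponent_add_one (x : tateModule V h) (m : ℕ) :
    h ^ m • tateComponent (m + 1) x = tateComponent 1 x := by
  induction m with
  | zero => simp
  | succ m ih => rw [pow_succ, mul_smul, smul_tateComponent_succ, ih]

theorem tateComponent_smul {m : ℕ} (a : AdicCompletion (Ideal.span {h}) R) (x : tateModule V h)
    (r : R) (hr : AdicCompletion.evalₐ (Ideal.span {h}) m a = Ideal.Quotient.mk _ r) :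
    tateComponent m (a • x) = r • tateComponent m x :=
  Torsion.val_smul a (x.1 m) r hr

theorem tateModule_ext {x y : tateModule V h} (hxy : ∀ m, tateComponent m x = tateComponent m y) :
    x = y :=
  Subtype.ext (funext fun m => Subtype.ext (hxy m))

theorem exists_tateComponent_one_eq (hsurj : Function.Surjective fun v : V => h • v) {v : V}
    (hv : h • v = 0) : ∃ x : tateModule V h, tateComponent 1 x = v := by
  choose s hs using hsurj
  let u (m : ℕ) : V := Nat.casesOn m 0 fun m => s^[m] v
  have hu (m : ℕ) : h • u (m + 1) = u m := by
    rcases m with _ | m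
    · exact hv
    · change h • s^[m + 1] v = s^[m] v
      rw [Function.iterate_succ_apply']
      exact hs _
  have hpow (m : ℕ) : h ^ m • u m = 0 := by
    induction m with
    | zero => exact smul_zero _
    | succ m ih => rw [pow_succ, mul_smul, hu, ih]
  exact ⟨⟨fun m => Torsion.ofVal (u m) (hpow m), hu⟩, rfl⟩

theorem tateComponent_sum_smul (x : ι → tateModule V h) {m : ℕ}
    (g : ι → AdicCompletion (Ideal.span {h}) R) (c : ι → R)
    (hc : ∀ i, AdicCompletion.evalₐ (Ideal.span {h}) m (g i) = Ideal.Quotient.mk _ (c i)) :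
    tateComponent m (∑ i, g i • x i) = ∑ i, c i • tateComponent m (x i) := by
  rw [map_sum]
  exact Finset.sum_congr rfl fun i _ => tateComponent_smul _ _ _ (hc i)

namespace IsTorsionBasis

variable {x : ι → tateModule V h} (hx : IsTorsionBasis h fun i => tateComponent 1 (x i))

include hx

theorem pow (m : ℕ) : IsTorsionBasis (h ^ m) fun i => tateComponent m (x i) := by
  have hpow (m : ℕ) (c : ι → R) : h ^ m • ∑ i, c i • tateComponent (m + 1) (x i) =
      ∑ i, c i • tateComponent 1 (x i) := by
    simp only [Finset.smul_sum, smul_comm (h ^ m), pow_smul_tateComponent_add_one]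
  have hmul (m : ℕ) (c : ι → R) : ∑ i, (h * c i) • tateComponent (m + 1) (x i) =
      ∑ i, c i • tateComponent m (x i) := by
    simp only [mul_comm h, mul_smul, smul_tateComponent_succ]
  induction m with
  | zero =>
    refine ⟨fun i => ((x i).1 0).pow_smul_val, fun w hw => ⟨0, ?_⟩, fun c _ i => ?_⟩
    · simpa using hw
    · simp
  | succ m ih =>
    refine ⟨fun i => ((x i).1 (m + 1)).pow_smul_val, fun w hw => ?_, fun c hc i => ?_⟩
    · obtain ⟨c, hc⟩ := hx.exists_eq_sum (h ^ m • w) (by rw [smul_smul, ← pow_succ', hw])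
      obtain ⟨b, hb⟩ := ih.exists_eq_sum (w - ∑ i, c i • tateComponent (m + 1) (x i))
        (by rw [smul_sub, hpow, ← hc, sub_self])
      refine ⟨fun i => h * b i + c i, ?_⟩
      simp only [add_smul, Finset.sum_add_distrib]
      rw [hmul, ← hb, sub_add_cancel]
    · choose b hb using hx.dvd_of_sum_eq_zero c (by rw [← hpow m, hc, smul_zero])
      simp only [hb, hmul] at hc ⊢
      rw [pow_succ']
      exact mul_dvd_mul_left _ (ih.dvd_of_sum_eq_zero b hc i)

theorem linearIndependent : LinearIndependent (AdicCompletion (Ideal.span {h}) R) x := by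
  rw [Fintype.linearIndependent_iff]
  refine fun g hg i => AdicCompletion.ext_evalₐ fun m => ?_
  choose c hc using fun i =>
    Ideal.Quotient.mk_surjective (AdicCompletion.evalₐ (Ideal.span {h}) m (g i))
  have hsum := tateComponent_sum_smul x g c fun i => (hc i).symm
  rw [hg, map_zero] at hsum
  rw [← hc i, map_zero, Ideal.Quotient.eq_zero_iff_mem, Ideal.span_singleton_pow,
    Ideal.mem_span_singleton]
  exact (hx.pow m).dvd_of_sum_eq_zero c hsum.symm i

theorem span_eq_top : ⊤ ≤ Submodule.span (AdicCompletion (Ideal.span {h}) R) (Set.range x) := by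
  intro y _
  rw [Submodule.mem_span_range_iff_exists_fun]
  choose c hc using fun m => (hx.pow m).exists_eq_sum _ (y.1 m).pow_smul_val
  have hcomponent (m : ℕ) : tateComponent m y =
      ∑ i, c m i • tateComponent m (x i) := hc m
  have hcauchy (i : ι) (m : ℕ) :
      c m i ≡ c (m + 1) i [SMOD (Ideal.span {h} ^ m • ⊤ : Submodule R R)] := by
    rw [SModEq.sub_mem, smul_eq_mul, Ideal.mul_top, Ideal.span_singleton_pow,
      Ideal.mem_span_singleton]
    refine (hx.pow m).dvd_of_sum_eq_zero (fun i => c m i - c (m + 1) i) ?_ i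
    simp only [sub_smul, Finset.sum_sub_distrib]
    rw [← hcomponent, sub_eq_zero, ← smul_tateComponent_succ, hcomponent, Finset.smul_sum]
    simp only [smul_comm h, smul_tateComponent_succ]
  let g (i : ι) : AdicCompletion (Ideal.span {h}) R :=
    AdicCompletion.mk _ _ (AdicCompletion.AdicCauchySequence.mk _ _ (fun m => c m i) (hcauchy i))
  refine ⟨g, tateModule_ext fun m => ?_⟩
  rw [tateComponent_sum_smul x g (c m) fun i => AdicCompletion.evalₐ_mk _ _ _, hcomponent]

/-- Lifts to the Tate module of a basis of the `h`-torsion form a basis of the Tate module. -/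
def tateBasis : Module.Basis ι (AdicCompletion (Ideal.span {h}) R) (tateModule V h) :=
  .mk hx.linearIndependent hx.span_eq_top

theorem tateBasis_apply (i : ι) : hx.tateBasis i = x i := Module.Basis.mk_apply _ _ i

theorem map_tateComponent_eq_sum [DecidableEq ι] (F : V →ₗ[R] V) {m : ℕ} {N : Matrix ι ι R}
    (hN : ∀ i j, AdicCompletion.evalₐ (Ideal.span {h}) m
      (LinearMap.toMatrix hx.tateBasis hx.tateBasis (tateMap h F) i j) =
        Ideal.Quotient.mk _ (N i j)) (j : ι) :
    F (tateComponent m (x j)) = ∑ i, N i j • tateComponent m (x i) := by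
  rw [← tateComponent_sum_smul x _ _ fun i => hN i j]
  have hsum : ∑ i, LinearMap.toMatrix hx.tateBasis hx.tateBasis (tateMap h F) i j • x i =
      tateMap h F (x j) := by
    simpa only [LinearMap.toMatrix_apply, tateBasis_apply] using
      hx.tateBasis.sum_repr (tateMap h F (hx.tateBasis j))
  exact congrArg (tateComponent m) hsum.symm

end IsTorsionBasis

end TateBasis

theorem natCard_quotient_span {Fq : Type*} [Field Fq] [Fintype Fq] {h : Fq[X]} (hh : h ≠ 0) :
    Nat.card (Fq[X] ⧸ Ideal.span {h}) = Fintype.card Fq ^ h.natDegree := by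
  have : Module.Finite Fq (Fq[X] ⧸ Ideal.span {h}) := (AdjoinRoot.powerBasis hh).finite
  rw [Module.natCard_eq_pow_finrank (K := Fq), Nat.card_eq_fintype_card,
    finrank_quotient_span_eq_natDegree]

theorem exists_isTorsionBasis {Fq : Type*} [Field Fq] [Fintype Fq] {h : Fq[X]}
    (hh : Irreducible h) {V : Type*} [AddCommGroup V] [Module Fq[X] V] {r : ℕ}
    (hcard : Nat.card (Submodule.torsionBy Fq[X] V h) = Fintype.card Fq ^ (r * h.natDegree)) :
    ∃ v : Fin r → V, IsTorsionBasis h v := by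
  let M := Submodule.torsionBy Fq[X] V h
  have hmem (v : V) : v ∈ M ↔ h • v = 0 := Submodule.mem_torsionBy_iff _ _
  have : (Ideal.span {h}).IsMaximal := PrincipalIdealRing.isMaximal_of_irreducible hh
  let _ : Field (Fq[X] ⧸ Ideal.span {h}) := Ideal.Quotient.field _
  have : Finite M := Nat.finite_of_card_ne_zero (hcard ▸ pow_ne_zero _ Fintype.card_ne_zero)
  have : Module.Finite (Fq[X] ⧸ Ideal.span {h}) M := Module.Finite.of_finite
  have hrank : Module.finrank (Fq[X] ⧸ Ideal.span {h}) M = r := by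
    have hpow := Module.natCard_eq_pow_finrank (K := Fq[X] ⧸ Ideal.span {h}) (V := M)
    rw [hcard, natCard_quotient_span hh.ne_zero, ← pow_mul, mul_comm] at hpow
    exact (Nat.eq_of_mul_eq_mul_left hh.natDegree_pos
      (Nat.pow_right_injective (Fintype.one_lt_card (α := Fq)) hpow)).symm
  let b := Module.finBasisOfFinrankEq (Fq[X] ⧸ Ideal.span {h}) M hrank
  have hsum (c : Fin r → Fq[X]) :
      ((∑ i, Ideal.Quotient.mk (Ideal.span {h}) (c i) • b i : M) : V) = ∑ i, c i • (b i : V) := by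
    rw [Submodule.coe_sum]
    rfl
  refine ⟨fun j => b j, fun j => (hmem _).1 (b j).2, fun w hw => ?_, fun c hc i => ?_⟩
  · choose c hc using fun i => Ideal.Quotient.mk_surjective (b.repr ⟨w, (hmem w).2 hw⟩ i)
    exact ⟨c, by rw [← hsum]; simp only [hc, b.sum_repr]⟩
  · have hzero := Fintype.linearIndependent_iff.1 b.linearIndependent _
      (Subtype.ext ((hsum c).trans hc)) i
    rwa [Ideal.Quotient.eq_zero_iff_mem, Ideal.mem_span_singleton] at hzero

/-! ### Additive polynomials -/

section Additive

variable {Fq : Type*} [Field Fq]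

theorem map_aeval_apply {M N : Type*} [AddCommGroup M] [AddCommGroup N] [Module Fq M] [Module Fq N]
    {S : Module.End Fq M} {T : Module.End Fq N} {f : M →ₗ[Fq] N} (hf : ∀ m, f (S m) = T (f m))
    (p : Fq[X]) (m : M) : f (aeval S p m) = aeval T p (f m) := by
  induction p using Polynomial.induction_on generalizing m with
  | C c => simp
  | add p p' hp hp' => simp only [map_add, LinearMap.add_apply, hp, hp']
  | monomial k c hk =>
    rw [pow_succ, ← mul_assoc, map_mul (aeval S), map_mul (aeval T), aeval_X, aeval_X,
      Module.End.mul_apply, Module.End.mul_apply, hk, hf]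

theorem linearIndepOn_of_injOn_natDegree {K ι : Type*} [Field K] {P : ι → K[X]} {s : Finset ι}
    (hne : ∀ i ∈ s, P i ≠ 0) (hinj : Set.InjOn (fun i => (P i).natDegree) s) :
    LinearIndepOn K P s := by
  rw [linearIndepOn_finset_iff]
  intro c hc i hi
  have hdeg := degree_sum_eq_of_disjoint (fun i => c i • P i) s fun j hj l hl hjl hdegree =>
    hjl (hinj hj.1 hl.1 (by
      have hcj : c j ≠ 0 := fun h => hj.2 (by simp [h])
      have hcl : c l ≠ 0 := fun h => hl.2 (by simp [h])
      simpa only [natDegree_smul _ hcj, natDegree_smul _ hcl] using natDegree_eq_of_degree_eq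
        hdegree))
  rw [hc, degree_zero, eq_comm, Finset.sup_eq_bot_iff] at hdeg
  exact (smul_eq_zero.1 (degree_eq_bot.1 (hdeg i hi))).resolve_right (hne i hi)

variable [Fintype Fq] {E : Type*} [Field E] [Algebra Fq E] (α : ℕ → E) (r : ℕ)

/-- The map `P ↦ ∑_{j ≤ r} α_j P ^ (q ^ j)` on `E[X]`, that is, the composition on the left with
the additive polynomial `∑_{j ≤ r} α_j X ^ (q ^ j)`. -/
def additiveEnd : Module.End Fq E[X] :=
  skewAction (FiniteField.frobeniusAlgHom Fq E[X]) fun j : Fin (r + 1) => C (α j)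

/-- The polynomial that describes the action of `a` on an `Fq[X]`-module with underlying space `E`
in which `X` acts as the additive polynomial `∑_{j ≤ r} α_j X ^ (q ^ j)`. -/
def actionPoly (a : Fq[X]) : E[X] := aeval (additiveEnd (Fq := Fq) α r) a X

theorem frobeniusAlgHom_pow_apply {B : Type*} [CommRing B] [Algebra Fq B] (n : ℕ) (x : B) :
    (FiniteField.frobeniusAlgHom Fq B ^ n) x = x ^ Fintype.card Fq ^ n := by
  rw [AlgHom.coe_pow, FiniteField.coe_frobeniusAlgHom, pow_iterate]

variable (Fq) in
theorem natCast_card_eq_zero (B : Type*) [CommRing B] [Algebra Fq B] :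
    (Fintype.card Fq : B) = 0 := by
  rw [← map_natCast (algebraMap Fq B), FiniteField.cast_card_eq_zero, map_zero]

variable {α r}

theorem additiveEnd_apply (P : E[X]) :
    additiveEnd (Fq := Fq) α r P =
      ∑ j ∈ Finset.range (r + 1), C (α j) * P ^ Fintype.card Fq ^ j := by
  simp only [additiveEnd, skewAction_apply, frobeniusAlgHom_pow_apply]
  exact Fin.sum_univ_eq_sum_range (fun j => C (α j) * P ^ Fintype.card Fq ^ j) _

theorem natDegree_additiveEnd (hα : α r ≠ 0) {P : E[X]} (hP : P.natDegree ≠ 0) :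
    (additiveEnd (Fq := Fq) α r P).natDegree = Fintype.card Fq ^ r * P.natDegree := by
  have hlead : (C (α r) * P ^ Fintype.card Fq ^ r).natDegree =
      Fintype.card Fq ^ r * P.natDegree := by
    rw [natDegree_C_mul hα, natDegree_pow]
  have hpos : 0 < Fintype.card Fq ^ r * P.natDegree := by positivity
  rw [additiveEnd_apply, Finset.sum_range_succ, natDegree_add_eq_right_of_natDegree_lt, hlead]
  rw [hlead, Nat.lt_iff_le_pred hpos]
  refine natDegree_sum_le_of_forall_le _ _ fun j hj => Nat.le_pred_of_lt ?_
  calc (C (α j) * P ^ Fintype.card Fq ^ j).natDegree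
      ≤ Fintype.card Fq ^ j * P.natDegree := (natDegree_C_mul_le _ _).trans natDegree_pow_le
    _ < Fintype.card Fq ^ r * P.natDegree := by
      gcongr
      exacts [Fintype.one_lt_card, Finset.mem_range.1 hj]

theorem derivative_additiveEnd (P : E[X]) :
    derivative (additiveEnd (Fq := Fq) α r P) = C (α 0) * derivative P := by
  rw [additiveEnd_apply, Finset.sum_range_succ', derivative_add, derivative_sum,
    Finset.sum_eq_zero, zero_add]
  · simp
  · intro j _
    simp [derivative_pow, natCast_card_eq_zero Fq E]

theorem natDegree_actionPoly_X_pow (hα : α r ≠ 0) (k : ℕ) :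
    (actionPoly α r (X ^ k : Fq[X])).natDegree = Fintype.card Fq ^ (r * k) := by
  induction k with
  | zero => simp [actionPoly]
  | succ k ih =>
    rw [actionPoly, pow_succ', map_mul, aeval_X, Module.End.mul_apply, ← actionPoly,
      natDegree_additiveEnd hα (ih ▸ by positivity), ih, ← pow_add, mul_add_one, add_comm]

theorem actionPoly_rank_zero (a : Fq[X]) : actionPoly α 0 a = C (aeval (α 0) a) * X := by
  have hend : additiveEnd (Fq := Fq) α 0 = Algebra.lmul Fq E[X] (C (α 0)) :=
    LinearMap.ext fun P => by simp [additiveEnd_apply]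
  rw [actionPoly, hend, aeval_algHom_apply]
  exact congrArg (· * X) (aeval_algebraMap_apply E[X] (α 0) a)

theorem derivative_actionPoly (a : Fq[X]) :
    derivative (actionPoly α r a) = C (aeval (α 0) a) := by
  have hcomm := map_aeval_apply (f := (derivative (R := E)).restrictScalars Fq)
    (T := Algebra.lmul Fq E[X] (C (α 0))) (derivative_additiveEnd (Fq := Fq) (r := r)) a X
  have haeval : aeval (C (α 0)) a = C (aeval (α 0) a) := aeval_algebraMap_apply E[X] (α 0) a
  rw [aeval_algHom_apply, haeval] at hcomm
  simpa [actionPoly] using hcomm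

theorem natDegree_actionPoly (hα : r ≠ 0 → α r ≠ 0) {a : Fq[X]} (ha : aeval (α 0) a ≠ 0) :
    (actionPoly α r a).natDegree = Fintype.card Fq ^ (r * a.natDegree) := by
  rcases eq_or_ne r 0 with rfl | hr
  · rw [actionPoly_rank_zero, natDegree_C_mul_X _ ha, zero_mul, pow_zero]
  have ha0 : a ≠ 0 := fun h => ha (by simp [h])
  have hsum : actionPoly α r a = ∑ k ∈ Finset.range (a.natDegree + 1),
      a.coeff k • actionPoly α r (X ^ k : Fq[X]) := by
    simp [actionPoly, aeval_eq_sum_range]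
  have hdeg (k : ℕ) : (a.coeff k • actionPoly α r (X ^ k : Fq[X])).natDegree ≤
      Fintype.card Fq ^ (r * k) :=
    (natDegree_smul_le _ _).trans_eq (natDegree_actionPoly_X_pow (hα hr) k)
  have hlead : (a.coeff a.natDegree • actionPoly α r (X ^ a.natDegree : Fq[X])).natDegree =
      Fintype.card Fq ^ (r * a.natDegree) := by
    rw [← algebraMap_smul E, natDegree_smul _ (by simpa using ha0),
      natDegree_actionPoly_X_pow (hα hr)]
  have hpos : 0 < Fintype.card Fq ^ (r * a.natDegree) := by positivity
  rw [hsum, Finset.sum_range_succ, natDegree_add_eq_right_of_natDegree_lt, hlead]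
  rw [hlead, Nat.lt_iff_le_pred hpos]
  refine natDegree_sum_le_of_forall_le _ _ fun k hk => Nat.le_pred_of_lt ((hdeg k).trans_lt ?_)
  exact Nat.pow_lt_pow_right Fintype.one_lt_card
    (Nat.mul_lt_mul_of_pos_left (Finset.mem_range.1 hk) hr.bot_lt)

theorem linearIndepOn_actionPoly_X_pow_pow (hα : α r ≠ 0) (m : ℕ) :
    LinearIndepOn E (fun p : Fin r × ℕ =>
        actionPoly α r (X ^ p.2 : Fq[X]) ^ Fintype.card Fq ^ (p.1 : ℕ))
      ↑(Finset.univ ×ˢ Finset.range m : Finset (Fin r × ℕ)) := by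
  have hdeg (p : Fin r × ℕ) :
      (actionPoly α r (X ^ p.2 : Fq[X]) ^ Fintype.card Fq ^ (p.1 : ℕ)).natDegree =
        Fintype.card Fq ^ (p.1 + r * p.2) := by
    rw [natDegree_pow, natDegree_actionPoly_X_pow hα, pow_add]
  refine linearIndepOn_of_injOn_natDegree (fun p _ h => ?_) fun p _ p' _ h => ?_
  · have hpos : 0 < Fintype.card Fq ^ (p.1 + r * p.2) := by positivity
    rw [← hdeg, h, natDegree_zero] at hpos
    exact hpos.false
  · simp only [hdeg] at h
    have hexp := Nat.pow_right_injective Fintype.one_lt_card h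
    have hr : 0 < r := p.1.pos
    refine Prod.ext (Fin.ext ?_) ?_
    · simpa [Nat.add_mul_mod_self_left, Nat.mod_eq_of_lt] using congrArg (· % r) hexp
    · simpa [Nat.add_mul_div_left, hr, Nat.div_eq_of_lt] using congrArg (· / r) hexp

variable {V : Type*} [AddCommGroup V] [Module Fq V] [Module Fq[X] V] [IsScalarTower Fq Fq[X] V]

/-- In the coordinate `o`, the variable acts on the `Fq[X]`-module `V` as the additive polynomial
`∑_{j ≤ r} α_j X ^ (q ^ j)`. -/
def IsAdditiveAction (o : V ≃ₗ[Fq] E) (α : ℕ → E) (r : ℕ) : Prop :=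
  ∀ v, o ((X : Fq[X]) • v) = ∑ j ∈ Finset.range (r + 1), α j * o v ^ Fintype.card Fq ^ j

namespace IsAdditiveAction

variable {o : V ≃ₗ[Fq] E} (ho : IsAdditiveAction o α r)

include ho

theorem eval_actionPoly (a : Fq[X]) (v : V) : (actionPoly α r a).eval (o v) = o (a • v) := by
  let f : E[X] →ₗ[Fq] V := o.symm.toLinearMap ∘ₗ (leval (o v)).restrictScalars Fq
  have hf (P : E[X]) : f (additiveEnd (Fq := Fq) α r P) = (X : Fq[X]) • f P :=
    o.injective (by simp [f, ho (o.symm _), additiveEnd_apply])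
  have hact := map_aeval_apply (T := Algebra.lsmul Fq Fq V (X : Fq[X])) hf a X
  rw [aeval_algHom_apply, aeval_X_left_apply] at hact
  simpa [f, actionPoly] using congrArg o hact

theorem natCard_torsionBy [IsAlgClosed E] (hα : r ≠ 0 → α r ≠ 0) {a : Fq[X]}
    (ha : aeval (α 0) a ≠ 0) :
    Nat.card (Submodule.torsionBy Fq[X] V a) = Fintype.card Fq ^ (r * a.natDegree) := by
  classical
  have hsep : (actionPoly α r a).Separable := by
    rw [separable_def, derivative_actionPoly]
    exact ⟨0, C (aeval (α 0) a)⁻¹, by rw [zero_mul, zero_add, ← C_mul, inv_mul_cancel₀ ha, C_1]⟩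
  have hmem (v : V) : v ∈ Submodule.torsionBy Fq[X] V a ↔ o v ∈ (actionPoly α r a).rootSet E := by
    rw [Submodule.mem_torsionBy_iff, mem_rootSet, coe_aeval_eq_eval, ho.eval_actionPoly,
      map_eq_zero_iff _ o.injective, and_iff_right hsep.ne_zero]
  rw [← natDegree_actionPoly hα ha,
    ← card_rootSet_eq_natDegree (K := E) hsep (IsAlgClosed.splits _), ← Nat.card_eq_fintype_card]
  exact Nat.card_congr (o.toEquiv.subtypeEquiv hmem)

theorem smul_surjective [IsAlgClosed E] (hα : r ≠ 0 → α r ≠ 0) {a : Fq[X]}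
    (ha : aeval (α 0) a ≠ 0) : Function.Surjective fun v : V => a • v := by
  intro w
  have hdeg : (actionPoly α r a - C (o w)).natDegree ≠ 0 := by
    rw [natDegree_sub_C, natDegree_actionPoly hα ha]
    positivity
  obtain ⟨x, hx⟩ := IsAlgClosed.exists_root _ fun h => hdeg (natDegree_eq_of_degree_eq_some h)
  refine ⟨o.symm x, o.injective ?_⟩
  rwa [IsRoot, eval_sub, eval_C, sub_eq_zero, ← o.apply_symm_apply x, ho.eval_actionPoly] at hx

theorem eq_zero_of_forall_torsion_eval [IsAlgClosed E] (hα : r ≠ 0 → α r ≠ 0) {a : Fq[X]}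
    (ha : aeval (α 0) a ≠ 0) {P : E[X]} (hdeg : P.natDegree < Fintype.card Fq ^ (r * a.natDegree))
    (hP : ∀ v, a • v = 0 → P.eval (o v) = 0) : P = 0 := by
  let roots : Submodule.torsionBy Fq[X] V a → E := fun v => o v
  rw [← ho.natCard_torsionBy hα ha] at hdeg
  have : Finite (Submodule.torsionBy Fq[X] V a) := Nat.finite_of_card_ne_zero (by lia)
  let _ := Fintype.ofFinite (Submodule.torsionBy Fq[X] V a)
  refine eq_zero_of_natDegree_lt_card_of_eval_eq_zero P (f := roots)
    (o.injective.comp Subtype.val_injective)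
    (fun v => hP _ ((Submodule.mem_torsionBy_iff _ _).1 v.2)) (by rwa [← Nat.card_eq_fintype_card])

/-- The functions `v ↦ o (X ^ k • v) ^ (q ^ l)` with `l < r` and `k < deg a` are linearly
independent on the `a`-torsion: a linear combination of them is a polynomial of degree less than
the number of torsion points. -/
theorem eq_zero_of_forall_torsion_sum [IsAlgClosed E] (hα : r ≠ 0 → α r ≠ 0) {a : Fq[X]}
    (ha : aeval (α 0) a ≠ 0) {y : Fin r → ℕ → E}
    (hy : ∀ v, a • v = 0 → ∑ l, ∑ k ∈ Finset.range a.natDegree,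
      y l k * o ((X ^ k : Fq[X]) • v) ^ Fintype.card Fq ^ (l : ℕ) = 0)
    (l : Fin r) {k : ℕ} (hk : k < a.natDegree) : y l k = 0 := by
  have hr : r ≠ 0 := l.pos.ne'
  let P (p : Fin r × ℕ) : E[X] := actionPoly α r (X ^ p.2 : Fq[X]) ^ Fintype.card Fq ^ (p.1 : ℕ)
  suffices hzero : ∑ p ∈ Finset.univ ×ˢ Finset.range a.natDegree, y p.1 p.2 • P p = 0 from
    linearIndepOn_finset_iff.1 (linearIndepOn_actionPoly_X_pow_pow (hα hr) a.natDegree)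
      (fun p => y p.1 p.2) hzero (l, k) (by simpa using hk)
  refine ho.eq_zero_of_forall_torsion_eval hα ha ?_ fun v hv => ?_
  · have hpos : 0 < Fintype.card Fq ^ (r * a.natDegree) := by positivity
    rw [Nat.lt_iff_le_pred hpos]
    refine natDegree_sum_le_of_forall_le _ _ fun p hp => Nat.le_pred_of_lt ?_
    have hexp : p.1 + r * p.2 < r * a.natDegree := by
      have hp2 : p.2 + 1 ≤ a.natDegree := by simpa using hp
      nlinarith [p.1.isLt, Nat.mul_le_mul_left r hp2]
    refine (natDegree_smul_le _ _).trans_lt ?_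
    rw [natDegree_pow, natDegree_actionPoly_X_pow (hα hr), ← pow_add]
    exact Nat.pow_lt_pow_right Fintype.one_lt_card hexp
  · simpa [P, eval_finsetSum, Finset.sum_product, ho.eval_actionPoly] using hy v hv

end IsAdditiveAction

end Additive

/-! ### Duality between torsion points and `E[t] / a` -/

section TopCoeff

variable {E : Type*} [Field E] {g : E[X]} (hg : g.Monic)

/-- The coefficient of `t ^ (deg g - 1)` on `E[t] / g`. -/
def topCoeff : AdjoinRoot g →ₗ[E] E :=
  (lcoeff E (g.natDegree - 1)).comp (AdjoinRoot.modByMonicHom hg)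

theorem topCoeff_mk (p : E[X]) :
    topCoeff hg (AdjoinRoot.mk g p) = (p %ₘ g).coeff (g.natDegree - 1) := rfl

theorem topCoeff_of_mul (c : E) (y : AdjoinRoot g) :
    topCoeff hg (AdjoinRoot.of g c * y) = c * topCoeff hg y := by
  rw [← AdjoinRoot.algebraMap_eq, ← Algebra.smul_def, map_smul, smul_eq_mul]

theorem eq_zero_of_topCoeff {y : AdjoinRoot g}
    (hy : ∀ k, topCoeff hg (AdjoinRoot.root g ^ k * y) = 0) : y = 0 := by
  obtain ⟨p, hdeg, rfl⟩ : ∃ p : E[X], p.degree < g.degree ∧ AdjoinRoot.mk g p = y :=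
    ⟨AdjoinRoot.modByMonicHom hg y, by
      obtain ⟨p, rfl⟩ := AdjoinRoot.mk_surjective y
      exact degree_modByMonic_lt p hg, AdjoinRoot.mk_leftInverse hg y⟩
  by_contra hne
  have hp : p ≠ 0 := fun h => hne (by rw [h, map_zero])
  have hlt : p.natDegree < g.natDegree := natDegree_lt_natDegree hp hdeg
  -- Multiplication by this power of `t` moves the leading coefficient of `p` to the top.
  have htop := hy (g.natDegree - 1 - p.natDegree)
  rw [← AdjoinRoot.mk_X, ← map_pow, ← map_mul, topCoeff_mk, (modByMonic_eq_self_iff hg).2,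
    coeff_X_pow_mul', if_pos (by lia), show g.natDegree - 1 - (g.natDegree - 1 - p.natDegree) =
      p.natDegree by lia] at htop
  · exact hp (leadingCoeff_eq_zero.1 htop)
  · refine degree_lt_degree ?_
    rw [natDegree_X_pow_mul _ hp]
    lia

theorem ext_topCoeff {y y' : AdjoinRoot g}
    (hy : ∀ k, topCoeff hg (AdjoinRoot.root g ^ k * y) =
      topCoeff hg (AdjoinRoot.root g ^ k * y')) : y = y' :=
  sub_eq_zero.1 (eq_zero_of_topCoeff hg fun k => by rw [mul_sub, map_sub, hy, sub_self])

theorem exists_topCoeff_mul_eq (L : AdjoinRoot g →ₗ[E] E) :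
    ∃ y, ∀ x, topCoeff hg (x * y) = L x := by
  have : Module.Finite E (AdjoinRoot g) := hg.finite_adjoinRoot
  let D : AdjoinRoot g →ₗ[E] (AdjoinRoot g →ₗ[E] E) :=
    ((LinearMap.mul E (AdjoinRoot g)).compr₂ (topCoeff hg)).flip
  have hinj : Function.Injective D := (injective_iff_map_eq_zero D).2 fun y hy =>
    eq_zero_of_topCoeff hg fun k => LinearMap.congr_fun hy _
  have hsurj : Function.Surjective D :=
    (LinearMap.injective_iff_surjective_of_finrank_eq_finrank
      (Subspace.dual_finrank_eq (K := E) (V := AdjoinRoot g)).symm).1 hinj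
  obtain ⟨y, hy⟩ := hsurj L
  exact ⟨y, LinearMap.congr_fun hy⟩

theorem topCoeff_map (ψ : E →+* E) (hψ : g.map ψ = g) (y : AdjoinRoot g) :
    topCoeff hg (AdjoinRoot.map ψ g g (dvd_of_eq hψ.symm) y) = ψ (topCoeff hg y) := by
  obtain ⟨p, rfl⟩ := AdjoinRoot.mk_surjective y
  have hmap : AdjoinRoot.map ψ g g (dvd_of_eq hψ.symm) (AdjoinRoot.mk g p) =
      AdjoinRoot.mk g (p.map ψ) := by
    rw [AdjoinRoot.map, AdjoinRoot.lift_mk, ← eval₂_map, ← AdjoinRoot.aeval_eq]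
    rfl
  rw [hmap, topCoeff_mk, topCoeff_mk]
  conv_lhs => rw [← hψ, ← map_modByMonic ψ hg, hψ]
  rw [coeff_map]

include hg

theorem exists_eq_sum_of_mul_root_pow (y : AdjoinRoot g) : ∃ c : ℕ → E,
    y = ∑ k ∈ Finset.range g.natDegree, AdjoinRoot.of g (c k) * AdjoinRoot.root g ^ k := by
  obtain ⟨p, rfl⟩ := AdjoinRoot.mk_surjective y
  refine ⟨(p %ₘ g).coeff, ?_⟩
  have hmk : AdjoinRoot.mk g p = AdjoinRoot.mk g (p %ₘ g) :=
    (AdjoinRoot.mk_leftInverse hg (AdjoinRoot.mk g p)).symm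
  rcases eq_or_ne g 1 with rfl | hg1
  · simp [hmk]
  have hsum := congrArg (AdjoinRoot.mk g)
    (as_sum_range_C_mul_X_pow' (p %ₘ g) (natDegree_modByMonic_lt p hg hg1))
  simpa only [hmk, map_sum, map_mul, map_pow, AdjoinRoot.mk_X, AdjoinRoot.mk_C] using hsum

theorem isUnit_of_vecMul_injective {ι : Type*} [Fintype ι] [DecidableEq ι]
    {W : Matrix ι ι (AdjoinRoot g)} (hW : ∀ y, Matrix.vecMul y W = 0 → y = 0) : IsUnit W := by
  have : Module.Finite E (AdjoinRoot g) := hg.finite_adjoinRoot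
  let F : (ι → AdjoinRoot g) →ₗ[E] (ι → AdjoinRoot g) := W.vecMulLinear.restrictScalars E
  have hinj : Function.Injective F := (injective_iff_map_eq_zero F).2 hW
  choose U hU using fun i => LinearMap.injective_iff_surjective.1 hinj (Pi.single i 1)
  refine IsUnit.of_mul_eq_one_right (Matrix.of U) (Matrix.ext fun i j => ?_)
  rw [Matrix.one_eq_pi_single]
  exact congrFun (hU i) j

end TopCoeff

section ScalarQuotient

variable {Fq E : Type*} [Field Fq] [Field E] [Algebra Fq E] {a : Fq[X]}

/-- The quotient `E[t] / a`. -/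
abbrev ScalarQuotient (E : Type*) [Field E] [Algebra Fq E] (a : Fq[X]) : Type _ :=
  AdjoinRoot (a.map (algebraMap Fq E))

variable (E a) in
/-- The canonical map from `Fq[t]` to `E[t] / a`. -/
def toScalarQuotient : Fq[X] →+* ScalarQuotient E a :=
  (AdjoinRoot.mk _).comp (mapRingHom (algebraMap Fq E))

theorem toScalarQuotient_apply (c : Fq[X]) :
    toScalarQuotient E a c = AdjoinRoot.mk _ (c.map (algebraMap Fq E)) := rfl

theorem toScalarQuotient_X : toScalarQuotient E a X = AdjoinRoot.root _ := by
  rw [toScalarQuotient_apply, map_X, AdjoinRoot.mk_X]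

variable [Fintype Fq]

variable (E a) in
theorem map_frobenius_map_algebraMap :
    (a.map (algebraMap Fq E)).map (FiniteField.frobeniusAlgHom Fq E).toRingHom =
      a.map (algebraMap Fq E) := by
  rw [Polynomial.map_map]
  exact congrArg (a.map ·) (AlgHom.comp_algebraMap (FiniteField.frobeniusAlgHom Fq E))

variable (E a) in
/-- The action of the `q`-Frobenius of `E` on `E[t] / a`, through the coefficients. -/
def coeffFrobenius : ScalarQuotient E a →+* ScalarQuotient E a :=
  AdjoinRoot.map (FiniteField.frobeniusAlgHom Fq E).toRingHom _ _
    (dvd_of_eq (map_frobenius_map_algebraMap E a).symm)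

theorem coeffFrobenius_pow_of (n : ℕ) (c : E) :
    (coeffFrobenius E a ^ n) (AdjoinRoot.of _ c) = AdjoinRoot.of _ (c ^ Fintype.card Fq ^ n) := by
  induction n with
  | zero => simp
  | succ n ih =>
    rw [pow_succ', RingHom.mul_def, RingHom.comp_apply, ih, pow_succ, pow_mul]
    exact AdjoinRoot.map_of _ _ _ _ _

theorem coeffFrobenius_pow_toScalarQuotient (n : ℕ) (c : Fq[X]) :
    (coeffFrobenius E a ^ n) (toScalarQuotient E a c) = toScalarQuotient E a c := by
  have hcomp : (coeffFrobenius E a).comp (toScalarQuotient E a) = toScalarQuotient E a := by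
    refine Polynomial.ringHom_ext (fun x => ?_) ?_
    · rw [RingHom.comp_apply, toScalarQuotient_apply, map_C, AdjoinRoot.mk_C,
        ← pow_one (coeffFrobenius E a), coeffFrobenius_pow_of, pow_one, ← map_pow,
        FiniteField.pow_card]
    · rw [RingHom.comp_apply, toScalarQuotient_X]
      exact AdjoinRoot.map_root _ _ _ _
  induction n with
  | zero => rfl
  | succ n ih =>
    rw [pow_succ', RingHom.mul_def, RingHom.comp_apply, ih, ← RingHom.comp_apply, hcomp]

theorem topCoeff_coeffFrobenius_pow (ha : a.Monic) (n : ℕ) (y : ScalarQuotient E a) :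
    topCoeff (ha.map _) ((coeffFrobenius E a ^ n) y) =
      topCoeff (ha.map _) y ^ Fintype.card Fq ^ n := by
  induction n with
  | zero => simp
  | succ n ih =>
    rw [pow_succ', RingHom.mul_def, RingHom.comp_apply, pow_succ, pow_mul, ← ih]
    exact topCoeff_map (ha.map _) _ (map_frobenius_map_algebraMap E a) _

end ScalarQuotient

section IsDual

variable {Fq E V : Type*} [Field Fq] [Field E] [Algebra Fq E] {a : Fq[X]} (ha : a.Monic)
variable [AddCommGroup V] [Module Fq V] [Module Fq[X] V]
variable (o : V ≃ₗ[Fq] E)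

/-- The element `ω` of `E[t] / a` represents, with respect to the pairing
`(x, y) ↦ topCoeff (x * y)`, the linear form `t ^ k ↦ o (t ^ k • v)`. These `ω` play the role of
Anderson's generating functions of the torsion points `v`. -/
def IsDual (v : V) (ω : ScalarQuotient E a) : Prop :=
  ∀ c : Fq[X], topCoeff (ha.map _) (toScalarQuotient E a c * ω) = o (c • v)

theorem exists_isDual [IsScalarTower Fq Fq[X] V] {v : V} (hv : a • v = 0) :
    ∃ ω, IsDual ha o v ω := by
  let L₀ : E[X] →ₗ[E] E :=
    Polynomial.lsum fun k => LinearMap.toSpanSingleton E E (o ((X ^ k : Fq[X]) • v))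
  have hL₀ (x : E) (c : Fq[X]) : L₀ (C x * c.map (algebraMap Fq E)) = x * o (c • v) := by
    induction c using Polynomial.induction_on' with
    | add c c' hc hc' => simp only [Polynomial.map_add, mul_add, map_add, hc, hc', add_smul]
    | monomial n c =>
      have hsmul : monomial n c • v = c • (X ^ n : Fq[X]) • v := by
        rw [← smul_X_eq_monomial, smul_assoc]
      rw [map_monomial, C_mul_monomial, Polynomial.lsum_apply, sum_monomial_index _ _ (by simp),
        LinearMap.toSpanSingleton_apply, hsmul, map_smul o, Algebra.smul_def c, smul_eq_mul,
        mul_assoc]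
  have hker : (Ideal.span {a.map (algebraMap Fq E)}).restrictScalars E ≤ LinearMap.ker L₀ := by
    intro p hp
    obtain ⟨b, rfl⟩ := Ideal.mem_span_singleton.1 hp
    clear hp
    rw [LinearMap.mem_ker]
    induction b using Polynomial.induction_on' with
    | add b b' hb hb' => rw [mul_add, map_add, hb, hb', add_zero]
    | monomial n c =>
      rw [← C_mul_X_pow_eq_monomial, mul_left_comm, ← Polynomial.map_X (algebraMap Fq E),
        ← Polynomial.map_pow, ← Polynomial.map_mul, hL₀, mul_comm a, mul_smul, hv, smul_zero,
        map_zero, mul_zero]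
  let L : ScalarQuotient E a →ₗ[E] E :=
    (Submodule.liftQ _ L₀ hker).comp (Submodule.Quotient.restrictScalarsEquiv E
      (Ideal.span {a.map (algebraMap Fq E)})).symm.toLinearMap
  have hL (p : E[X]) : L (AdjoinRoot.mk _ p) = L₀ p := rfl
  obtain ⟨ω, hω⟩ := exists_topCoeff_mul_eq (ha.map (algebraMap Fq E)) L
  refine ⟨ω, fun c => ?_⟩
  rw [hω, toScalarQuotient_apply, hL]
  simpa using hL₀ 1 c

namespace IsDual

variable {ha o} {v : V} {ω ω' : ScalarQuotient E a}

theorem unique (hω : IsDual ha o v ω) (hω' : IsDual ha o v ω') : ω = ω' := by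
  refine ext_topCoeff (ha.map (algebraMap Fq E)) fun k => ?_
  rw [← toScalarQuotient_X, ← map_pow, hω, hω']

theorem smul (hω : IsDual ha o v ω) (c : Fq[X]) :
    IsDual ha o (c • v) (toScalarQuotient E a c * ω) := fun b => by
  rw [← mul_assoc, ← map_mul, hω, mul_smul]

theorem sum {ι : Type*} {s : Finset ι} {v : ι → V} {ω : ι → ScalarQuotient E a}
    (hω : ∀ i ∈ s, IsDual ha o (v i) (ω i)) : IsDual ha o (∑ i ∈ s, v i) (∑ i ∈ s, ω i) :=
  fun c => by
    rw [Finset.mul_sum, Finset.smul_sum, map_sum, map_sum]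
    exact Finset.sum_congr rfl fun i hi => hω i hi c

variable [Fintype Fq]

theorem topCoeff_mul_coeffFrobenius_pow (hω : IsDual ha o v ω) (c : Fq[X]) (n : ℕ) :
    topCoeff (ha.map _) (toScalarQuotient E a c * (coeffFrobenius E a ^ n) ω) =
      o (c • v) ^ Fintype.card Fq ^ n := by
  rw [← hω, ← topCoeff_coeffFrobenius_pow ha, map_mul (coeffFrobenius E a ^ n),
    coeffFrobenius_pow_toScalarQuotient]

theorem coeffFrobenius_pow (hω : IsDual ha o v ω) {n : ℕ} {F : V →ₗ[Fq[X]] V}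
    (hF : ∀ v, o (F v) = o v ^ Fintype.card Fq ^ n) :
    IsDual ha o (F v) ((coeffFrobenius E a ^ n) ω) := fun c => by
  rw [hω.topCoeff_mul_coeffFrobenius_pow, ← hF, map_smul]

variable {α : ℕ → E} {r : ℕ}

theorem root_mul (hω : IsDual ha o v ω) (ho : IsAdditiveAction o α r) :
    AdjoinRoot.root _ * ω =
      ∑ j ∈ Finset.range (r + 1), AdjoinRoot.of _ (α j) * (coeffFrobenius E a ^ j) ω := by
  refine ext_topCoeff (ha.map (algebraMap Fq E)) fun k => ?_
  simp only [← toScalarQuotient_X, ← map_pow, Finset.mul_sum, map_sum]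
  rw [(hω.smul X), smul_comm, ho]
  refine Finset.sum_congr rfl fun j _ => ?_
  rw [mul_left_comm, topCoeff_of_mul, hω.topCoeff_mul_coeffFrobenius_pow]

theorem isRecSolution (hω : IsDual ha o v ω) (ho : IsAdditiveAction o α r) :
    IsRecSolution (AdjoinRoot.root (a.map (algebraMap Fq E)))
      (fun i j => AdjoinRoot.of _ (α j ^ Fintype.card Fq ^ i)) r
      fun i => (coeffFrobenius E a ^ i) ω := fun i => by
  have h := congrArg (coeffFrobenius E a ^ i) (hω.root_mul ho)
  rw [map_mul, ← toScalarQuotient_X, coeffFrobenius_pow_toScalarQuotient, map_sum] at h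
  rw [smul_eq_mul, ← toScalarQuotient_X, h]
  refine Finset.sum_congr rfl fun j _ => ?_
  rw [map_mul, coeffFrobenius_pow_of, ← RingHom.comp_apply, ← RingHom.mul_def, ← pow_add,
    smul_eq_mul]

end IsDual

variable [IsScalarTower Fq Fq[X] V] [Fintype Fq] [IsAlgClosed E] {ha o} {α : ℕ → E} {r : ℕ}
variable (ho : IsAdditiveAction o α r) (hα : r ≠ 0 → α r ≠ 0) (ha₀ : aeval (α 0) a ≠ 0)

include ho hα ha₀

theorem eq_zero_of_forall_isDual {y : Fin r → ScalarQuotient E a}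
    (hy : ∀ v ω, a • v = 0 → IsDual ha o v ω →
      ∑ l, y l * (coeffFrobenius E a ^ (l : ℕ)) ω = 0) : y = 0 := by
  choose c hc using fun l => exists_eq_sum_of_mul_root_pow (ha.map (algebraMap Fq E)) (y l)
  rw [ha.natDegree_map] at hc
  have hzero := ho.eq_zero_of_forall_torsion_sum hα ha₀ (y := c) fun v hv => by
    obtain ⟨ω, hω⟩ := exists_isDual ha o hv
    rw [← map_zero (topCoeff (ha.map (algebraMap Fq E))), ← hy v ω hv hω, map_sum]
    refine Finset.sum_congr rfl fun l _ => ?_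
    rw [hc l, Finset.sum_mul, map_sum]
    refine Finset.sum_congr rfl fun k _ => ?_
    rw [mul_assoc, topCoeff_of_mul, ← toScalarQuotient_X,
      ← map_pow (toScalarQuotient E a), hω.topCoeff_mul_coeffFrobenius_pow]
  funext l
  rw [hc l]
  refine Finset.sum_eq_zero fun k hk => ?_
  rw [hzero l (Finset.mem_range.1 hk), map_zero, zero_mul]

variable {v : Fin r → V} (hv : IsTorsionBasis a v)

include hv

theorem isUnit_periodMatrix {ω : Fin r → ScalarQuotient E a} (hω : ∀ j, IsDual ha o (v j) (ω j)) :
    IsUnit (Matrix.of fun l j : Fin r => (coeffFrobenius E a ^ (l : ℕ)) (ω j)) := by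
  refine isUnit_of_vecMul_injective (ha.map _) fun y hy =>
    eq_zero_of_forall_isDual (ha := ha) ho hα ha₀ fun w ω' hw hω' => ?_
  obtain ⟨c, rfl⟩ := hv.exists_eq_sum w hw
  obtain rfl := hω'.unique (IsDual.sum fun j _ => (hω j).smul (c j))
  calc ∑ l, y l * (coeffFrobenius E a ^ (l : ℕ)) (∑ j, toScalarQuotient E a (c j) * ω j)
      = ∑ j, toScalarQuotient E a (c j) *
          ∑ l, y l * (coeffFrobenius E a ^ (l : ℕ)) (ω j) := by
        simp only [map_sum, map_mul, coeffFrobenius_pow_toScalarQuotient, Finset.mul_sum]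
        rw [Finset.sum_comm]
        exact Finset.sum_congr rfl fun j _ => Finset.sum_congr rfl fun l _ => mul_left_comm _ _ _
    _ = 0 := Finset.sum_eq_zero fun j _ => by
        rw [show ∑ l, y l * (coeffFrobenius E a ^ (l : ℕ)) (ω j) = 0 from congrFun hy j, mul_zero]

include ha in
theorem charpoly_frobenius_torsion {d : ℕ} {F : V →ₗ[Fq[X]] V}
    (hF : ∀ w, o (F w) = o w ^ Fintype.card Fq ^ d) {N : Matrix (Fin r) (Fin r) Fq[X]}
    (hN : ∀ j, F (v j) = ∑ i, N i j • v i) :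
    (N.map (toScalarQuotient E a)).charpoly =
      ((polyMonodromy (fun i j => α j ^ Fintype.card Fq ^ i) r d).map
        (AdjoinRoot.mk (a.map (algebraMap Fq E)))).charpoly := by
  rcases eq_or_ne r 0 with rfl | hr
  · exact congrArg Matrix.charpoly (Subsingleton.elim _ _)
  have hlead (i : ℕ) : IsUnit (C (α r ^ Fintype.card Fq ^ i)) :=
    isUnit_C.2 (IsUnit.mk0 _ (pow_ne_zero _ (hα hr)))
  choose ω hω using fun j => exists_isDual ha o (hv.smul_eq_zero j)
  obtain ⟨W, hW⟩ := isUnit_periodMatrix ho hα ha₀ hv hω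
  have hcomm : (polyMonodromy (fun i j => α j ^ Fintype.card Fq ^ i) r d).map
      (AdjoinRoot.mk (a.map (algebraMap Fq E))) * (W : Matrix _ _ _) =
      (W : Matrix _ _ _) * N.map (toScalarQuotient E a) := by
    rw [hW, monodromy_map _ hlead, AdjoinRoot.mk_X]
    ext l j
    have hshift : (coeffFrobenius E a ^ d) (ω j) = ∑ i, toScalarQuotient E a (N i j) * ω i :=
      ((hω j).coeffFrobenius_pow hF).unique <| by
        rw [hN]
        exact IsDual.sum fun i _ => (hω i).smul (N i j)
    have hrec := ((hω j).isRecSolution ho).eq_sum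
      (fun i => (IsUnit.mk0 _ (pow_ne_zero _ (hα hr))).map (AdjoinRoot.of _)) hr (d + l)
    calc ∑ m, recSeq (AdjoinRoot.root _)
          (fun i j => AdjoinRoot.of _ (α j ^ Fintype.card Fq ^ i)) r (d + l) m *
            (coeffFrobenius E a ^ (m : ℕ)) (ω j)
        = (coeffFrobenius E a ^ (d + l)) (ω j) := hrec.symm
      _ = (coeffFrobenius E a ^ (l : ℕ)) ((coeffFrobenius E a ^ d) (ω j)) := by
        rw [add_comm, pow_add, RingHom.mul_def, RingHom.comp_apply]
      _ = ∑ i, (coeffFrobenius E a ^ (l : ℕ)) (ω i) * toScalarQuotient E a (N i j) := by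
        simp only [hshift, map_sum, map_mul, coeffFrobenius_pow_toScalarQuotient, mul_comm]
  have hconj := Matrix.charpoly_units_conj W (N.map (toScalarQuotient E a))
  rw [← hcomm, mul_assoc, ← Matrix.coe_units_inv, Units.mul_inv, mul_one] at hconj
  exact hconj.symm

end IsDual

/-! ### The characteristic polynomial of Frobenius -/

section Completion

variable {Fq : Type*} [Field Fq] (E : Type*) [Field E] [Algebra Fq E]

theorem toScalarQuotient_eq_zero_iff (a c : Fq[X]) : toScalarQuotient E a c = 0 ↔ a ∣ c := by
  rw [toScalarQuotient_apply, AdjoinRoot.mk_eq_zero]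
  exact Polynomial.map_dvd_map' _

/-- The canonical map from the `h`-adic completion of `Fq[t]` to `E[t] / h ^ m`. -/
def completionToScalarQuotient (h : Fq[X]) (m : ℕ) :
    AdicCompletion (Ideal.span {h}) Fq[X] →+* ScalarQuotient E (h ^ m) :=
  (Ideal.Quotient.lift (Ideal.span {h} ^ m) (toScalarQuotient E (h ^ m)) fun c hc => by
    rw [Ideal.span_singleton_pow, Ideal.mem_span_singleton] at hc
    exact (toScalarQuotient_eq_zero_iff E _ c).2 hc).comp
    (AdicCompletion.evalₐ (Ideal.span {h}) m).toRingHom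

variable {E}

theorem completionToScalarQuotient_eq {h : Fq[X]} {m : ℕ}
    {x : AdicCompletion (Ideal.span {h}) Fq[X]} {c : Fq[X]}
    (hc : AdicCompletion.evalₐ (Ideal.span {h}) m x = Ideal.Quotient.mk _ c) :
    completionToScalarQuotient E h m x = toScalarQuotient E (h ^ m) c := by
  rw [completionToScalarQuotient, RingHom.comp_apply]
  change Ideal.Quotient.lift _ _ _ (AdicCompletion.evalₐ (Ideal.span {h}) m x) = _
  rw [hc, Ideal.Quotient.lift_mk]

theorem exists_toScalarQuotient_eq (h : Fq[X]) (m : ℕ) (x : AdicCompletion (Ideal.span {h}) Fq[X]) :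
    ∃ c, toScalarQuotient E (h ^ m) c = completionToScalarQuotient E h m x := by
  obtain ⟨c, hc⟩ := Ideal.Quotient.mk_surjective (AdicCompletion.evalₐ (Ideal.span {h}) m x)
  exact ⟨c, (completionToScalarQuotient_eq hc.symm).symm⟩

theorem completionToScalarQuotient_algebraMap (h : Fq[X]) (m : ℕ) (c : Fq[X]) :
    completionToScalarQuotient E h m (algebraMap _ _ c) = toScalarQuotient E (h ^ m) c :=
  completionToScalarQuotient_eq (AlgHom.commutes _ _)

variable (E) in
theorem eq_of_completionToScalarQuotient_eq {h : Fq[X]}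
    {x y : AdicCompletion (Ideal.span {h}) Fq[X]}
    (hxy : ∀ m, completionToScalarQuotient E h m x = completionToScalarQuotient E h m y) :
    x = y := by
  refine AdicCompletion.ext_evalₐ fun m => ?_
  obtain ⟨c, hc⟩ := Ideal.Quotient.mk_surjective (AdicCompletion.evalₐ (Ideal.span {h}) m x)
  obtain ⟨c', hc'⟩ := Ideal.Quotient.mk_surjective (AdicCompletion.evalₐ (Ideal.span {h}) m y)
  rw [← hc, ← hc', Ideal.Quotient.eq, Ideal.span_singleton_pow, Ideal.mem_span_singleton,
    ← toScalarQuotient_eq_zero_iff E, map_sub, ← completionToScalarQuotient_eq hc.symm,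
    ← completionToScalarQuotient_eq hc'.symm, hxy, sub_self]

theorem algebraMap_completion_injective {h : Fq[X]} (hh : Irreducible h) :
    Function.Injective (algebraMap Fq[X] (AdicCompletion (Ideal.span {h}) Fq[X])) := by
  refine (injective_iff_map_eq_zero _).2 fun c hc => ?_
  by_contra hc0
  have hdvd : h ^ (c.natDegree + 1) ∣ c := by
    rw [← toScalarQuotient_eq_zero_iff Fq, ← completionToScalarQuotient_algebraMap, hc, map_zero]
  have hle := natDegree_le_of_dvd hdvd hc0
  rw [natDegree_pow] at hle
  nlinarith [hh.natDegree_pos]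

theorem exists_map_eq_of_forall_mk_eq {h : Fq[X]} (hmonic : h.Monic) (hirr : Irreducible h)
    (p : E[X]) (hp : ∀ m, ∃ c, toScalarQuotient E (h ^ m) c = AdjoinRoot.mk _ p) :
    ∃ c : Fq[X], c.map (algebraMap Fq E) = p := by
  let m := p.natDegree + 1
  obtain ⟨c, hc⟩ := hp m
  rw [toScalarQuotient_apply, AdjoinRoot.mk_eq_mk] at hc
  have hmon : ((h ^ m).map (algebraMap Fq E)).Monic := (hmonic.pow m).map _
  have hlt : p.degree < ((h ^ m).map (algebraMap Fq E)).degree := by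
    refine degree_lt_degree ?_
    rw [(hmonic.pow m).natDegree_map, natDegree_pow]
    exact Nat.le_mul_of_pos_right m hirr.natDegree_pos
  refine ⟨c %ₘ h ^ m, ?_⟩
  rw [map_modByMonic _ (hmonic.pow m), ← (modByMonic_eq_self_iff hmon).2 hlt, ← sub_eq_zero,
    ← sub_modByMonic]
  exact (modByMonic_eq_zero_iff_dvd hmon).2 hc

end Completion

theorem exists_tateModule_basis {Fq E V : Type*} [Field Fq] [Fintype Fq] [Field E] [Algebra Fq E]
    [IsAlgClosed E] [AddCommGroup V] [Module Fq V] [Module Fq[X] V] [IsScalarTower Fq Fq[X] V]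
    {o : V ≃ₗ[Fq] E} {α : ℕ → E} {r d : ℕ} (ho : IsAdditiveAction o α r) (hα : r ≠ 0 → α r ≠ 0)
    {h : Fq[X]} (hmonic : h.Monic) (hirr : Irreducible h) (hh : aeval (α 0) h ≠ 0)
    {F : V →ₗ[Fq[X]] V} (hF : ∀ v, o (F v) = o v ^ Fintype.card Fq ^ d) :
    ∃ b : Module.Basis (Fin r) (AdicCompletion (Ideal.span {h}) Fq[X]) (tateModule V h),
      ∀ m, (LinearMap.toMatrix b b (tateMap h F)).charpoly.map (completionToScalarQuotient E h m) =
        (polyMonodromy (fun i j => α j ^ Fintype.card Fq ^ i) r d).charpoly.map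
          (AdjoinRoot.mk _) := by
  obtain ⟨v, hv⟩ := exists_isTorsionBasis hirr (ho.natCard_torsionBy hα hh)
  choose x hx using fun j =>
    exists_tateComponent_one_eq (ho.smul_surjective hα hh) (hv.smul_eq_zero j)
  obtain rfl : (fun j => tateComponent 1 (x j)) = v := funext hx
  refine ⟨hv.tateBasis, fun m => ?_⟩
  choose N hN using fun i j => Ideal.Quotient.mk_surjective (AdicCompletion.evalₐ (Ideal.span {h}) m
    (LinearMap.toMatrix hv.tateBasis hv.tateBasis (tateMap h F) i j))
  have hmap : (LinearMap.toMatrix hv.tateBasis hv.tateBasis (tateMap h F)).map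
      (completionToScalarQuotient E h m) = (Matrix.of N).map (toScalarQuotient E (h ^ m)) :=
    Matrix.ext fun i j => completionToScalarQuotient_eq (hN i j).symm
  rw [← Matrix.charpoly_map, hmap, ← Matrix.charpoly_map]
  refine charpoly_frobenius_torsion (ha := hmonic.pow m) ho hα ?_ (hv.pow m) hF
    (hv.map_tateComponent_eq_sum F fun i j => (hN i j).symm)
  rw [map_pow]
  exact pow_ne_zero _ hh

section MonicPrime

variable {Fq : Type*} [Field Fq]

theorem aeval_thetaBar_eq_zero_iff (f : MonicPrime Fq) (p : Fq[X]) :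
    aeval (thetaBar f) p = 0 ↔ f.1 ∣ p := by
  rw [thetaBar, aeval_algebraMap_apply, AdjoinRoot.aeval_eq,
    map_eq_zero_iff _ (algebraMap (AdjoinRoot f.1) (ResidueClosure f)).injective,
    AdjoinRoot.mk_eq_zero]

theorem MonicPrime.eq_of_dvd {f h : MonicPrime Fq} (hd : f.1 ∣ h.1) : f = h :=
  Subtype.ext (eq_of_monic_of_associated f.2.1 h.2.1 (f.2.2.associated_of_dvd h.2.2 hd))

theorem exists_monicPrime_ne (f : MonicPrime Fq) : ∃ h : MonicPrime Fq, h ≠ f := by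
  by_contra! hall
  have heq := (hall ⟨X - C 1, monic_X_sub_C 1, irreducible_X_sub_C 1⟩).trans
    (hall ⟨X, monic_X, irreducible_X⟩).symm
  simpa using congrArg (eval 0) (congrArg Subtype.val heq)

theorem aeval_pow_card_pow [Fintype Fq] {B : Type*} [CommRing B] [Algebra Fq B] (x : B)
    (p : Fq[X]) (i : ℕ) :
    aeval (x ^ Fintype.card Fq ^ i) p = aeval x p ^ Fintype.card Fq ^ i := by
  rw [← frobeniusAlgHom_pow_apply, ← frobeniusAlgHom_pow_apply, aeval_algHom_apply]

end MonicPrime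

namespace DrinfeldModule

variable {Fq : Type*} [Field Fq] {r : ℕ} (φ : DrinfeldModule Fq r)

section CoeffAt

variable {B : Type*} [CommRing B] [Algebra Fq B]

/-- The coefficients of `φ_θ` specialized at `θ = x`, continued by `0`. -/
def coeffAt (x : B) (j : ℕ) : B :=
  if hj : j < r + 1 then aeval x (φ.coeff ⟨j, hj⟩) else 0

theorem coeffAt_fin (x : B) (j : Fin (r + 1)) : φ.coeffAt x j = aeval x (φ.coeff j) :=
  dif_pos j.2

theorem coeffAt_zero (x : B) : φ.coeffAt x 0 = x :=
  (φ.coeffAt_fin x 0).trans (by rw [φ.coeff_zero, aeval_X])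

theorem map_coeffAt {B' : Type*} [CommRing B'] [Algebra Fq B'] (ι : B →ₐ[Fq] B') (x : B)
    (j : ℕ) : ι (φ.coeffAt x j) = φ.coeffAt (ι x) j := by
  simp only [coeffAt, apply_dite ι, map_zero, aeval_algHom_apply]

theorem coeffAt_pow [Fintype Fq] (x : B) (i j : ℕ) :
    φ.coeffAt (x ^ Fintype.card Fq ^ i) j = φ.coeffAt x j ^ Fintype.card Fq ^ i := by
  rw [← frobeniusAlgHom_pow_apply, ← frobeniusAlgHom_pow_apply, map_coeffAt]

end CoeffAt

variable (f : MonicPrime Fq)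

/-- The coefficients of the reduction of `φ_θ` at `f`, continued by `0`. -/
abbrev redCoeff : ℕ → ResidueClosure f := φ.coeffAt (thetaBar f)

theorem bddAbove_reductionRank :
    BddAbove {i : ℕ | ∃ hi : i < r + 1, ¬ f.1 ∣ φ.coeff ⟨i, hi⟩} :=
  ⟨r, fun _ hi => Nat.lt_succ_iff.1 hi.1⟩

theorem redCoeff_eq_zero {j : ℕ} (hj : φ.reductionRank f < j) : φ.redCoeff f j = 0 := by
  rw [redCoeff, coeffAt]
  split_ifs with h
  · rw [aeval_thetaBar_eq_zero_iff]
    by_contra hd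
    exact hj.not_ge (le_csSup (φ.bddAbove_reductionRank f) ⟨h, hd⟩)
  · rfl

theorem redCoeff_reductionRank_ne_zero (h0 : φ.reductionRank f ≠ 0) :
    φ.redCoeff f (φ.reductionRank f) ≠ 0 := by
  have hne : {i : ℕ | ∃ hi : i < r + 1, ¬ f.1 ∣ φ.coeff ⟨i, hi⟩}.Nonempty :=
    Set.nonempty_iff_ne_empty.2 fun he => h0 (by rw [reductionRank, he, csSup_empty]; rfl)
  obtain ⟨hi, hd⟩ : ∃ hi : φ.reductionRank f < r + 1, ¬ f.1 ∣ φ.coeff ⟨φ.reductionRank f, hi⟩ :=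
    Nat.sSup_mem hne (φ.bddAbove_reductionRank f)
  rwa [redCoeff, coeffAt, dif_pos hi, Ne, aeval_thetaBar_eq_zero_iff]

theorem reductionRank_le : φ.reductionRank f ≤ r := by
  by_contra! h
  exact φ.redCoeff_reductionRank_ne_zero f (by lia) (dif_neg (by lia))

variable [Fintype Fq]

theorem redCoeff_pow (j : ℕ) :
    φ.redCoeff f j ^ Fintype.card Fq ^ f.1.natDegree = φ.redCoeff f j := by
  rw [← coeffAt_pow, thetaBar_pow]

theorem isAdditiveAction_reduction :
    IsAdditiveAction (Module.AEval'.of (φ.reductionAction f)).symm (φ.redCoeff f)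
      (φ.reductionRank f) := fun v => by
  obtain ⟨x, rfl⟩ := (Module.AEval'.of (φ.reductionAction f)).surjective v
  rw [Module.AEval'.X_smul_of, LinearEquiv.symm_apply_apply, LinearEquiv.symm_apply_apply,
    reductionAction, skewAction_apply]
  simp only [← coeffAt_fin, frobeniusAlgHom_pow_apply]
  rw [Fin.sum_univ_eq_sum_range fun j => φ.redCoeff f j * x ^ Fintype.card Fq ^ j]
  refine (Finset.sum_subset (Finset.range_mono (Nat.succ_le_succ (φ.reductionRank_le f)))
    fun j _ hj => ?_).symm
  rw [φ.redCoeff_eq_zero f (by simpa using hj), zero_mul]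

/-- The coefficients of the difference equation attached to the reduction of `φ` at `f`. -/
abbrev frobeniusCoeff (i j : ℕ) : ResidueClosure f := φ.redCoeff f j ^ Fintype.card Fq ^ i

/-- The characteristic polynomial of the monodromy of the difference equation attached to the
reduction of `φ` at `f`. -/
def monodromyCharpoly : (ResidueClosure f)[X][X] :=
  (polyMonodromy (φ.frobeniusCoeff f) (φ.reductionRank f) f.1.natDegree).charpoly

variable {f} in
theorem exists_tate_basis {h : MonicPrime Fq} (hne : h ≠ f) :
    ∃ b : Module.Basis (Fin (φ.reductionRank f)) (AdicCompletion (Ideal.span {h.1}) Fq[X])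
      (tateModule (φ.ReductionModule f) h.1),
    ∀ m, (LinearMap.toMatrix b b (tateMap h.1 (φ.frobenius f))).charpoly.map
      (completionToScalarQuotient (ResidueClosure f) h.1 m) =
        (φ.monodromyCharpoly f).map (AdjoinRoot.mk _) := by
  refine exists_tateModule_basis (φ.isAdditiveAction_reduction f)
    (φ.redCoeff_reductionRank_ne_zero f) h.2.1 h.2.2 ?_ fun v => ?_
  · rw [redCoeff, φ.coeffAt_zero, Ne, aeval_thetaBar_eq_zero_iff]
    exact fun hd => hne (MonicPrime.eq_of_dvd hd).symm
  · rw [← frobeniusAlgHom_pow_apply]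
    rfl

theorem exists_map_eq_monodromyCharpoly :
    ∃ P : Fq[X][X], P.map (mapRingHom (algebraMap Fq (ResidueClosure f))) =
      φ.monodromyCharpoly f := by
  rw [← Polynomial.mem_lifts, Polynomial.lifts_iff_coeff_lifts]
  intro i
  obtain ⟨h, hne⟩ := exists_monicPrime_ne f
  obtain ⟨b, hb⟩ := φ.exists_tate_basis hne
  refine exists_map_eq_of_forall_mk_eq h.2.1 h.2.2 _ fun m => ?_
  rw [← coeff_map, ← hb, coeff_map]
  exact exists_toScalarQuotient_eq _ _ _

theorem isFrobeniusCharpolyAt {P : Fq[X][X]}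
    (hP : P.map (mapRingHom (algebraMap Fq (ResidueClosure f))) = φ.monodromyCharpoly f)
    {h : MonicPrime Fq} (hne : h ≠ f) : φ.IsFrobeniusCharpolyAt f h P := by
  obtain ⟨b, hb⟩ := φ.exists_tate_basis hne
  refine ⟨_, b, Polynomial.ext fun i =>
    eq_of_completionToScalarQuotient_eq (ResidueClosure f) fun m => ?_⟩
  rw [← coeff_map, hb, coeff_map, coeff_map, completionToScalarQuotient_algebraMap, ← hP,
    coeff_map]
  rfl

theorem IsFrobeniusCharpolyAt.unique {h : MonicPrime Fq} {P P' : Fq[X][X]}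
    (hP : φ.IsFrobeniusCharpolyAt f h P) (hP' : φ.IsFrobeniusCharpolyAt f h P') : P = P' := by
  obtain ⟨s, b, hb⟩ := hP
  obtain ⟨s', b', hb'⟩ := hP'
  have : Module.Free (AdicCompletion (Ideal.span {h.1}) Fq[X])
    (tateModule (φ.ReductionModule f) h.1) := .of_basis b
  have : Module.Finite (AdicCompletion (Ideal.span {h.1}) Fq[X])
    (tateModule (φ.ReductionModule f) h.1) := .of_basis b
  rw [LinearMap.charpoly_toMatrix] at hb hb'
  exact Polynomial.map_injective _ (algebraMap_completion_injective h.2.2) (hb.symm.trans hb')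

theorem frobeniusCharpoly_map :
    (φ.frobeniusCharpoly f).map (mapRingHom (algebraMap Fq (ResidueClosure f))) =
      φ.monodromyCharpoly f := by
  obtain ⟨P, hP⟩ := φ.exists_map_eq_monodromyCharpoly f
  obtain ⟨h, hne⟩ := exists_monicPrime_ne f
  have hex : ∃ P, ∀ h : MonicPrime Fq, h ≠ f → φ.IsFrobeniusCharpolyAt f h P :=
    ⟨P, fun _ => φ.isFrobeniusCharpolyAt f hP⟩
  rw [frobeniusCharpoly, dif_pos hex, ← hP,
    (hex.choose_spec h hne).unique φ f (φ.isFrobeniusCharpolyAt f hP hne)]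

end DrinfeldModule

/-! ### The Fitting generator of the twisted module -/

section QuasiPeriodic

theorem quasiPeriodicMatrix_X_C {R : Type*} [CommRing R] (a : ℕ → ℕ → R) (r d : ℕ) (z : R) :
    quasiPeriodicMatrix X (fun i j => C (a i j)) r d (C z) =
      (-quasiPeriodicMatrix 0 a r d z).charmatrix := by
  ext1 i l
  simp only [quasiPeriodicMatrix, Matrix.of_apply, Matrix.charmatrix_apply, Matrix.neg_apply,
    Matrix.diagonal_apply, ite_self, zero_sub, neg_neg, map_sum, apply_ite C, map_mul, map_pow,
    map_zero]

theorem charpoly_eq_of_mul_eq_mul {K ι : Type*} [Field K] [Fintype ι] [DecidableEq ι]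
    {Y A G : Matrix ι ι K} (hY : Y.det ≠ 0) (h : Y * A = G * Y) : A.charpoly = G.charpoly := by
  obtain ⟨U, rfl⟩ : IsUnit Y := (Matrix.isUnit_iff_isUnit_det _).2 hY.isUnit
  rw [← Matrix.charpoly_units_conj U A, h, mul_assoc,
    Matrix.mul_nonsing_inv _ ((Matrix.isUnit_iff_isUnit_det _).1 U.isUnit), mul_one]

/-- The functionals `y 0, …, y (d - 1)` form a basis of `V*` over `L`, in which the transpose of
`T` acts as `∑_j a_{ij} S ^ j` on quasi-periodic sequences. -/
theorem charpoly_map_eq_det_quasiPeriodicMatrix {K L V : Type*} [Field K] [Field L] [Algebra K L]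
    [AddCommGroup V] [Module K V] {d r : ℕ} {z : L} {a : ℕ → ℕ → L} {y : ℕ → V →ₗ[K] L}
    {T : V →ₗ[K] V} (b : Module.Basis (Fin d) K V)
    (hy : ∀ v, IsQuasiPeriodic d z fun i => y i v)
    (hT : ∀ i v, y i (T v) = ∑ j ∈ Finset.range (r + 1), a i j * y (i + j) v)
    (hdet : (Matrix.of fun i l : Fin d => y i (b l)).det ≠ 0) :
    (LinearMap.toMatrix b b T).charpoly.map (algebraMap K L) =
      (quasiPeriodicMatrix X (fun i j => C (a i j)) r d (C z)).det := by
  rw [quasiPeriodicMatrix_X_C, ← Matrix.charpoly_map]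
  refine charpoly_eq_of_mul_eq_mul hdet (Matrix.ext fun i l => ?_)
  have hmul : (-quasiPeriodicMatrix 0 a r d z * Matrix.of fun i l : Fin d => y i (b l)) i l =
      y i (T (b l)) := by
    simpa [Matrix.mul_apply, hT] using
      congrArg Neg.neg ((hy (b l)).sum_quasiPeriodicMatrix_smul (t := 0) (a := a) (r := r) i)
  rw [hmul, ← b.sum_repr (T (b l)), map_sum, Matrix.mul_apply]
  refine Finset.sum_congr rfl fun m _ => ?_
  rw [map_smul, Algebra.smul_def, mul_comm, Matrix.map_apply, LinearMap.toMatrix_apply]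
  rfl

end QuasiPeriodic

theorem exists_basis_quotient {K : Type*} [Field K] {g : K[X]} (hg : g.Monic) {d : ℕ}
    (hd : g.natDegree = d) :
    ∃ b : Module.Basis (Fin d) K (K[X] ⧸ (Ideal.span {g}).restrictScalars K),
      ∀ l, b l = Submodule.Quotient.mk (X ^ (l : ℕ)) := by
  let e : AdjoinRoot g ≃ₗ[K] K[X] ⧸ (Ideal.span {g}).restrictScalars K :=
    (Submodule.Quotient.restrictScalarsEquiv K (Ideal.span {g})).symm
  have hdim : (AdjoinRoot.powerBasis' hg).dim = d := hd
  refine ⟨((AdjoinRoot.powerBasis' hg).basis.map e).reindex (finCongr hdim), fun l => ?_⟩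
  rw [Module.Basis.reindex_apply, Module.Basis.map_apply, PowerBasis.basis_eq_pow,
    AdjoinRoot.powerBasis'_gen, ← AdjoinRoot.mk_X, ← map_pow]
  rfl

section ScalarTower

variable {Fq : Type*} [Field Fq] {n : ℕ} {L : Type*} [Field L] [Algebra (ZField Fq n) L]
  [Algebra Fq L] [IsScalarTower Fq (ZField Fq n) L]

theorem aeval_toZ (β : L) (p : Fq[X]) : aeval β (toZ Fq n p) = aeval β p := by
  rw [toZ, coe_mapRingHom, aeval_map_algebraMap]

theorem algebraMap_z_ne {f : Fq[X]} (hf : f ≠ 0) {β : L} (hβ : aeval β f = 0) (k : Fin n) :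
    algebraMap (ZField Fq n) L (z Fq k) ≠ β := by
  rintro rfl
  rw [aeval_algebraMap_apply, map_eq_zero_iff _ (algebraMap (ZField Fq n) L).injective, z,
    aeval_algebraMap_apply, map_eq_zero_iff _ (IsFractionRing.injective _ _)] at hβ
  exact hf (transcendental_iff.1 (MvPolynomial.transcendental_X Fq k) f hβ)

end ScalarTower

variable {Fq : Type*} [Field Fq] [Fintype Fq]

theorem map_eq_prod_of_injective_pow {L : Type*} [Field L] [Algebra Fq L] {f : Fq[X]}
    (hf : f.Monic) {β : L} (hβ : aeval β f = 0)
    (hinj : Function.Injective fun i : Fin f.natDegree => β ^ Fintype.card Fq ^ (i : ℕ)) :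
    f.map (algebraMap Fq L) =
      ∏ i : Fin f.natDegree, (X - C (β ^ Fintype.card Fq ^ (i : ℕ))) := by
  refine eq_of_monic_of_dvd_of_natDegree_le (monic_prod_X_sub_C _ _) (hf.map _) ?_ ?_
  · refine Finset.prod_dvd_of_coprime (fun _ _ _ _ hne => pairwise_coprime_X_sub_C hinj hne) ?_
    intro i _
    rw [dvd_iff_isRoot, IsRoot, eval_map_algebraMap, aeval_pow_card_pow, hβ,
      zero_pow (pow_ne_zero _ Fintype.card_ne_zero)]
  · rw [hf.natDegree_map, natDegree_finsetProd_X_sub_C_eq_card, Finset.card_univ, Fintype.card_fin]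

section TwistEval

variable {n : ℕ} {L : Type*} [Field L] [Algebra (ZField Fq n) L]

theorem aeval_tauZ_pow (β : L) (j : ℕ) (p : (ZField Fq n)[X]) :
    aeval β ((tauZ Fq n ^ j) p) = aeval (β ^ Fintype.card Fq ^ j) p := by
  induction j generalizing β with
  | zero => simp
  | succ j ih =>
    rw [pow_succ', AlgHom.mul_apply, tauZ, expand_aeval, ← tauZ, ih, ← pow_mul, ← pow_succ']

theorem aeval_ell (β : L) (i : ℕ) (k : Fin n) :
    aeval β (ell Fq i k) = ∏ m ∈ Finset.range i,
      (algebraMap (ZField Fq n) L (z Fq k) - β ^ Fintype.card Fq ^ m) := by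
  simp only [ell, map_prod, map_sub, aeval_C, map_pow, aeval_X]

theorem aeval_ell_add (β : L) (i j : ℕ) (k : Fin n) :
    aeval β (ell Fq (i + j) k) =
      aeval β (ell Fq i k) * aeval (β ^ Fintype.card Fq ^ i) (ell Fq j k) := by
  simp only [aeval_ell, Finset.prod_range_add, ← pow_mul, ← pow_add]

variable [Algebra Fq L] [IsScalarTower Fq (ZField Fq n) L] {f : Fq[X]} {β : L}

theorem aeval_pow_eq_zero (hβ : aeval β f = 0) (i : ℕ) :
    aeval (β ^ Fintype.card Fq ^ i) f = 0 := by
  rw [aeval_pow_card_pow, hβ, zero_pow (pow_ne_zero _ Fintype.card_ne_zero)]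

theorem aeval_ell_ne_zero (hf : f ≠ 0) (hβ : aeval β f = 0) (i : ℕ) (k : Fin n) :
    aeval β (ell Fq i k) ≠ 0 := by
  rw [aeval_ell]
  exact Finset.prod_ne_zero_iff.2 fun m _ =>
    sub_ne_zero.2 (algebraMap_z_ne hf (aeval_pow_eq_zero hβ m) k)

theorem aeval_ell_natDegree (hf : f.Monic) (hβ : aeval β f = 0)
    (hinj : Function.Injective fun i : Fin f.natDegree => β ^ Fintype.card Fq ^ (i : ℕ))
    (k : Fin n) :
    aeval β (ell Fq f.natDegree k) = algebraMap (ZField Fq n) L (aeval (z Fq k) f) := by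
  rw [aeval_ell, ← aeval_algebraMap_apply, ← eval_map_algebraMap,
    map_eq_prod_of_injective_pow hf hβ hinj, eval_prod, Finset.prod_range]
  simp only [eval_sub, eval_X, eval_C]

/-- Evaluation on `𝔸 / f𝔸` at the conjugate `β ^ (q ^ i)` of the root `β` of `f`, scaled by
`∏_k ℓ_i(z_k)(β)` so that `ϕ_θ` becomes a difference operator with coefficients free of the
`z_k`. -/
def twistEval (hβ : aeval β f = 0) (i : ℕ) :
    ((ZField Fq n)[X] ⧸ (Ideal.span {toZ Fq n f}).restrictScalars (ZField Fq n)) →ₗ[ZField Fq n]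
      L :=
  Submodule.liftQ _ (LinearMap.mulLeft (ZField Fq n) (aeval β (∏ k : Fin n, ell Fq i k)) ∘ₗ
      (aeval (β ^ Fintype.card Fq ^ i)).toLinearMap) fun p hp => by
    obtain ⟨c, rfl⟩ := Ideal.mem_span_singleton.1 hp
    rw [LinearMap.mem_ker, LinearMap.comp_apply, AlgHom.toLinearMap_apply, map_mul, aeval_toZ,
      aeval_pow_eq_zero hβ, zero_mul, map_zero]

theorem twistEval_mk (hβ : aeval β f = 0) (i : ℕ) (p : (ZField Fq n)[X]) :
    twistEval hβ i (Submodule.Quotient.mk p) =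
      (∏ k : Fin n, aeval β (ell Fq i k)) * aeval (β ^ Fintype.card Fq ^ i) p := by
  rw [← map_prod]
  rfl

theorem isQuasiPeriodic_twistEval (hf : f.Monic) (hβ : aeval β f = 0)
    (hβd : β ^ Fintype.card Fq ^ f.natDegree = β)
    (hinj : Function.Injective fun i : Fin f.natDegree => β ^ Fintype.card Fq ^ (i : ℕ))
    (v : (ZField Fq n)[X] ⧸ (Ideal.span {toZ Fq n f}).restrictScalars (ZField Fq n)) :
    IsQuasiPeriodic f.natDegree
      (algebraMap (ZField Fq n) L (∏ k : Fin n, aeval (z Fq k) f))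
      fun i => twistEval hβ i v := fun i => by
  obtain ⟨p, rfl⟩ := Submodule.Quotient.mk_surjective _ v
  simp only [twistEval_mk, add_comm i, aeval_ell_add, pow_add, pow_mul, hβd,
    aeval_ell_natDegree hf hβ hinj, Finset.prod_mul_distrib, map_prod, smul_eq_mul, mul_assoc]

theorem twistEval_twistQuotientAction {r : ℕ} (φ : DrinfeldModule Fq r) (hβ : aeval β f = 0)
    (i : ℕ) (v : (ZField Fq n)[X] ⧸ (Ideal.span {toZ Fq n f}).restrictScalars (ZField Fq n)) :
    twistEval hβ i (φ.twistQuotientAction n f v) = ∑ j ∈ Finset.range (r + 1),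
      φ.coeffAt β j ^ Fintype.card Fq ^ i * twistEval hβ (i + j) v := by
  obtain ⟨p, rfl⟩ := Submodule.Quotient.mk_surjective _ v
  have hmk : φ.twistQuotientAction n f (Submodule.Quotient.mk p) =
      Submodule.Quotient.mk (φ.twistAction n p) := rfl
  rw [hmk, twistEval_mk, DrinfeldModule.twistAction, skewAction_apply, map_sum, Finset.mul_sum,
    Finset.sum_range]
  refine Finset.sum_congr rfl fun j _ => ?_
  rw [twistEval_mk, map_mul, aeval_tauZ_pow, DrinfeldModule.twistCoeff, map_mul, aeval_toZ,
    map_prod, ← φ.coeffAt_pow, φ.coeffAt_fin, ← pow_mul, ← pow_add]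
  simp only [aeval_ell_add, Finset.prod_mul_distrib]
  ring

theorem det_twistEval_ne_zero (hf : f.Monic) (hβ : aeval β f = 0)
    (hinj : Function.Injective fun i : Fin f.natDegree => β ^ Fintype.card Fq ^ (i : ℕ)) :
    (Matrix.of fun i l : Fin f.natDegree =>
      twistEval (n := n) hβ i (Submodule.Quotient.mk (X ^ (l : ℕ)))).det ≠ 0 := by
  have hfactor : (Matrix.of fun i l : Fin f.natDegree =>
      twistEval (n := n) hβ i (Submodule.Quotient.mk (X ^ (l : ℕ)))) =
      Matrix.diagonal (fun i : Fin f.natDegree => ∏ k : Fin n, aeval β (ell Fq i k)) *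
        Matrix.vandermonde fun i : Fin f.natDegree => β ^ Fintype.card Fq ^ (i : ℕ) := by
    ext i l
    rw [Matrix.diagonal_mul, Matrix.vandermonde_apply, Matrix.of_apply, twistEval_mk, map_pow,
      aeval_X]
  rw [hfactor, Matrix.det_mul, Matrix.det_diagonal]
  exact mul_ne_zero
    (Finset.prod_ne_zero_iff.2 fun i _ =>
      Finset.prod_ne_zero_iff.2 fun k _ => aeval_ell_ne_zero hf.ne_zero hβ i k)
    (Matrix.det_vandermonde_ne_zero_iff.2 hinj)

theorem map_fittingGenerator_twistModule {r : ℕ} (φ : DrinfeldModule Fq r) (hf : f.Monic)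
    (hβ : aeval β f = 0) (hβd : β ^ Fintype.card Fq ^ f.natDegree = β)
    (hinj : Function.Injective fun i : Fin f.natDegree => β ^ Fintype.card Fq ^ (i : ℕ)) :
    (fittingGenerator (ZField Fq n) (φ.TwistModule n f)).map (algebraMap (ZField Fq n) L) =
      (quasiPeriodicMatrix X (fun i j => C (φ.coeffAt β j ^ Fintype.card Fq ^ i)) r f.natDegree
        (C (algebraMap (ZField Fq n) L (∏ k : Fin n, aeval (z Fq k) f)))).det := by
  obtain ⟨b, hb⟩ : ∃ b : Module.Basis (Fin f.natDegree) (ZField Fq n)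
      ((ZField Fq n)[X] ⧸ (Ideal.span {toZ Fq n f}).restrictScalars (ZField Fq n)),
      ∀ l, b l = Submodule.Quotient.mk (X ^ (l : ℕ)) :=
    exists_basis_quotient (hf.map (algebraMap Fq (ZField Fq n))) (hf.natDegree_map _)
  refine (congrArg _ (fittingGenerator_aeval b (φ.twistQuotientAction n f))).trans
    (charpoly_map_eq_det_quasiPeriodicMatrix b (isQuasiPeriodic_twistEval hf hβ hβd hinj)
      (twistEval_twistQuotientAction φ hβ) ?_)
  simp only [hb]
  exact det_twistEval_ne_zero hf hβ hinj

end TwistEval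

/-! ### Euler factors -/

theorem thetaBar_pow_injective {Fq : Type*} [Field Fq] [Fintype Fq] (f : MonicPrime Fq) :
    Function.Injective fun i : Fin f.1.natDegree => thetaBar f ^ Fintype.card Fq ^ (i : ℕ) := by
  let pb := AdjoinRoot.powerBasis f.2.2.ne_zero
  have : Module.Finite Fq (AdjoinRoot f.1) := pb.finite
  have : Finite (AdjoinRoot f.1) := Module.finite_of_finite Fq
  have hord : orderOf (FiniteField.frobeniusAlgHom Fq (AdjoinRoot f.1)) = f.1.natDegree := by
    rw [FiniteField.orderOf_frobeniusAlgHom, pb.finrank]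
    rfl
  intro i j hij
  have hroot : AdjoinRoot.root f.1 ^ Fintype.card Fq ^ (i : ℕ) =
      AdjoinRoot.root f.1 ^ Fintype.card Fq ^ (j : ℕ) :=
    (algebraMap (AdjoinRoot f.1) (ResidueClosure f)).injective (by
      rw [map_pow, map_pow]; exact hij)
  have hfrob : FiniteField.frobeniusAlgHom Fq (AdjoinRoot f.1) ^ (i : ℕ) =
      FiniteField.frobeniusAlgHom Fq (AdjoinRoot f.1) ^ (j : ℕ) :=
    AdjoinRoot.algHom_ext (by rw [frobeniusAlgHom_pow_apply, frobeniusAlgHom_pow_apply, hroot])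
  exact Fin.ext (pow_injOn_Iio_orderOf (i.2.trans_eq hord.symm) (j.2.trans_eq hord.symm) hfrob)

namespace DrinfeldModule

variable {Fq : Type*} [Field Fq] [Fintype Fq] {r : ℕ} (φ : DrinfeldModule Fq r)
  (f : MonicPrime Fq)

/-- The polynomial `f + ∑_{i=1}^{r₀} c(f) p_i x ^ i = f D_f(x / f)`. -/
def localPoly : Fq[X][X] :=
  C f.1 + ∑ i ∈ Finset.Icc 1 (φ.reductionRank f),
    C (C (φ.frobeniusConst f) * (φ.frobeniusCharpoly f).coeff i) * X ^ i

theorem eulerFactor_coeff_mul (i : ℕ) :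
    (φ.eulerFactor f).coeff i * f.1 = (φ.localPoly f).coeff i * f.1 ^ i := by
  rcases Nat.eq_zero_or_eq_succ_pred i with rfl | hi
  · simp [eulerFactor, localPoly]
  · rw [hi]
    simp only [eulerFactor, localPoly, coeff_add, coeff_one, coeff_C_succ, Nat.succ_ne_zero,
      if_false, zero_add, finsetSum_coeff, coeff_C_mul_X_pow, Finset.sum_ite_eq]
    split_ifs
    · rw [Nat.succ_sub_one, mul_assoc, ← pow_succ]
    · rw [zero_mul, zero_mul]

theorem localPoly_eq_C_mul_frobeniusCharpoly (h0 : C (φ.frobeniusConst f) *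
    (φ.frobeniusCharpoly f).coeff 0 = f.1)
    (hdeg : (φ.frobeniusCharpoly f).natDegree ≤ φ.reductionRank f) :
    φ.localPoly f = C (C (φ.frobeniusConst f)) * φ.frobeniusCharpoly f := by
  conv_rhs => rw [(φ.frobeniusCharpoly f).as_sum_range_C_mul_X_pow' (Nat.lt_succ_of_le hdeg)]
  rw [Finset.mul_sum, Finset.range_eq_Ico, Finset.sum_eq_sum_Ico_succ_bot (Nat.succ_pos _)]
  simp only [← mul_assoc, ← C_mul, pow_zero, mul_one, h0]
  rfl

/-- The spectral polynomial of the difference equation attached to the reduction of `φ` at `f`. -/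
abbrev reductionSpectralPoly : (ResidueClosure f)[X][X] :=
  spectralPoly (φ.frobeniusCoeff f) (φ.reductionRank f) f.1.natDegree

theorem frobeniusCoeff_zero (i : ℕ) : φ.frobeniusCoeff f i 0 = thetaBar f ^ Fintype.card Fq ^ i :=
  congrArg (· ^ _) (φ.coeffAt_zero _)

theorem periodic_frobeniusCoeff :
    Function.Periodic (φ.frobeniusCoeff f) f.1.natDegree := fun i => by
  funext j
  rw [frobeniusCoeff, add_comm, pow_add, pow_mul, φ.redCoeff_pow f]

theorem map_eq_prod_frobeniusCoeff : f.1.map (algebraMap Fq (ResidueClosure f)) =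
    ∏ i : Fin f.1.natDegree, (X - C (φ.frobeniusCoeff f i 0)) := by
  simp only [frobeniusCoeff_zero]
  exact map_eq_prod_of_injective_pow f.2.1 ((aeval_thetaBar_eq_zero_iff f _).2 dvd_rfl)
    (thetaBar_pow_injective f)

theorem exists_frobeniusCharpoly_map_eq (h0 : φ.reductionRank f ≠ 0) :
    ∃ c : ResidueClosure f, c ≠ 0 ∧
      (φ.frobeniusCharpoly f).map (mapRingHom (algebraMap Fq (ResidueClosure f))) =
        C (C c) * φ.reductionSpectralPoly f := by
  rw [φ.frobeniusCharpoly_map f]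
  exact exists_charpoly_polyMonodromy f.2.2.natDegree_pos h0
    (fun i => pow_ne_zero _ (φ.redCoeff_reductionRank_ne_zero f h0)) (φ.periodic_frobeniusCoeff f)

theorem natDegree_frobeniusCharpoly :
    (φ.frobeniusCharpoly f).natDegree = φ.reductionRank f := by
  have hinj : Function.Injective (mapRingHom (algebraMap Fq (ResidueClosure f))) :=
    map_injective _ (algebraMap Fq (ResidueClosure f)).injective
  rw [← natDegree_map_eq_of_injective hinj, φ.frobeniusCharpoly_map f, monodromyCharpoly,
    Matrix.charpoly_natDegree_eq_dim, Fintype.card_fin]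

theorem map_localPoly :
    (φ.localPoly f).map (mapRingHom (algebraMap Fq (ResidueClosure f))) =
      φ.reductionSpectralPoly f := by
  rcases eq_or_ne (φ.reductionRank f) 0 with hr | hr
  · rw [reductionSpectralPoly, spectralPoly, localPoly, hr, det_quasiPeriodicMatrix_order_zero]
    rw [Finset.Icc_eq_empty (by decide), Finset.sum_empty, add_zero, map_C, coe_mapRingHom,
      φ.map_eq_prod_frobeniusCoeff, map_prod]
    simp only [C_sub]
  obtain ⟨c, hc0, hc⟩ := φ.exists_frobeniusCharpoly_map_eq f hr
  have hcoeff : ((φ.frobeniusCharpoly f).coeff 0).map (algebraMap Fq (ResidueClosure f)) =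
      C c * f.1.map (algebraMap Fq (ResidueClosure f)) := by
    rw [map_eq_prod_frobeniusCoeff, ← spectralPoly_coeff_zero, ← coeff_C_mul, ← hc, coeff_map,
      coe_mapRingHom]
  have hconst : algebraMap Fq (ResidueClosure f) (φ.frobeniusConst f) = c⁻¹ := by
    rw [frobeniusConst, map_inv₀, ← leadingCoeff_map, hcoeff, leadingCoeff_mul, leadingCoeff_C,
      (f.2.1.map _).leadingCoeff, mul_one]
  have hf : C (φ.frobeniusConst f) * (φ.frobeniusCharpoly f).coeff 0 = f.1 := by
    refine map_injective _ (algebraMap Fq (ResidueClosure f)).injective ?_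
    rw [Polynomial.map_mul, map_C, hconst, hcoeff, ← mul_assoc, ← C_mul, inv_mul_cancel₀ hc0, C_1,
      one_mul]
  rw [φ.localPoly_eq_C_mul_frobeniusCharpoly f hf (φ.natDegree_frobeniusCharpoly f).le,
    Polynomial.map_mul, hc, map_C, coe_mapRingHom, map_C, hconst, ← mul_assoc, ← C_mul, ← C_mul,
    inv_mul_cancel₀ hc0, C_1, C_1, one_mul]

/-- The Riemann hypothesis for the reduction of `φ` at `f`, in the form of a bound for the degrees
of the coefficients of the characteristic polynomial of Frobenius. -/
theorem natDegree_coeff_localPoly_le {i : ℕ} (hne : (φ.localPoly f).coeff i ≠ 0) :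
    r * ((φ.localPoly f).coeff i).natDegree + f.1.natDegree * i ≤ r * f.1.natDegree := by
  rcases eq_or_ne (φ.reductionRank f) 0 with hr | hr
  · have hC : φ.localPoly f = C f.1 := by simp [localPoly, hr]
    rw [hC] at hne ⊢
    obtain rfl : i = 0 := by_contra fun hi => hne (coeff_C_of_ne_zero hi)
    simp
  have hcoeff : (φ.reductionSpectralPoly f).coeff i =
      ((φ.localPoly f).coeff i).map (algebraMap Fq (ResidueClosure f)) := by
    rw [← map_localPoly, coeff_map, coe_mapRingHom]
  have hle := natDegree_coeff_spectralPoly_le (φ.frobeniusCoeff f) hr f.1.natDegree i (by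
    rwa [hcoeff, Polynomial.map_ne_zero_iff (algebraMap Fq (ResidueClosure f)).injective])
  rw [hcoeff, natDegree_map] at hle
  have hdeg : ((φ.localPoly f).coeff i).natDegree ≤ f.1.natDegree :=
    Nat.le_of_mul_le_mul_left (by linarith [Nat.zero_le (f.1.natDegree * i)])
      (Nat.pos_of_ne_zero hr)
  obtain ⟨s, hs⟩ := Nat.exists_eq_add_of_le (φ.reductionRank_le f)
  linarith [congrArg (· * ((φ.localPoly f).coeff i).natDegree) hs, congrArg (· * f.1.natDegree) hs,
    Nat.mul_le_mul_left s hdeg]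

variable {n : ℕ}

theorem map_eval₂_localPoly {L : Type*} [Field L] [Algebra Fq L] [Algebra (ZField Fq n) L]
    [IsScalarTower Fq (ZField Fq n) L] (ι : ResidueClosure f →ₐ[Fq] L) (w : ZField Fq n) :
    ((φ.localPoly f).eval₂ (toZ Fq n) (C w)).map (algebraMap (ZField Fq n) L) =
      (quasiPeriodicMatrix X (fun i j => C (φ.coeffAt (ι (thetaBar f)) j ^ Fintype.card Fq ^ i))
        r f.1.natDegree (C (algebraMap (ZField Fq n) L w))).det := by
  have hcoeff : ∀ i j, φ.coeffAt (ι (thetaBar f)) j ^ Fintype.card Fq ^ i =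
      ι (φ.frobeniusCoeff f i j) := fun i j => by rw [map_pow, map_coeffAt]
  have hmap : (mapRingHom (algebraMap (ZField Fq n) L)).comp (toZ Fq n) =
      (mapRingHom ι.toRingHom).comp (mapRingHom (algebraMap Fq (ResidueClosure f))) := by
    rw [toZ, mapRingHom_comp, mapRingHom_comp, ← IsScalarTower.algebraMap_eq]
    exact congrArg mapRingHom ι.comp_algebraMap.symm
  have hvanish : ∀ i j, φ.reductionRank f < j →
      (C (φ.coeffAt (ι (thetaBar f)) j ^ Fintype.card Fq ^ i) : L[X]) = 0 := fun i j hj => by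
    rw [hcoeff, frobeniusCoeff, φ.redCoeff_eq_zero f hj,
      zero_pow (pow_ne_zero _ Fintype.card_ne_zero), map_zero, C_0]
  rw [quasiPeriodicMatrix_eq_of_le _ (φ.reductionRank_le f) hvanish, ← coe_mapRingHom, hom_eval₂,
    hmap, ← eval₂_map, map_localPoly, eval₂_spectralPoly]
  simp only [hcoeff, coe_mapRingHom, map_X, map_C]
  rfl

variable (n)

theorem fittingGenerator_twistModule :
    fittingGenerator (ZField Fq n) (φ.TwistModule n f.1) =
      (φ.localPoly f).eval₂ (toZ Fq n) (C (∏ k : Fin n, aeval (z Fq k) f.1)) := by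
  let L := AlgebraicClosure (ZField Fq n)
  have : Module.Finite Fq (AdjoinRoot f.1) := (AdjoinRoot.powerBasis f.2.2.ne_zero).finite
  have : Algebra.IsAlgebraic Fq (ResidueClosure f) :=
    Algebra.IsAlgebraic.trans Fq (AdjoinRoot f.1) (ResidueClosure f)
  let ι : ResidueClosure f →ₐ[Fq] L := IsAlgClosed.lift
  have hroot : aeval (ι (thetaBar f)) f.1 = 0 := by
    rw [aeval_algHom_apply, (aeval_thetaBar_eq_zero_iff f _).2 dvd_rfl, map_zero]
  have hinj : Function.Injective fun i : Fin f.1.natDegree =>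
      ι (thetaBar f) ^ Fintype.card Fq ^ (i : ℕ) := by
    simp only [← map_pow]
    exact ι.injective.comp (thetaBar_pow_injective f)
  refine map_injective _ (algebraMap (ZField Fq n) L).injective ?_
  rw [φ.map_eval₂_localPoly f ι]
  exact map_fittingGenerator_twistModule φ f.2.1 hroot (by rw [← map_pow, thetaBar_pow]) hinj

end DrinfeldModule

/-! ### Euler products over nonarchimedean fields -/

section EulerProduct

variable {ι : Type*}

/-- A finitely supported function on `insert i T` is a value at `i` together with a finitely
supported function on `T`. -/
def supportInsertEquiv [DecidableEq ι] {i : ι} {T : Finset ι} (hi : i ∉ T) :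
    ℕ × {e : ι →₀ ℕ // e.support ⊆ T} ≃ {e : ι →₀ ℕ // e.support ⊆ insert i T} where
  toFun p := ⟨p.2.1.update i p.1,
    (Finsupp.support_update_subset ..).trans (Finset.insert_subset_insert _ p.2.2)⟩
  invFun e := (e.1 i, ⟨e.1.erase i, by
    rw [Finsupp.support_erase, ← Finset.subset_insert_iff]
    exact e.2⟩)
  left_inv p := by
    have hpi : i ∉ p.2.1.support := fun h => hi (p.2.2 h)
    ext : 2
    · simp
    · change (p.2.1.update i p.1).erase i = p.2.1
      rw [Finsupp.erase_update_eq_erase, Finsupp.erase_of_notMem_support hpi]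
  right_inv e := Subtype.ext <| by
    change (e.1.erase i).update i (e.1 i) = e.1
    rw [Finsupp.update_erase_eq_update, Finsupp.update_self]

theorem prod_supportInsertEquiv [DecidableEq ι] {M : Type*} [CommMonoid M] {i : ι} {T : Finset ι}
    (hi : i ∉ T) {a : ι → ℕ → M} (ha0 : ∀ i, a i 0 = 1)
    (p : ℕ × {e : ι →₀ ℕ // e.support ⊆ T}) :
    (supportInsertEquiv hi p).1.prod a = a i p.1 * p.2.1.prod a := by
  have hpi : i ∉ p.2.1.support := fun h => hi (p.2.2 h)
  change (p.2.1.update i p.1).prod a = _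
  rw [← Finsupp.mul_prod_erase' _ i a ha0, Finsupp.erase_update_eq_erase,
    Finsupp.erase_of_notMem_support hpi, Finsupp.update_apply, if_pos rfl]

variable {R : Type*} [CommRing R] [UniformSpace R] [IsUniformAddGroup R] [NonarchimedeanRing R]
  {a : ι → ℕ → R} {s : ι → R}

theorem hasSum_finsuppProd_of_support_subset (ha0 : ∀ i, a i 0 = 1)
    (ha : ∀ i, HasSum (a i) (s i)) (T : Finset ι) :
    HasSum (fun e : {e : ι →₀ ℕ // e.support ⊆ T} => e.1.prod a) (∏ i ∈ T, s i) := by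
  classical
  induction T using Finset.induction_on with
  | empty =>
    let _ : Unique {e : ι →₀ ℕ // e.support ⊆ ∅} :=
      { default := ⟨0, by simp⟩
        uniq := fun e => Subtype.ext (Finsupp.support_eq_empty.1 (Finset.subset_empty.1 e.2)) }
    convert hasSum_unique (fun e : {e : ι →₀ ℕ // e.support ⊆ ∅} => e.1.prod a)
    rw [Finset.prod_empty]
    exact (Finsupp.prod_zero_index (h := a)).symm
  | insert i T hi ih =>
    rw [Finset.prod_insert hi, ← (supportInsertEquiv hi).hasSum_iff]
    exact ((ha i).mul_of_nonarchimedean ih).congr_fun fun p => prod_supportInsertEquiv hi ha0 p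

theorem hasProd_of_hasSum_finsuppProd (ha0 : ∀ i, a i 0 = 1) (ha : ∀ i, HasSum (a i) (s i)) {S : R}
    (hS : HasSum (fun e : ι →₀ ℕ => e.prod a) S) : HasProd s S := by
  classical
  suffices h : Filter.Tendsto (fun T : Finset ι => S - ∏ i ∈ T, s i) Filter.atTop (nhds 0) by
    rw [HasProd, SummationFilter.unconditional_filter]
    simpa using (tendsto_const_nhds (x := S)).sub h
  refine Filter.tendsto_def.2 fun U hU => ?_
  obtain ⟨V, hV⟩ := NonarchimedeanRing.is_nonarchimedean U hU
  have hfin : {e : ι →₀ ℕ | e.prod a ∉ V}.Finite :=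
    hS.summable.tendsto_cofinite_zero V.mem_nhds_zero
  -- Once `T` contains the primes dividing one of the finitely many terms outside `V`, the product
  -- over `T` differs from `S` by a sum of terms in the closed subgroup `V`.
  refine Filter.mem_atTop_sets.2 ⟨hfin.toFinset.biUnion Finsupp.support, fun T hT => hV ?_⟩
  have hprod : HasSum ({e : ι →₀ ℕ | e.support ⊆ T}.indicator fun e => e.prod a) (∏ i ∈ T, s i) :=
    hasSum_subtype_iff_indicator.1 (hasSum_finsuppProd_of_support_subset ha0 ha T)
  have hterm : ∀ e : ι →₀ ℕ,
      e.prod a - {e : ι →₀ ℕ | e.support ⊆ T}.indicator (fun e => e.prod a) e ∈ V := fun e => by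
    by_cases he : e.support ⊆ T
    · rw [Set.indicator_of_mem (by exact he), sub_self]
      exact V.zero_mem
    · rw [Set.indicator_of_notMem (by exact he), sub_zero]
      by_contra hc
      exact he ((Finset.subset_biUnion_of_mem Finsupp.support (hfin.mem_toFinset.2 hc)).trans hT)
  exact V.isClosed.mem_of_tendsto (hS.sub hprod)
    (Filter.Eventually.of_forall fun E => V.toAddSubgroup.sum_mem fun e _ => hterm e)

end EulerProduct

section Valued

open WithZero

variable {K : Type*} [Field K] [Valued K ℤᵐ⁰] {r d : ℕ}

theorem nonarchimedeanRing_of_valued : NonarchimedeanRing K where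
  is_nonarchimedean U hU := by
    obtain ⟨γ, hγ⟩ := Valued.mem_nhds_zero.1 hU
    exact ⟨⟨Valued.v.restrict.ltAddSubgroup γ, Valued.isOpen_ball K γ.1⟩, hγ⟩

theorem pow_valuation_sum_le {R Γ₀ ι : Type*} [Ring R] [LinearOrderedCommGroupWithZero Γ₀]
    (v : Valuation R Γ₀) (hr : r ≠ 0) {B : Γ₀} {s : Finset ι} {x : ι → R}
    (h : ∀ i ∈ s, v (x i) ^ r ≤ B) : v (∑ i ∈ s, x i) ^ r ≤ B := by
  induction s using Finset.cons_induction with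
  | empty => simp [hr]
  | cons i s hi ih =>
    rw [Finset.forall_mem_cons] at h
    rw [Finset.sum_cons]
    refine (pow_le_pow_left₀ zero_le (v.map_add _ _) r).trans ?_
    rw [(pow_left_mono r).map_max]
    exact max_le h.1 (ih h.2)

theorem summable_of_pow_valuation_le [CompleteSpace K] {ι : Type*} {x : ι → K} {w : ι → ℕ}
    (hw : ∀ N, {i | w i ≤ N}.Finite)
    (hx : ∀ i, Valued.v (x i) ^ r ≤ exp (-(w i : ℤ))) : Summable x := by
  have := nonarchimedeanRing_of_valued (K := K)
  refine NonarchimedeanAddGroup.summable_of_tendsto_cofinite_zero ?_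
  rw [(Valued.hasBasis_nhds_zero K ℤᵐ⁰).tendsto_right_iff]
  intro γ _
  have hγ : MonoidWithZeroHom.ValueGroup₀.embedding γ.1 ≠ 0 :=
    (_root_.map_ne_zero _).2 γ.ne_zero
  obtain ⟨k, hk⟩ := exists_exp_neg_natCast_lt (pow_ne_zero r hγ)
  rw [Filter.eventually_cofinite]
  refine (hw k).subset fun i hi => ?_
  by_contra hik
  refine hi ((Valuation.restrict_lt_iff_lt_embedding _).2 (lt_of_pow_lt_pow_left₀ r zero_le
    (((hx i).trans ?_).trans_lt hk)))
  rw [exp_le_exp, neg_le_neg_iff]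
  exact_mod_cast (not_le.1 hik).le

variable {P D : PowerSeries K}

theorem coeff_eq_ite_sub_sum_of_mul_eq_one {R : Type*} [CommRing R] {P D : PowerSeries R}
    (hPD : P * D = 1) (hD0 : PowerSeries.coeff 0 D = 1) (m : ℕ) : PowerSeries.coeff m P =
      (if m = 0 then 1 else 0) -
        ∑ i ∈ Finset.range m, PowerSeries.coeff i P * PowerSeries.coeff (m - i) D := by
  rw [← PowerSeries.coeff_one, ← hPD, PowerSeries.coeff_mul,
    Finset.Nat.sum_antidiagonal_eq_sum_range_succ
      (fun i j => PowerSeries.coeff i P * PowerSeries.coeff j D), Finset.sum_range_succ,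
    Nat.sub_self, hD0, mul_one, add_sub_cancel_left]

theorem pow_valuation_coeff_inv_le (hr : r ≠ 0) (hPD : P * D = 1)
    (hD0 : PowerSeries.coeff 0 D = 1)
    (hD : ∀ i, Valued.v (PowerSeries.coeff i D) ^ r ≤ exp (-(d * i : ℕ) : ℤ)) (m : ℕ) :
    Valued.v (PowerSeries.coeff m P) ^ r ≤ exp (-(d * m : ℕ) : ℤ) := by
  induction m using Nat.strong_induction_on with
  | _ m ih =>
    rw [coeff_eq_ite_sub_sum_of_mul_eq_one hPD hD0]
    split_ifs with hm
    · simp [hm]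
    rw [zero_sub, Valuation.map_neg]
    refine pow_valuation_sum_le _ hr fun i hi => ?_
    have him := Finset.mem_range.1 hi
    calc Valued.v (PowerSeries.coeff i P * PowerSeries.coeff (m - i) D) ^ r
        = Valued.v (PowerSeries.coeff i P) ^ r * Valued.v (PowerSeries.coeff (m - i) D) ^ r := by
          rw [map_mul, mul_pow]
      _ ≤ exp (-(d * i : ℕ) : ℤ) * exp (-(d * (m - i) : ℕ) : ℤ) := mul_le_mul' (ih i him) (hD _)
      _ = exp (-(d * m : ℕ) : ℤ) := by
          rw [← exp_add, ← neg_add, ← Nat.cast_add, ← mul_add, Nat.add_sub_cancel' him.le]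

theorem hasSum_coeff_inv [CompleteSpace K] (hr : r ≠ 0) (hd : 0 < d) (hPD : P * D = 1)
    (hD0 : PowerSeries.coeff 0 D = 1)
    (hD : ∀ i, Valued.v (PowerSeries.coeff i D) ^ r ≤ exp (-(d * i : ℕ) : ℤ)) {y : K}
    (hy : HasSum (fun i => PowerSeries.coeff i D) y) :
    HasSum (fun i => PowerSeries.coeff i P) y⁻¹ := by
  have := nonarchimedeanRing_of_valued (K := K)
  have hfin : ∀ N, {i | d * i ≤ N}.Finite := fun N =>
    (Set.finite_Iic N).subset fun i hi => (Nat.le_mul_of_pos_left i hd).trans hi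
  have hP : Summable fun i => PowerSeries.coeff i P :=
    summable_of_pow_valuation_le hfin (pow_valuation_coeff_inv_le hr hPD hD0 hD)
  have hPD_summable := hP.mul_of_nonarchimedean hy.summable
  have hmul : (∑' i, PowerSeries.coeff i P) * y = 1 := by
    rw [← hy.tsum_eq, hP.tsum_mul_tsum_eq_tsum_sum_antidiagonal hy.summable hPD_summable]
    simp only [← PowerSeries.coeff_mul, hPD, PowerSeries.coeff_one, tsum_ite_eq]
  exact eq_inv_of_mul_eq_one_left hmul ▸ hP.hasSum

end Valued

/-! ### The valuation of `Fq(z_1, …, z_n)((θ⁻¹))` -/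

section Valuation

open WithZero

theorem valuation_algebraMap_le_one {k : Type*} [Field k] (c : k) :
    Valued.v (algebraMap k (LaurentSeries k) c) ≤ 1 := by
  refine (LaurentSeries.valuation_le_iff_coeff_lt_eq_zero k (D := 0)).2 fun m hm => ?_
  rw [HahnSeries.algebraMap_apply', PowerSeries.algebraMap_apply, Algebra.algebraMap_self_apply,
    HahnSeries.ofPowerSeries_C]
  exact HahnSeries.coeff_single_of_ne hm.ne

variable (Fq : Type*) [Field Fq] (n : ℕ)

theorem valuation_toLaurent_X_pow (m : ℕ) :
    Valued.v (toLaurent Fq n (X ^ m)) = exp (m : ℤ) := by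
  rw [map_pow, map_pow, toLaurent, aeval_X, LaurentSeries.valuation_single_zpow, neg_neg,
    ← exp_nsmul, nsmul_one]

theorem valuation_toLaurent_C_le_one (c : ZField Fq n) : Valued.v (toLaurent Fq n (C c)) ≤ 1 := by
  rw [toLaurent, aeval_C]
  exact valuation_algebraMap_le_one c

theorem valuation_toLaurent_le (p : (ZField Fq n)[X]) :
    Valued.v (toLaurent Fq n p) ≤ exp (p.natDegree : ℤ) := by
  conv_lhs => rw [p.as_sum_range_C_mul_X_pow, map_sum]
  refine Valued.v.map_sum_le fun i hi => ?_
  rw [map_mul, map_mul, valuation_toLaurent_X_pow]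
  refine (mul_le_of_le_one_left' (valuation_toLaurent_C_le_one Fq n _)).trans (exp_le_exp.2 ?_)
  exact_mod_cast Nat.lt_succ_iff.1 (Finset.mem_range.1 hi)

theorem valuation_toLaurent_of_monic {p : (ZField Fq n)[X]} (hp : p.Monic) :
    Valued.v (toLaurent Fq n p) = exp (p.natDegree : ℤ) := by
  have hsplit : p.eraseLead + X ^ p.natDegree = p := by
    simpa [hp.leadingCoeff] using p.eraseLead_add_C_mul_X_pow
  have hlt : Valued.v (toLaurent Fq n p.eraseLead) <
      Valued.v (toLaurent Fq n (X ^ p.natDegree)) := by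
    rw [valuation_toLaurent_X_pow]
    rcases p.eraseLead_natDegree_lt_or_eraseLead_eq_zero with hdeg | h0
    · exact (valuation_toLaurent_le Fq n _).trans_lt (exp_lt_exp.2 (by exact_mod_cast hdeg))
    · rw [h0, map_zero, map_zero]
      exact exp_pos
  rw [← valuation_toLaurent_X_pow Fq n, ← Valuation.map_add_eq_of_lt_right _ hlt, ← map_add, hsplit]

/-- The inclusion of `A` in `Fq(z_1, …, z_n)((θ⁻¹))`. -/
def embed : Fq[X] →+* LaurentSeries (ZField Fq n) := (toLaurent Fq n).toRingHom.comp (toZ Fq n)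

theorem valuation_embed_le (p : Fq[X]) : Valued.v (embed Fq n p) ≤ exp (p.natDegree : ℤ) := by
  rw [← natDegree_map (algebraMap Fq (ZField Fq n))]
  exact valuation_toLaurent_le Fq n _

theorem valuation_embed_of_monic {p : Fq[X]} (hp : p.Monic) :
    Valued.v (embed Fq n p) = exp (p.natDegree : ℤ) := by
  rw [← natDegree_map (algebraMap Fq (ZField Fq n))]
  exact valuation_toLaurent_of_monic Fq n (hp.map _)

theorem embed_ne_zero {p : Fq[X]} (hp : p.Monic) : embed Fq n p ≠ 0 := by
  rw [← Valued.v.ne_zero_iff, valuation_embed_of_monic Fq n hp]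
  exact exp_ne_zero

/-- The product `a(z_1) ⋯ a(z_n)` as an element of `Fq(z_1, …, z_n)((θ⁻¹))`. -/
def evalProd : Fq[X] →* LaurentSeries (ZField Fq n) where
  toFun a := toLaurent Fq n (C (∏ k : Fin n, aeval (z Fq k) a))
  map_one' := by simp only [map_one, Finset.prod_const_one]
  map_mul' a b := by simp only [map_mul, Finset.prod_mul_distrib]

theorem valuation_evalProd_le_one (a : Fq[X]) : Valued.v (evalProd Fq n a) ≤ 1 :=
  valuation_toLaurent_C_le_one Fq n _

end Valuation

/-! ### Unique factorization of monic polynomials -/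

section Factorization

variable {Fq : Type*} [Field Fq]

/-- The monic polynomial `∏ f ^ e(f)`. -/
def monicOfFinsupp (e : MonicPrime Fq →₀ ℕ) : MonicPoly Fq :=
  ⟨e.prod fun f m => f.1 ^ m, monic_prod_of_monic _ _ fun f _ => f.2.1.pow _⟩

theorem monicOfFinsupp_val (e : MonicPrime Fq →₀ ℕ) :
    (monicOfFinsupp e).1 = e.prod fun f m => f.1 ^ m := rfl

theorem emultiplicity_monicPrime_pow [DecidableEq (MonicPrime Fq)] (f g : MonicPrime Fq) (m : ℕ) :
    emultiplicity f.1 (g.1 ^ m) = if g = f then (m : ℕ∞) else 0 := by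
  split_ifs with hgf
  · rw [hgf, emultiplicity_pow_self f.2.2.ne_zero f.2.2.not_isUnit]
  · exact emultiplicity_eq_zero.2 fun hd =>
      hgf (MonicPrime.eq_of_dvd (f.2.2.prime.dvd_of_dvd_pow hd)).symm

theorem multiplicity_monicOfFinsupp (e : MonicPrime Fq →₀ ℕ) (f : MonicPrime Fq) :
    multiplicity f.1 (monicOfFinsupp e).1 = e f := by
  classical
  refine multiplicity_eq_of_emultiplicity_eq_some ?_
  rw [monicOfFinsupp_val, Finsupp.prod, Finset.emultiplicity_prod f.2.2.prime]
  simp only [emultiplicity_monicPrime_pow, Finset.sum_ite_eq', Finsupp.mem_support_iff]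
  split_ifs with hf
  · rfl
  · rw [not_not.1 hf, Nat.cast_zero]

theorem monicOfFinsupp_injective : Function.Injective (monicOfFinsupp (Fq := Fq)) := by
  intro e e' h
  ext f
  rw [← multiplicity_monicOfFinsupp, h, multiplicity_monicOfFinsupp]

theorem monicOfFinsupp_add_val (e e' : MonicPrime Fq →₀ ℕ) :
    (monicOfFinsupp (e + e')).1 = (monicOfFinsupp e).1 * (monicOfFinsupp e').1 :=
  Finsupp.prod_add_index' (fun _ => pow_zero _) fun _ _ _ => pow_add _ _ _

theorem monicOfFinsupp_single_val (f : MonicPrime Fq) (m : ℕ) :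
    (monicOfFinsupp (Finsupp.single f m)).1 = f.1 ^ m :=
  Finsupp.prod_single_index (pow_zero f.1)

theorem exists_monicOfFinsupp_val_eq (a : Fq[X]) (ha : a.Monic) :
    ∃ e, (monicOfFinsupp e).1 = a := by
  induction hm : a.natDegree using Nat.strong_induction_on generalizing a with
  | _ m ih =>
    by_cases hu : IsUnit a
    · exact ⟨0, (ha.eq_one_of_isUnit hu).symm⟩
    obtain ⟨g, hg, hgirr, b, rfl⟩ := exists_monic_irreducible_factor a hu
    have hb : b.Monic := hg.of_mul_monic_left ha
    have hdeg : b.natDegree < m := by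
      rw [← hm, hg.natDegree_mul hb]
      exact Nat.lt_add_of_pos_left hgirr.natDegree_pos
    obtain ⟨e, rfl⟩ := ih _ hdeg b hb rfl
    exact ⟨Finsupp.single ⟨g, hg, hgirr⟩ 1 + e, by
      rw [monicOfFinsupp_add_val, monicOfFinsupp_single_val, pow_one]⟩

/-- The bijection `e ↦ ∏ f ^ e(f)` of unique factorization. -/
def monicEquiv : (MonicPrime Fq →₀ ℕ) ≃ MonicPoly Fq :=
  Equiv.ofBijective monicOfFinsupp ⟨monicOfFinsupp_injective, fun a =>
    (exists_monicOfFinsupp_val_eq a.1 a.2).imp fun _ => Subtype.ext⟩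

theorem finite_natDegree_le [Finite Fq] (N : ℕ) :
    {a : MonicPoly Fq | a.1.natDegree ≤ N}.Finite := by
  have : Finite (degreeLT Fq (N + 1)) := .of_equiv _ (degreeLTEquiv Fq (N + 1)).toEquiv.symm
  refine Set.Finite.of_injOn (f := Subtype.val) (t := (degreeLT Fq (N + 1) : Set Fq[X]))
    (fun a ha => ?_) Subtype.val_injective.injOn (Set.toFinite _)
  rw [SetLike.mem_coe, mem_degreeLT]
  exact (degree_le_of_natDegree_le ha).trans_lt (by exact_mod_cast Nat.lt_succ_self N)

end Factorization

/-! ### Expansion of the Euler product -/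

theorem prod_exp_neg_natCast {ι : Type*} (s : Finset ι) (w : ι → ℕ) :
    ∏ i ∈ s, WithZero.exp (-(w i : ℤ)) = WithZero.exp (-((∑ i ∈ s, w i : ℕ) : ℤ)) := by
  induction s using Finset.cons_induction with
  | empty => rfl
  | cons i s hi ih =>
    rw [Finset.prod_cons, Finset.sum_cons, ih, ← WithZero.exp_add, Nat.cast_add, neg_add]

namespace DrinfeldModule

open WithZero

variable {Fq : Type*} [Field Fq] [Fintype Fq] {r : ℕ} (φ : DrinfeldModule Fq r) (n : ℕ)
  (f : MonicPrime Fq)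

theorem eulerFactor_coeff_zero : (φ.eulerFactor f).coeff 0 = 1 := by
  simp [eulerFactor]

theorem muPrimePow_zero : φ.muPrimePow f 0 = 1 := by
  simp [muPrimePow]

/-- The power series `D_f(f(z_1) ⋯ f(z_n) x / f)`. -/
def localDenominator : PowerSeries (LaurentSeries (ZField Fq n)) :=
  PowerSeries.rescale (evalProd Fq n f.1 / embed Fq n f.1)
    (PowerSeries.map (embed Fq n) (φ.eulerFactor f : PowerSeries Fq[X]))

/-- The power series `∑ μ(f ^ m) f(z_1) ^ m ⋯ f(z_n) ^ m x ^ m / f ^ m`, the inverse of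
`localDenominator`. -/
def localSeries : PowerSeries (LaurentSeries (ZField Fq n)) :=
  PowerSeries.rescale (evalProd Fq n f.1 / embed Fq n f.1)
    (PowerSeries.map (embed Fq n) (PowerSeries.invOfUnit (φ.eulerFactor f : PowerSeries Fq[X]) 1))

theorem localSeries_mul_localDenominator :
    φ.localSeries n f * φ.localDenominator n f = 1 := by
  rw [localSeries, localDenominator, ← map_mul, ← map_mul, PowerSeries.invOfUnit_mul, map_one,
    map_one]
  rw [Polynomial.constantCoeff_coe, eulerFactor_coeff_zero, Units.val_one]

theorem coeff_localSeries (m : ℕ) : PowerSeries.coeff m (φ.localSeries n f) =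
    (evalProd Fq n f.1 / embed Fq n f.1) ^ m * embed Fq n (φ.muPrimePow f m) := by
  rw [localSeries, PowerSeries.coeff_rescale, PowerSeries.coeff_map, muPrimePow]

theorem coeff_localDenominator_zero : PowerSeries.coeff 0 (φ.localDenominator n f) = 1 := by
  rw [localDenominator, PowerSeries.coeff_rescale, PowerSeries.coeff_map, Polynomial.coeff_coe,
    eulerFactor_coeff_zero, map_one, pow_zero, mul_one]

theorem coeff_localDenominator (i : ℕ) : PowerSeries.coeff i (φ.localDenominator n f) =
    embed Fq n ((φ.localPoly f).coeff i) * evalProd Fq n f.1 ^ i / embed Fq n f.1 := by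
  have hf := embed_ne_zero Fq n f.2.1
  have hcoeff := congrArg (embed Fq n) (φ.eulerFactor_coeff_mul f i)
  rw [map_mul, map_mul, map_pow] at hcoeff
  rw [localDenominator, PowerSeries.coeff_rescale, PowerSeries.coeff_map, Polynomial.coeff_coe,
    div_pow, div_mul_eq_mul_div, div_eq_div_iff (pow_ne_zero i hf) hf, mul_assoc, hcoeff]
  ring

theorem pow_valuation_coeff_localDenominator_le (i : ℕ) :
    Valued.v (PowerSeries.coeff i (φ.localDenominator n f)) ^ r ≤
      exp (-(f.1.natDegree * i : ℕ) : ℤ) := by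
  rcases eq_or_ne ((φ.localPoly f).coeff i) 0 with h0 | h0
  · rw [coeff_localDenominator, h0, map_zero, zero_mul, zero_div, map_zero,
      zero_pow (Nat.ne_zero_of_lt φ.rank_pos)]
    exact zero_le
  have hcoeff : Valued.v (PowerSeries.coeff i (φ.localDenominator n f)) ≤
      exp (((φ.localPoly f).coeff i).natDegree - f.1.natDegree : ℤ) := by
    rw [coeff_localDenominator, map_div₀, map_mul, map_pow, valuation_embed_of_monic Fq n f.2.1,
      exp_sub]
    exact div_le_div_of_nonneg_right ((mul_le_of_le_one_right' (pow_le_one₀ zero_le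
      (valuation_evalProd_le_one Fq n f.1))).trans (valuation_embed_le Fq n _)) zero_le
  have hdeg : (r * ((φ.localPoly f).coeff i).natDegree + f.1.natDegree * i : ℤ) ≤
      r * f.1.natDegree := by
    exact_mod_cast φ.natDegree_coeff_localPoly_le f h0
  refine (pow_le_pow_left₀ zero_le hcoeff r).trans ?_
  rw [← exp_nsmul, exp_le_exp, nsmul_eq_mul]
  push_cast
  linarith

theorem inv_taelmanFactor : (φ.taelmanFactor n f)⁻¹ =
    (φ.localPoly f).eval₂ (embed Fq n) (evalProd Fq n f.1) / embed Fq n f.1 := by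
  rw [taelmanFactor, fittingGenerator_quotient (g := toZ Fq n f.1) (f.2.1.map _),
    fittingGenerator_twistModule, inv_div]
  exact congrArg (· / _) (hom_eval₂ _ _ (toLaurent Fq n).toRingHom _)

theorem hasSum_localDenominator :
    HasSum (fun i => PowerSeries.coeff i (φ.localDenominator n f)) (φ.taelmanFactor n f)⁻¹ := by
  rw [inv_taelmanFactor, eval₂_eq_sum_range, Finset.sum_div]
  simp only [← coeff_localDenominator]
  refine hasSum_sum_of_ne_finset_zero fun i hi => ?_
  rw [coeff_localDenominator, coeff_eq_zero_of_natDegree_lt, map_zero, zero_mul, zero_div]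
  simpa using hi

theorem hasSum_localSeries :
    HasSum (fun i => PowerSeries.coeff i (φ.localSeries n f)) (φ.taelmanFactor n f) := by
  rw [← inv_inv (φ.taelmanFactor n f)]
  exact hasSum_coeff_inv (Nat.ne_zero_of_lt φ.rank_pos) f.2.2.natDegree_pos
    (φ.localSeries_mul_localDenominator n f) (φ.coeff_localDenominator_zero n f)
    (φ.pow_valuation_coeff_localDenominator_le n f) (φ.hasSum_localDenominator n f)

theorem mu_monicOfFinsupp (e : MonicPrime Fq →₀ ℕ) :
    φ.mu (monicOfFinsupp e) = e.prod φ.muPrimePow := by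
  simp only [mu, multiplicity_monicOfFinsupp]
  refine finprod_eq_prod_of_mulSupport_subset _ fun f hf => Finsupp.mem_support_iff.2 fun h0 => ?_
  rw [Function.mem_mulSupport, h0, muPrimePow_zero] at hf
  exact hf rfl

theorem pellarinTerm_eq (a : MonicPoly Fq) :
    φ.pellarinTerm n a = embed Fq n (φ.mu a) * evalProd Fq n a.1 / embed Fq n a.1 := by
  rw [pellarinTerm, map_mul, ← map_prod C]
  rfl

theorem pellarinTerm_monicOfFinsupp (e : MonicPrime Fq →₀ ℕ) :
    φ.pellarinTerm n (monicOfFinsupp e) =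
      e.prod fun f m => PowerSeries.coeff m (φ.localSeries n f) := by
  rw [pellarinTerm_eq, mu_monicOfFinsupp, monicOfFinsupp_val]
  simp only [Finsupp.prod, map_prod, map_pow, coeff_localSeries]
  rw [← Finset.prod_mul_distrib, ← Finset.prod_div_distrib]
  exact Finset.prod_congr rfl fun f _ => by rw [div_pow, div_mul_eq_mul_div, mul_comm]

theorem pow_valuation_pellarinTerm_le (e : MonicPrime Fq →₀ ℕ) :
    Valued.v (φ.pellarinTerm n (monicOfFinsupp e)) ^ r ≤
      exp (-((monicOfFinsupp e).1.natDegree : ℤ)) := by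
  have hdeg : (monicOfFinsupp e).1.natDegree = ∑ f ∈ e.support, f.1.natDegree * e f := by
    rw [monicOfFinsupp_val, Finsupp.prod, natDegree_prod_of_monic _ _ fun f _ => f.2.1.pow _]
    exact Finset.sum_congr rfl fun f _ => by rw [f.2.1.natDegree_pow, mul_comm]
  rw [pellarinTerm_monicOfFinsupp, hdeg, ← prod_exp_neg_natCast, Finsupp.prod, map_prod,
    ← Finset.prod_pow]
  exact Finset.prod_le_prod' fun f _ =>
    pow_valuation_coeff_inv_le (Nat.ne_zero_of_lt φ.rank_pos)
      (φ.localSeries_mul_localDenominator n f) (φ.coeff_localDenominator_zero n f)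
      (φ.pow_valuation_coeff_localDenominator_le n f) (e f)

theorem summable_pellarinTerm :
    Summable fun e : MonicPrime Fq →₀ ℕ => φ.pellarinTerm n (monicOfFinsupp e) :=
  summable_of_pow_valuation_le (w := fun e => (monicOfFinsupp e).1.natDegree)
    (fun N => (finite_natDegree_le N).preimage monicOfFinsupp_injective.injOn)
    (φ.pow_valuation_pellarinTerm_le n)

theorem hasProd_taelmanFactor : HasProd (fun f : MonicPrime Fq => φ.taelmanFactor n f)
    (∑' e : MonicPrime Fq →₀ ℕ, φ.pellarinTerm n (monicOfFinsupp e)) := by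
  have := nonarchimedeanRing_of_valued (K := LaurentSeries (ZField Fq n))
  have hsum := (φ.summable_pellarinTerm n).hasSum
  simp only [pellarinTerm_monicOfFinsupp] at hsum ⊢
  refine hasProd_of_hasSum_finsuppProd (fun f => ?_) (φ.hasSum_localSeries n) hsum
  rw [coeff_localSeries, muPrimePow_zero, map_one, pow_zero, mul_one]

theorem hasSum_pellarinTerm :
    HasSum (fun a : MonicPoly Fq => φ.pellarinTerm n a) (φ.taelmanLValue n) := by
  rw [← monicEquiv.hasSum_iff, taelmanLValue, (φ.hasProd_taelmanFactor n).tprod_eq]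
  exact (φ.summable_pellarinTerm n).hasSum

end DrinfeldModule

end Taelman

end

theorem theorem1p1 {Fq : Type*} [Field Fq] [Fintype Fq] {r : ℕ}
    (φ : Taelman.DrinfeldModule Fq r) (n : ℕ) :
    Multipliable (fun f : Taelman.MonicPrime Fq => φ.taelmanFactor n f) ∧
      HasSum (fun a : Taelman.MonicPoly Fq => φ.pellarinTerm n a) (φ.taelmanLValue n) :=
  ⟨(φ.hasProd_taelmanFactor n).multipliable, φ.hasSum_pellarinTerm n⟩
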